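/- Let $N$ be a lattice (a free abelian group of finite rank), $N^+ = N\oplus\mathbb Z$, $N_{\mathbb Q}=N\otimes_{\mathbb Z}\mathbb Q$, $N^+_{\mathbb Q}=N^+\otimes_{\mathbb Z}\mathbb Q$, and let $\pi: N^+_{\mathbb Q}\to N_{\mathbb Q}$ be the projection induced by $N\oplus\mathbb Z\to N$. A cone of $N^+_{\mathbb Q}$ is simplicial if it is generated by a finite linearly independent family; it is $\pi$-strictly convex if its image under $\pi$ contains no line. A simplicial fan of $N^+_{\mathbb Q}$ means here a finite set of simplicial, $\pi$-strictly convex cones that contains every face of each of its cones and in which the intersection of any two cones is a face of both. A cone $\sigma$ is $\pi$-independent if $\pi|_\sigma$ is injective; a $\pi$-independent cone $\sigma$ is $\pi$-nonsingular if $\pi(\sigma)$ is generated by a subset of a $\mathbb Z$-basis of $N$. A fan is $\pi$-nonsingular if all its $\pi$-independent cones are $\pi$-nonsingular. The star subdivision of a fan $\Sigma$ at a nonzero vector $\rho$ of its support consists of the cones of $\Sigma$ that do not contain $\rho$ and of the cones $\tau+\mathbb Q_{\ge 0}\,\rho$, where $\tau\in\Sigma$ does not contain $\rho$ and is contained in a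 cone of $\Sigma$ that contains $\rho$. Theorem. For every simplicial fan $\Sigma$ of $N^+_{\mathbb Q}$ there is a finite sequence of simplicial fans $\Sigma=\Sigma_0,\Sigma_1,\dots,\Sigma_k$ of $N^+_{\mathbb Q}$ such that $\Sigma_{i+1}$ is a star subdivision of $\Sigma_i$ for every $0\le i<k$, the fan $\Sigma_k$ is $\pi$-nonsingular, and every $\pi$-independent $\pi$-nonsingular cone of $\Sigma$ is a cone of each of the fans $\Sigma_0,\dots,\Sigma_k$. -/

import Mathlib

open scoped TensorProduct

namespace ToricFan

/-- The rational vector space `N_ℚ` of a lattice `N`. -/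
abbrev NQ (N : Type*) [AddCommGroup N] : Type _ := ℚ ⊗[ℤ] N

/-- The rational vector space `N⁺_ℚ` of the lattice `N⁺ = N ⊕ ℤ`. -/
abbrev NPlusQ (N : Type*) [AddCommGroup N] : Type _ := ℚ ⊗[ℤ] (N × ℤ)

/-- The projection `π : N⁺_ℚ → N_ℚ` induced by the projection `N ⊕ ℤ → N`. -/
noncomputable def proj (N : Type*) [AddCommGroup N] : NPlusQ N →ₗ[ℚ] NQ N :=
  (LinearMap.fst ℤ N ℤ).baseChange ℚ

/-- A cone of `N_ℚ` is nonsingular if it is generated by a subfamily of a `ℤ`-basis of `N`. -/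
def IsNonsingular {N : Type*} [AddCommGroup N] (C : PointedCone ℚ (NQ N)) : Prop :=
  ∃ (b : Module.Basis (Fin (Module.finrank ℤ N)) ℤ N) (s : Set (Fin (Module.finrank ℤ N))),
    C = PointedCone.hull ℚ ((fun i => (1 : ℚ) ⊗ₜ[ℤ] b i) '' s)

/-- A cone `σ` of `N⁺_ℚ` is `π`-strictly convex if `π(σ)` contains no line. -/
def IsPiStrictlyConvex {N : Type*} [AddCommGroup N] (σ : PointedCone ℚ (NPlusQ N)) : Prop :=
  (PointedCone.map (proj N) σ).toConvexCone.Salient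

/-- A cone `σ` of `N⁺_ℚ` is `π`-independent if `π` is injective on `σ`. -/
def IsPiIndependent {N : Type*} [AddCommGroup N] (σ : PointedCone ℚ (NPlusQ N)) : Prop :=
  Set.InjOn (proj N) (σ : Set (NPlusQ N))

/-- `π`-nonsingularity of a cone is a notion for `π`-independent cones only: it means that the
projection `π(σ)` is a nonsingular cone of `N_ℚ`. -/
def IsPiNonsingularCone {N : Type*} [AddCommGroup N] (σ : PointedCone ℚ (NPlusQ N)) : Prop :=
  IsPiIndependent σ ∧ IsNonsingular (PointedCone.map (proj N) σ)

/-- Simplicial fans of `N⁺_ℚ` with `π`-strictly convex cones. Since the scalars are rational,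
every linearly independent family can be rescaled to one of elements of `N⁺` without changing
the cone that it generates, so that simplicial cones are automatically rational. -/
structure IsSimplicialFan {N : Type*} [AddCommGroup N]
    (S : Set (PointedCone ℚ (NPlusQ N))) : Prop where
  finite : S.Finite
  simplicial : ∀ σ ∈ S, σ.IsSimplicial
  piStrictlyConvex : ∀ σ ∈ S, IsPiStrictlyConvex σ
  face_mem : ∀ σ ∈ S, ∀ τ : PointedCone ℚ (NPlusQ N), τ.IsFaceOf σ → τ ∈ S
  inf_face : ∀ σ ∈ S, ∀ τ ∈ S, (σ ⊓ τ).IsFaceOf σ ∧ (σ ⊓ τ).IsFaceOf τ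

/-- A fan is `π`-nonsingular if all its `π`-independent cones are `π`-nonsingular. -/
def IsPiNonsingular {N : Type*} [AddCommGroup N] (S : Set (PointedCone ℚ (NPlusQ N))) : Prop :=
  ∀ σ ∈ S, IsPiIndependent σ → IsPiNonsingularCone σ

/-- The star subdivision of the fan `S` at `ρ`: the cones of `S` that do not contain `ρ`, together
with the cones `τ + ℚ≥0 ρ`, where `τ` runs through the cones of `S` that do not contain `ρ` and
that are contained in a cone of `S` which contains `ρ`. -/
def starSubdivision {N : Type*} [AddCommGroup N] (S : Set (PointedCone ℚ (NPlusQ N)))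
    (ρ : NPlusQ N) : Set (PointedCone ℚ (NPlusQ N)) :=
  {σ | σ ∈ S ∧ ρ ∉ σ} ∪
    {σ | ∃ τ ∈ S, ρ ∉ τ ∧ (∃ δ ∈ S, τ ≤ δ ∧ ρ ∈ δ) ∧ σ = τ ⊔ PointedCone.hull ℚ {ρ}}

/-- `S'` is a star subdivision of `S`, at some nonzero vector of the support of `S`. -/
def IsStarSubdivision {N : Type*} [AddCommGroup N]
    (S S' : Set (PointedCone ℚ (NPlusQ N))) : Prop :=
  ∃ ρ : NPlusQ N, ρ ≠ 0 ∧ (∃ σ ∈ S, ρ ∈ σ) ∧ S' = starSubdivision S ρ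

end ToricFan

namespace ToricFan
-- Index of a generated lattice in its saturation
section LatticeIndex
open scoped Classical

/-! The kernel of `π` is a line, so the projected vertices of a simplicial cone `δ` satisfy at most
one linear relation `r` up to scaling. Its support is a circuit, and a face of `δ` is
`π`-independent exactly when it does not contain the circuit. The multiplicity of an independent
cone is the index of the lattice spanned by its projected vertices in the saturation of that
lattice. After rescaling, `|r l|` is the multiplicity of the facet `δ.erase l` for every `l` in the
circuit (`IsRelation.exists_normal`). Subdividing at `ρ = ∑ c v • v` and dropping a vertex `i` with
`c i ≠ 0` turns `r` into the relation `cross`, whose coefficients are `r i` at `ρ` and the minors `c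
i * r k - r i * c k` elsewhere. It is again normalized (`IsNormalRelation.cross`), so these numbers
control all new multiplicities.

The fan is `π`-nonsingular once all independent cones have multiplicity one, and a bound `M ≥ 2` for
the multiplicities is lowered step by step. Two kinds of centers are used. A point of the half-open
parallelotope of an independent cone gives only new multiplicities below `M`, provided that no
circuit takes both signs on the support of the point (`IsCodefinite.subdivide`). An interior point
of a circuit with the same projection as the sum of the positive vertices never violates the bound
`M` (`IsMultBound.circuit`). Repeated subdivisions at such points produce the required
codefiniteness (`exists_isCodefinite`), because the circuits involved descend through a discrete
scale of levels.

The danger is that circuit subdivisions create new cones of multiplicity `M`. With the sign of the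
circuit chosen suitably, this happens only for relations attaining both `M` and `-M`. For fixed `M`,
the relations of this kind with several coefficients of each sign (bad) are removed first. Those
with exactly one sign occurring once (good) come next, each by a parallelotope point. What remains
are relations between two parallel vertices. These do no harm: such a circuit with both signs on a
face of an independent cone would be contained in that cone. The cones of multiplicity `M` can then
be removed one by one (`exists_mult_eq_empty`).

Every center lies in the relative interior of a cone that is not unimodular, and faces of unimodular
cones are unimodular, so nonsingular cones survive. For this, the vertices of the initial fan are
scaled to project to basis vectors of `N` whenever possible. -/

theorem relIndex_eq_map_mul_ker {G H : Type*} [AddCommGroup G] [AddCommGroup H] (f : G →+ H)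
    {A L : AddSubgroup G} (h : A ≤ L) :
    A.relIndex L = (A.map f).relIndex (L.map f) * (A ⊓ f.ker).relIndex (L ⊓ f.ker) := by
  have h1 : A ⊔ (L ⊓ f.ker) ≤ L := sup_le h inf_le_left
  rw [← AddSubgroup.relIndex_mul_relIndex _ _ _ le_sup_left h1, AddSubgroup.relIndex_sup_left,
    mul_comm]
  congr 1
  · rw [← AddSubgroup.relIndex_comap, ← AddSubgroup.inf_relIndex_right, ←
      AddSubgroup.inf_relIndex_right ((A.map f).comap f)]
    congr 1
    ext x
    simp only [AddSubgroup.mem_inf, AddSubgroup.mem_comap, AddSubgroup.mem_map]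
    constructor
    · rintro ⟨hx, hxL⟩
      obtain ⟨a, ha, b, hb, rfl⟩ := AddSubgroup.mem_sup.1 hx
      have hb' : f b = 0 := hb.2
      exact ⟨⟨a, ha, by simp [hb']⟩, hxL⟩
    · rintro ⟨⟨a, ha, hax⟩, hxL⟩
      refine ⟨AddSubgroup.mem_sup.2 ⟨a, ha, x - a, ⟨L.sub_mem hxL (h ha), ?_⟩, by simp⟩, hxL⟩
      simp [hax]
  · rw [← AddSubgroup.inf_relIndex_right]
    congr 1
    rw [← inf_assoc, inf_eq_left.2 h]

/-- With `β = p / q`, the groups generated by `1` and by `β` share the subgroup generated by `p = q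
* β`. Its index in `C` is computed through each of them. The identity also covers infinite index,
where `relIndex` is zero. -/
theorem relIndex_zmultiples_rat (C : AddSubgroup ℚ) {β : ℚ} (hβ : β ≠ 0) (h1 : 1 ∈ C)
    (hC : β ∈ C) :
    ((AddSubgroup.zmultiples β).relIndex C : ℚ) =
      |β| * ((AddSubgroup.zmultiples (1 : ℚ)).relIndex C : ℚ) := by
  have key : ∀ (x : ℚ) (n : ℤ), x ≠ 0 → n ≠ 0 →
      (AddSubgroup.zmultiples (n • x)).relIndex (AddSubgroup.zmultiples x) = n.natAbs := by
    intro x n hx hn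
    have hinj : Function.Injective (zmultiplesHom ℚ x) := by
      intro a b hab
      simpa [hx] using hab
    have e1 : AddSubgroup.zmultiples (n • x) =
        (AddSubgroup.zmultiples n).map (zmultiplesHom ℚ x) := by
      rw [AddMonoidHom.map_zmultiples]; simp
    have e2 : AddSubgroup.zmultiples x = (⊤ : AddSubgroup ℤ).map (zmultiplesHom ℚ x) := by
      ext y; simp [AddSubgroup.mem_zmultiples_iff]
    rw [e1, e2, AddSubgroup.relIndex_map_map_of_injective _ _ hinj, AddSubgroup.relIndex_top_right,
      Int.index_zmultiples]
  have hp : β.num ≠ 0 := Rat.num_ne_zero.2 hβ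
  have hq : (β.den : ℤ) ≠ 0 := by exact_mod_cast β.den_nz
  have e : β.num • (1 : ℚ) = (β.den : ℤ) • β := by
    simp only [zsmul_eq_mul, mul_one]
    push_cast
    rw [mul_comm, Rat.mul_den_eq_num]
  have le1 : ∀ (x : ℚ) (n : ℤ), AddSubgroup.zmultiples (n • x) ≤ AddSubgroup.zmultiples x :=
    fun x n => by
      rw [AddSubgroup.zmultiples_le]
      exact AddSubgroup.zsmul_mem _ (AddSubgroup.mem_zmultiples x) n
  have A := AddSubgroup.relIndex_mul_relIndex _ _ C (le1 1 β.num)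
    (AddSubgroup.zmultiples_le.2 h1)
  have B := AddSubgroup.relIndex_mul_relIndex _ _ C (le1 β β.den)
    (AddSubgroup.zmultiples_le.2 hC)
  rw [key _ _ one_ne_zero hp] at A
  rw [key _ _ hβ hq, ← e, ← A] at B
  have B' : (β.den : ℚ) * ((AddSubgroup.zmultiples β).relIndex C : ℚ) =
      |(β.num : ℚ)| * ((AddSubgroup.zmultiples (1 : ℚ)).relIndex C : ℚ) := by
    have := congrArg (Nat.cast : ℕ → ℚ) B
    push_cast at this
    rw [Nat.cast_natAbs, Nat.cast_natAbs] at this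
    simpa using this
  have hd : (0 : ℚ) < β.den := by exact_mod_cast β.den_pos
  have hb : |β| = |(β.num : ℚ)| / β.den := by
    conv_lhs => rw [← Rat.num_div_den β]
    rw [abs_div, abs_of_pos hd]
  rw [hb, div_mul_eq_mul_div, eq_div_iff hd.ne', ← B', mul_comm]

variable {W : Type*} [AddCommGroup W] [Module ℚ W]

/-- The index of the lattice generated by `T` in the lattice of the points of `L` that lie in the
rational span of `T`. -/
noncomputable def latticeIndex (L : AddSubgroup W) (T : Set W) : ℕ :=
  (AddSubgroup.closure T).relIndex (L ⊓ (Submodule.span ℚ T).toAddSubgroup)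

theorem closure_le_inf_span {L : AddSubgroup W} {T : Set W} (hT : T ⊆ L) :
    AddSubgroup.closure T ≤ L ⊓ (Submodule.span ℚ T).toAddSubgroup := by
  rw [AddSubgroup.closure_le]
  exact fun x hx => ⟨hT hx, Submodule.subset_span hx⟩

theorem exists_nsmul_mem_closure {T : Set W} {x : W} (hx : x ∈ Submodule.span ℚ T) :
    ∃ n : ℕ, n ≠ 0 ∧ n • x ∈ AddSubgroup.closure T := by
  induction hx using Submodule.span_induction with
  | mem x h => exact ⟨1, one_ne_zero, by simpa using AddSubgroup.subset_closure h⟩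
  | zero => exact ⟨1, one_ne_zero, by simp⟩
  | add x y _ _ hx hy =>
    obtain ⟨n, hn, hx⟩ := hx
    obtain ⟨m, hm, hy⟩ := hy
    refine ⟨n * m, mul_ne_zero hn hm, ?_⟩
    rw [smul_add]
    refine add_mem ?_ ?_
    · rw [mul_comm, mul_smul]; exact AddSubgroup.nsmul_mem _ hx m
    · rw [mul_smul]; exact AddSubgroup.nsmul_mem _ hy n
  | smul a x _ hx =>
    obtain ⟨n, hn, hx⟩ := hx
    refine ⟨a.den * n, mul_ne_zero a.den_nz hn, ?_⟩
    have : (a.den * n) • a • x = a.num • n • x := by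
      simp only [← Nat.cast_smul_eq_nsmul ℚ, ← Int.cast_smul_eq_zsmul ℚ, smul_smul]
      congr 1
      push_cast
      rw [mul_right_comm, Rat.den_mul_eq_num]
    rw [this]
    exact AddSubgroup.zsmul_mem _ hx _

/-- The index is finite: the quotient is finitely generated, and it is torsion because every point
of the rational span has a multiple in the generated lattice. -/
theorem latticeIndex_ne_zero {L : AddSubgroup W} (hL : L.FG) (T : Set W) :
    latticeIndex L T ≠ 0 := by
  have hfg : (L ⊓ (Submodule.span ℚ T).toAddSubgroup).FG := by
    have h1 : (AddSubgroup.toIntSubmodule L).FG := by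
      rw [Submodule.fg_iff_addSubgroup_fg]; simpa using hL
    have h2 : IsNoetherian ℤ (AddSubgroup.toIntSubmodule L) :=
      isNoetherian_of_fg_of_noetherian _ h1
    have h3 : (AddSubgroup.toIntSubmodule (L ⊓ (Submodule.span ℚ T).toAddSubgroup)).FG :=
      h1.of_le (by intro x hx; exact hx.1)
    exact (Submodule.fg_iff_addSubgroup_fg _).1 h3
  set A := L ⊓ (Submodule.span ℚ T).toAddSubgroup with hA
  unfold latticeIndex
  rw [← hA]
  have : AddGroup.FG A := (AddGroup.fg_iff_addSubgroup_fg _).2 hfg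
  have hfin : Finite (A ⧸ (AddSubgroup.closure T).addSubgroupOf A) := by
    have : Module.Finite ℤ (A ⧸ (AddSubgroup.closure T).addSubgroupOf A) :=
      Module.Finite.iff_addGroup_fg.2 inferInstance
    apply Module.finite_of_fg_torsion
    intro x
    induction x using QuotientAddGroup.induction_on with
    | H x =>
    obtain ⟨n, hn, h⟩ := exists_nsmul_mem_closure (T := T) (x := (x : W)) x.2.2
    refine ⟨⟨n, by simpa using hn⟩, ?_⟩
    change (n : ℤ) • (QuotientAddGroup.mk x : A ⧸ (AddSubgroup.closure T).addSubgroupOf A) = 0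
    rw [← QuotientAddGroup.mk_zsmul, QuotientAddGroup.eq_zero_iff]
    simpa [AddSubgroup.mem_addSubgroupOf] using h
  exact AddSubgroup.index_ne_zero_of_finite

theorem exists_linearMap_eq_one {T : Set W} {w : W} (hw : w ∉ Submodule.span ℚ T) :
    ∃ f : W →ₗ[ℚ] ℚ, f w = 1 ∧ ∀ x ∈ Submodule.span ℚ T, f x = 0 := by
  obtain ⟨f, hf, hT⟩ := Submodule.exists_le_ker_of_notMem hw
  refine ⟨(f w)⁻¹ • f, by simp [hf], fun x hx => ?_⟩
  have : f x = 0 := hT hx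
  simp [this]

/-- Multiplicativity of the index along `f`: on the generated lattice, `f` has image `ℤ * f u` and
kernel the lattice of `T`; on the saturated one its kernel is the saturated lattice of `T`. -/
theorem latticeIndex_insert {L : AddSubgroup W} {T : Set W} {u : W} (hT : T ⊆ L) (hu : u ∈ L)
    {f : W →ₗ[ℚ] ℚ} (hf : f u ≠ 0) (hfT : ∀ x ∈ Submodule.span ℚ T, f x = 0) :
    latticeIndex L (insert u T) = (AddSubgroup.zmultiples (f u)).relIndex
      ((L ⊓ (Submodule.span ℚ (insert u T)).toAddSubgroup).map f.toAddMonoidHom) *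
        latticeIndex L T := by
  have hcl : ∀ x ∈ AddSubgroup.closure T, x ∈ Submodule.span ℚ T := fun x hx =>
    (closure_le_inf_span (L := ⊤) (fun _ _ => trivial) hx).2
  unfold latticeIndex
  rw [relIndex_eq_map_mul_ker f.toAddMonoidHom
    (closure_le_inf_span (Set.insert_subset hu hT))]
  have hins : ∀ x, x ∈ AddSubgroup.closure (insert u T) ↔
      ∃ n : ℤ, ∃ t ∈ AddSubgroup.closure T, n • u + t = x := by
    intro x
    rw [Set.insert_eq, AddSubgroup.closure_union, AddSubgroup.mem_sup]
    simp [AddSubgroup.mem_closure_singleton]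
  congr 2
  · ext y
    simp only [AddSubgroup.mem_map, hins, AddSubgroup.mem_zmultiples_iff]
    constructor
    · rintro ⟨x, ⟨n, t, ht, rfl⟩, rfl⟩
      exact ⟨n, by simp [hfT _ (hcl t ht)]⟩
    · rintro ⟨n, rfl⟩
      exact ⟨n • u, ⟨n, 0, zero_mem _, by simp⟩, by simp⟩
  · ext x
    simp only [AddSubgroup.mem_inf, hins, AddMonoidHom.mem_ker]
    constructor
    · rintro ⟨⟨n, t, ht, rfl⟩, h⟩
      simp [hfT _ (hcl t ht), hf] at h
      simpa [h] using ht
    · intro h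
      exact ⟨⟨0, x, h, by simp⟩, hfT _ (hcl x h)⟩
  · ext x
    simp only [AddSubgroup.mem_inf, AddMonoidHom.mem_ker, Submodule.mem_toAddSubgroup,
      Submodule.mem_span_insert]
    constructor
    · rintro ⟨⟨hxL, a, z, hz, rfl⟩, h⟩
      simp [hfT _ hz, hf] at h
      subst h
      exact ⟨hxL, by simpa using hz⟩
    · rintro ⟨hxL, hx⟩
      exact ⟨⟨hxL, 0, x, hx, by simp⟩, hfT _ hx⟩

/-- Both sets have the same span, so in `latticeIndex_insert` only the generator of the image
changes. A functional that is `1` on `w` and vanishes on `T` is `β` on `u`. -/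
theorem latticeIndex_replace {L : AddSubgroup W} {T : Set W} {w u : W} {β : ℚ} (hT : T ⊆ L)
    (hwL : w ∈ L) (huL : u ∈ L) (hw : w ∉ Submodule.span ℚ T) (hβ : β ≠ 0)
    (hu : u - β • w ∈ Submodule.span ℚ T) :
    (latticeIndex L (insert u T) : ℚ) = |β| * latticeIndex L (insert w T) := by
  obtain ⟨f, hfw, hfT⟩ := exists_linearMap_eq_one hw
  have hfu : f u = β := by
    have := hfT _ hu
    simp [hfw] at this
    linarith
  have hspan : Submodule.span ℚ (insert u T) = Submodule.span ℚ (insert w T) := by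
    have hsub : ∀ a, Submodule.span ℚ T ≤ Submodule.span ℚ (insert a T) := fun a =>
      Submodule.span_mono (Set.subset_insert _ _)
    have hmem : ∀ a, a ∈ Submodule.span ℚ (insert a T) := fun a =>
      Submodule.subset_span (Set.mem_insert _ _)
    apply le_antisymm <;> rw [Submodule.span_le] <;> refine Set.insert_subset ?_
      (Submodule.subset_span.trans (hsub _))
    · have := add_mem (hsub w hu) (Submodule.smul_mem _ β (hmem w))
      simpa using this
    · have := Submodule.smul_mem _ β⁻¹ (sub_mem (hmem u) (hsub u hu))
      simpa [smul_smul, hβ] using this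
  rw [latticeIndex_insert hT huL (f := f) (by rwa [hfu]) hfT,
    latticeIndex_insert hT hwL (f := f) (by rw [hfw]; exact one_ne_zero) hfT, hspan, hfw, hfu]
  push_cast
  rw [relIndex_zmultiples_rat _ hβ, mul_assoc]
  · exact ⟨w, ⟨hwL, Submodule.subset_span (Set.mem_insert _ _)⟩, hfw⟩
  · exact ⟨u, ⟨huL, hspan ▸ Submodule.subset_span (Set.mem_insert _ _)⟩, hfu⟩

theorem latticeIndex_le_insert {L : AddSubgroup W} (hL : L.FG) {T : Set W} {w : W} (hT : T ⊆ L)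
    (hwL : w ∈ L) (hw : w ∉ Submodule.span ℚ T) :
    latticeIndex L T ≤ latticeIndex L (insert w T) := by
  obtain ⟨f, hfw, hfT⟩ := exists_linearMap_eq_one hw
  have h := latticeIndex_insert hT hwL (f := f) (by rw [hfw]; exact one_ne_zero) hfT
  have h0 := latticeIndex_ne_zero hL (insert w T)
  rw [h] at h0 ⊢
  exact Nat.le_mul_of_pos_left _ (Nat.pos_of_ne_zero (left_ne_zero_of_mul h0))

end LatticeIndex
-- Circuits, their normalization, and elimination of a vertex
section Relations
open scoped Classical

variable {V W : Type*} [AddCommGroup V] [Module ℚ V] [AddCommGroup W] [Module ℚ W]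
  {π : V →ₗ[ℚ] W} {L : AddSubgroup W}

/-- The multiplicity of the projection of the cone with vertices `t`. -/
noncomputable def mult (π : V →ₗ[ℚ] W) (L : AddSubgroup W) (t : Finset V) : ℕ :=
  latticeIndex L (π '' (t : Set V))

theorem mult_ne_zero (hL : L.FG) (t : Finset V) : mult π L t ≠ 0 := latticeIndex_ne_zero hL _

theorem linearCombination_mem {c : V →₀ ℚ} {t : Finset V} (hc : c.support ⊆ t) :
    Finsupp.linearCombination ℚ π c ∈ Submodule.span ℚ (π '' (t : Set V)) :=
  (Finsupp.mem_span_image_iff_linearCombination ℚ).2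
    ⟨c, (Finsupp.mem_supported ℚ c).2 (by exact_mod_cast hc), rfl⟩

/-- The saturation contains a lattice point outside the lattice generated by the vertices. Removing
the integral parts of its coefficients moves it into the half-open parallelotope without making it
zero. -/
theorem exists_of_mult_ne_one {t : Finset V} (ht : ∀ v ∈ t, π v ∈ L) (h : mult π L t ≠ 1) :
    ∃ c : V →₀ ℚ, c ≠ 0 ∧ c.support ⊆ t ∧ (∀ v, 0 ≤ c v) ∧ (∀ v, c v < 1) ∧
      Finsupp.linearCombination ℚ π c ∈ L := by
  rw [mult, latticeIndex, ne_eq, AddSubgroup.relIndex_eq_one, SetLike.not_le_iff_exists] at h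
  obtain ⟨x, ⟨hxL, hx⟩, hxc⟩ := h
  obtain ⟨l, hl, rfl⟩ := (Finsupp.mem_span_image_iff_linearCombination ℚ).1 hx
  rw [Finsupp.mem_supported] at hl
  set d : V →₀ ℚ := l.mapRange (fun q => (⌊q⌋ : ℚ)) (by simp) with hd
  have hds : d.support ⊆ t := (Finsupp.support_mapRange).trans (by exact_mod_cast hl)
  have hdc : Finsupp.linearCombination ℚ π d ∈ AddSubgroup.closure (π '' (t : Set V)) := by
    rw [Finsupp.linearCombination_apply]
    refine sum_mem fun v hv => ?_
    have : d v • π v = ⌊l v⌋ • π v := by simp [hd, Int.cast_smul_eq_zsmul]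
    change d v • π v ∈ _
    rw [this]
    exact AddSubgroup.zsmul_mem _ (AddSubgroup.subset_closure (Set.mem_image_of_mem π (hds hv))) _
  have hval : ∀ v, (l - d) v = Int.fract (l v) := fun v => by simp [hd]
  refine ⟨l - d, ?_, ?_, fun v => ?_, fun v => ?_, ?_⟩
  · rw [sub_ne_zero]
    intro h
    exact hxc (h ▸ hdc)
  · intro v hv
    rcases Finset.mem_union.1 (Finsupp.support_sub hv) with h | h
    · exact hl h
    · exact hds h
  · rw [hval]; exact Int.fract_nonneg _
  · rw [hval]; exact Int.fract_lt_one _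
  · rw [map_sub]
    refine L.sub_mem hxL (((AddSubgroup.closure_le L).2 ?_) hdc)
    rintro _ ⟨v, hv, rfl⟩
    exact ht v hv

theorem exists_int_of_mem_closure {t : Finset V} {x : W}
    (hx : x ∈ AddSubgroup.closure (π '' (t : Set V))) :
    ∃ d : V →₀ ℚ, d.support ⊆ t ∧ (∀ v, ∃ n : ℤ, d v = n) ∧
      Finsupp.linearCombination ℚ π d = x := by
  induction hx using AddSubgroup.closure_induction with
  | mem x hx =>
    obtain ⟨v, hv, rfl⟩ := hx
    refine ⟨Finsupp.single v 1, ?_, fun u => ?_, by simp⟩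
    · exact Finsupp.support_single_subset.trans (by simpa using hv)
    · by_cases h : v = u
      · exact ⟨1, by simp [h]⟩
      · exact ⟨0, by simp [h]⟩
  | zero => exact ⟨0, by simp, fun v => ⟨0, by simp⟩, by simp⟩
  | add x y _ _ hx hy =>
    obtain ⟨d, hd, hn, rfl⟩ := hx
    obtain ⟨e, he, hm, rfl⟩ := hy
    refine ⟨d + e, Finsupp.support_add.trans (Finset.union_subset hd he), fun v => ?_, by simp⟩
    obtain ⟨n, hn⟩ := hn v
    obtain ⟨m, hm⟩ := hm v
    exact ⟨n + m, by simp [hn, hm]⟩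
  | neg x _ hx =>
    obtain ⟨d, hd, hn, rfl⟩ := hx
    refine ⟨-d, by simpa using hd, fun v => ?_, by simp⟩
    obtain ⟨n, hn⟩ := hn v
    exact ⟨-n, by simp [hn]⟩

theorem linearIndepOn_iff_support {t : Finset V} : LinearIndepOn ℚ π (t : Set V) ↔
    ∀ r : V →₀ ℚ, r.support ⊆ t → Finsupp.linearCombination ℚ π r = 0 → r = 0 := by
  rw [linearIndepOn_iff]
  simp [Finsupp.mem_supported]

theorem exists_int_of_mult_eq_one {t : Finset V} (hi : LinearIndepOn ℚ π (t : Set V))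
    (h : mult π L t = 1) {c : V →₀ ℚ} (hc : c.support ⊆ t)
    (hcL : Finsupp.linearCombination ℚ π c ∈ L) (v : V) : ∃ n : ℤ, c v = n := by
  rw [mult, latticeIndex, AddSubgroup.relIndex_eq_one] at h
  obtain ⟨d, hd, hn, hdc⟩ := exists_int_of_mem_closure (h ⟨hcL, linearCombination_mem hc⟩)
  have := linearIndepOn_iff_support.1 hi (d - c)
    (Finsupp.support_sub.trans (Finset.union_subset hd hc)) (by simp [hdc])
  rw [sub_eq_zero.1 this] at hn
  exact hn v

theorem notMem_span_of_linearIndepOn_insert {t : Finset V} {a : V} (ha : a ∉ t)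
    (h : LinearIndepOn ℚ π ((insert a t : Finset V) : Set V)) :
    π a ∉ Submodule.span ℚ (π '' (t : Set V)) := by
  rw [Finset.coe_insert] at h
  exact ((linearIndepOn_insert (by exact_mod_cast ha)).1 h).2

theorem mult_erase_le (hL : L.FG) {t : Finset V} (ht : ∀ v ∈ t, π v ∈ L)
    (hi : LinearIndepOn ℚ π (t : Set V)) (a : V) : mult π L (t.erase a) ≤ mult π L t := by
  by_cases ha : a ∈ t
  · have hi' := hi
    rw [← Finset.insert_erase ha] at hi'
    have := latticeIndex_le_insert hL (T := π '' ((t.erase a : Finset V) : Set V)) (w := π a)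
      (by rintro _ ⟨v, hv, rfl⟩; exact ht v (Finset.mem_of_mem_erase hv)) (ht a ha)
      (notMem_span_of_linearIndepOn_insert (Finset.notMem_erase a t) hi')
    rwa [← Set.image_insert_eq, ← Finset.coe_insert, Finset.insert_erase ha] at this
  · rw [Finset.erase_eq_of_notMem ha]

theorem mult_mono (hL : L.FG) {s t : Finset V} (hst : s ⊆ t) (ht : ∀ v ∈ t, π v ∈ L)
    (hi : LinearIndepOn ℚ π (t : Set V)) : mult π L s ≤ mult π L t := by
  have key : ∀ u : Finset V, mult π L (t \ u) ≤ mult π L t := by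
    intro u
    induction u using Finset.induction_on with
    | empty => simp
    | insert a u _ ih =>
      rw [Finset.sdiff_insert]
      exact (mult_erase_le hL (fun v hv => ht v (Finset.sdiff_subset hv))
        (hi.mono (by simp)) a).trans ih
  simpa [Finset.sdiff_sdiff_eq_self hst] using key (t \ s)

/-- Replacing a vertex of an independent set multiplies the multiplicity by a coordinate. -/
theorem mult_replace {t : Finset V} {w u : V} {β : ℚ} (ht : ∀ v ∈ t, π v ∈ L) (hwL : π w ∈ L)
    (huL : π u ∈ L) (hw : w ∉ t) (hi : LinearIndepOn ℚ π ((insert w t : Finset V) : Set V))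
    (hβ : β ≠ 0) (hu : π u - β • π w ∈ Submodule.span ℚ (π '' (t : Set V))) :
    (mult π L (insert u t) : ℚ) = |β| * mult π L (insert w t) := by
  have := latticeIndex_replace (T := π '' (t : Set V)) (w := π w) (u := π u)
    (by rintro _ ⟨v, hv, rfl⟩; exact ht v hv) hwL huL
    (notMem_span_of_linearIndepOn_insert hw hi) hβ hu
  simpa only [mult, Finset.coe_insert, Set.image_insert_eq] using this

/-- A nontrivial linear relation among the projections of the vertices of `δ`. -/
structure IsRelation (π : V →ₗ[ℚ] W) (δ : Finset V) (r : V →₀ ℚ) : Prop where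
  ne_zero : r ≠ 0
  support_subset : r.support ⊆ δ
  eq_zero : Finsupp.linearCombination ℚ π r = 0

/-- A relation whose coefficients are, up to sign, the multiplicities of the facets. -/
structure IsNormalRelation (π : V →ₗ[ℚ] W) (L : AddSubgroup W) (δ : Finset V) (r : V →₀ ℚ) : Prop
    extends IsRelation π δ r where
  mult_eq : ∀ l, r l ≠ 0 → (mult π L (δ.erase l) : ℚ) = |r l|

theorem IsRelation.mono {δ δ' : Finset V} {r : V →₀ ℚ} (h : IsRelation π δ r) (hδ : δ ⊆ δ') :
    IsRelation π δ' r := ⟨h.1, h.2.trans hδ, h.3⟩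

theorem IsRelation.smul {δ : Finset V} {r : V →₀ ℚ} (h : IsRelation π δ r) {θ : ℚ} (hθ : θ ≠ 0) :
    IsRelation π δ (θ • r) :=
  ⟨smul_ne_zero hθ h.1, (Finsupp.support_smul).trans h.2, by simp [h.3]⟩

theorem IsRelation.exists_ne {δ : Finset V} {r : V →₀ ℚ} (h : IsRelation π δ r) :
    ∃ l, r l ≠ 0 := Finsupp.ne_iff.1 h.1

theorem IsRelation.mem {δ : Finset V} {r : V →₀ ℚ} (h : IsRelation π δ r) {l : V} (hl : r l ≠ 0) :
    l ∈ δ := h.2 (Finsupp.mem_support_iff.2 hl)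

theorem IsNormalRelation.neg {δ : Finset V} {r : V →₀ ℚ} (h : IsNormalRelation π L δ r) :
    IsNormalRelation π L δ (-r) where
  ne_zero := neg_ne_zero.2 h.1.1
  support_subset := by simpa using h.1.2
  eq_zero := by simp [h.1.3]
  mult_eq l hl := by simpa using h.2 l (by simpa using hl)

theorem linearCombination_eq_map (r : V →₀ ℚ) :
    Finsupp.linearCombination ℚ π r = π (Finsupp.linearCombination ℚ id r) := by
  rw [Finsupp.apply_linearCombination]; rfl

/-- The one-dimensionality of the kernel enters here: `∑ r v • v` and `∑ r' v • v` both lie in `ker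
π`, hence are proportional, and the independence of `δ` carries the proportionality over to the
coefficients. -/
theorem IsRelation.exists_smul
    (hker : ∀ x y : V, π x = 0 → π y = 0 → x ≠ 0 → ∃ c : ℚ, y = c • x) {δ : Finset V}
    (hδ : LinearIndepOn ℚ id (δ : Set V)) {r r' : V →₀ ℚ} (h : IsRelation π δ r)
    (hs : r'.support ⊆ δ) (h0 : Finsupp.linearCombination ℚ π r' = 0) : ∃ θ : ℚ, r' = θ • r := by
  have key : ∀ a : V →₀ ℚ, a.support ⊆ δ → Finsupp.linearCombination ℚ id a = 0 → a = 0 :=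
    (linearIndepOn_iff_support (π := LinearMap.id)).1 hδ
  obtain ⟨θ, hθ⟩ := hker (Finsupp.linearCombination ℚ id r) (Finsupp.linearCombination ℚ id r')
    (by rw [← linearCombination_eq_map]; exact h.3) (by rw [← linearCombination_eq_map]; exact h0)
    (fun hr => h.1 (key r h.2 hr))
  refine ⟨θ, sub_eq_zero.1 (key _ (Finsupp.support_sub.trans (Finset.union_subset hs
    (Finsupp.support_smul.trans h.2))) ?_)⟩
  simp [hθ]

theorem IsRelation.linearIndepOn_iff
    (hker : ∀ x y : V, π x = 0 → π y = 0 → x ≠ 0 → ∃ c : ℚ, y = c • x) {δ t : Finset V}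
    (hδ : LinearIndepOn ℚ id (δ : Set V)) {r : V →₀ ℚ} (h : IsRelation π δ r) (ht : t ⊆ δ) :
    LinearIndepOn ℚ π (t : Set V) ↔ ¬ r.support ⊆ t := by
  rw [linearIndepOn_iff_support]
  constructor
  · intro hi hr
    exact h.1 (hi r hr h.3)
  · intro hr a ha h0
    obtain ⟨θ, rfl⟩ := h.exists_smul hker hδ (ha.trans ht) h0
    by_contra hne
    have hθ : θ ≠ 0 := fun h => hne (by simp [h])
    rw [Finsupp.support_smul_eq hθ] at ha
    exact hr ha

theorem IsRelation.linearIndepOn_erase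
    (hker : ∀ x y : V, π x = 0 → π y = 0 → x ≠ 0 → ∃ c : ℚ, y = c • x) {δ : Finset V}
    (hδ : LinearIndepOn ℚ id (δ : Set V)) {r : V →₀ ℚ} (h : IsRelation π δ r) {l : V}
    (hl : r l ≠ 0) : LinearIndepOn ℚ π ((δ.erase l : Finset V) : Set V) :=
  (h.linearIndepOn_iff hker hδ (Finset.erase_subset _ _)).2 fun hs =>
    Finset.notMem_erase l δ (hs (Finsupp.mem_support_iff.2 hl))

theorem exists_isRelation {δ : Finset V} (h : ¬ LinearIndepOn ℚ π (δ : Set V)) :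
    ∃ r, IsRelation π δ r := by
  rw [linearIndepOn_iff_support] at h
  push Not at h
  obtain ⟨r, h1, h2, h3⟩ := h
  exact ⟨r, h3, h1, h2⟩

/-- Scale so that the formula holds at one vertex `a`. Modulo the vertices other than `a` and `l`,
the relation reads `π a = -(r l / r a) • π l`, so passing from `δ.erase a` to `δ.erase l` multiplies
the multiplicity by `|r l / r a|`. -/
theorem IsRelation.exists_normal (hL : L.FG)
    (hker : ∀ x y : V, π x = 0 → π y = 0 → x ≠ 0 → ∃ c : ℚ, y = c • x) {δ : Finset V}
    (hδ : LinearIndepOn ℚ id (δ : Set V)) (hv : ∀ v ∈ δ, π v ∈ L) {r : V →₀ ℚ}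
    (h : IsRelation π δ r) : ∃ θ : ℚ, 0 < θ ∧ IsNormalRelation π L δ (θ • r) := by
  obtain ⟨a, ha⟩ := h.exists_ne
  have hm : (0 : ℚ) < mult π L (δ.erase a) := by
    exact_mod_cast Nat.pos_of_ne_zero (mult_ne_zero hL _)
  have hθ : 0 < (mult π L (δ.erase a) : ℚ) / |r a| := div_pos hm (abs_pos.2 ha)
  refine ⟨_, hθ, h.smul hθ.ne', fun l hl => ?_⟩
  have hl : r l ≠ 0 := fun h0 => hl (by simp [h0])
  have hra := abs_pos.2 ha
  rw [Finsupp.smul_apply, smul_eq_mul, abs_mul, abs_of_pos hθ]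
  by_cases hla : l = a
  · subst hla
    field_simp
  have h1 : δ.erase a = insert l ((δ.erase a).erase l) :=
    (Finset.insert_erase (Finset.mem_erase.2 ⟨hla, h.mem hl⟩)).symm
  have h2 : δ.erase l = insert a ((δ.erase a).erase l) := by
    rw [Finset.erase_right_comm, Finset.insert_erase]
    exact Finset.mem_erase.2 ⟨Ne.symm hla, h.mem ha⟩
  have hi := h.linearIndepOn_erase hker hδ ha
  rw [h1] at hi
  rw [h2, mult_replace (β := -(r l / r a)) (w := l) (L := L)
    (fun v hv' => hv v (Finset.mem_of_mem_erase (Finset.mem_of_mem_erase hv'))) (hv l (h.mem hl))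
    (hv a (h.mem ha)) (Finset.notMem_erase _ _) hi (neg_ne_zero.2 (div_ne_zero hl ha)), ← h1,
    abs_neg, abs_div]
  · field_simp
  -- This combination has coefficient zero at both `a` and `l`, and `r` contributes nothing to its
  -- projection.
  · have : Finsupp.linearCombination ℚ π
        (Finsupp.single a 1 + (r l / r a) • Finsupp.single l 1 - (r a)⁻¹ • r) =
        π a - -(r l / r a) • π l := by
      simp [h.3]
    rw [← this]
    refine linearCombination_mem fun v hv' => ?_
    rw [Finsupp.mem_support_iff] at hv'
    have hva : v ≠ a := by
      rintro rfl
      simp [hla, ha] at hv'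
    have hvl : v ≠ l := by
      rintro rfl
      apply hv'
      simp [Ne.symm hla]
      field_simp
      simp
    refine Finset.mem_erase.2 ⟨hvl, Finset.mem_erase.2 ⟨hva, h.mem fun h0 => hv' ?_⟩⟩
    simp [Ne.symm hva, Ne.symm hvl, h0]

/-- An independent face misses some vertex `k` of the circuit and is therefore a face of `d.erase
k`, of multiplicity `|q k|`. Bounds on coefficients thus become bounds on multiplicities. -/
theorem IsNormalRelation.exists_mult_le (hL : L.FG)
    (hker : ∀ x y : V, π x = 0 → π y = 0 → x ≠ 0 → ∃ c : ℚ, y = c • x) {d t : Finset V}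
    (hd : LinearIndepOn ℚ id (d : Set V)) (hv : ∀ v ∈ d, π v ∈ L) {q : V →₀ ℚ}
    (h : IsNormalRelation π L d q) (ht : t ⊆ d) (hi : LinearIndepOn ℚ π (t : Set V)) :
    ∃ k ∉ t, q k ≠ 0 ∧ (mult π L t : ℚ) ≤ |q k| := by
  obtain ⟨k, hk, hkt⟩ := Finset.not_subset.1 ((h.1.linearIndepOn_iff hker hd ht).1 hi)
  have hk := Finsupp.mem_support_iff.1 hk
  refine ⟨k, hkt, hk, ?_⟩
  rw [← h.2 k hk]
  exact_mod_cast mult_mono hL (Finset.subset_erase.2 ⟨ht, hkt⟩)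
    (fun v hv' => hv v (Finset.mem_of_mem_erase hv')) (h.1.linearIndepOn_erase hker hd hk)

/-- Passing to a face cannot increase multiplicities, hence cannot increase the coefficients of a
normalized relation. -/
theorem IsNormalRelation.exists_smul (hL : L.FG)
    (hker : ∀ x y : V, π x = 0 → π y = 0 → x ≠ 0 → ∃ c : ℚ, y = c • x) {d d' : Finset V}
    (hd : LinearIndepOn ℚ id (d : Set V)) (hv : ∀ v ∈ d, π v ∈ L) {q q' : V →₀ ℚ}
    (h : IsNormalRelation π L d q) (h' : IsNormalRelation π L d' q') (hdd : d' ⊆ d) :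
    ∃ θ : ℚ, θ ≠ 0 ∧ |θ| ≤ 1 ∧ q' = θ • q := by
  obtain ⟨θ, rfl⟩ := h.1.exists_smul hker hd (h'.1.2.trans hdd) h'.1.3
  have hθ : θ ≠ 0 := fun h0 => h'.1.1 (by simp [h0])
  refine ⟨θ, hθ, ?_, rfl⟩
  obtain ⟨k, hk⟩ := h.1.exists_ne
  have h2 := h'.2 k (by simpa using ⟨hθ, hk⟩)
  have h3 : (mult π L (d'.erase k) : ℚ) ≤ mult π L (d.erase k) := by
    exact_mod_cast mult_mono hL (Finset.erase_subset_erase k hdd)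
      (fun v hv' => hv v (Finset.mem_of_mem_erase hv')) (h.1.linearIndepOn_erase hker hd hk)
  rw [h2, h.2 k hk, Finsupp.smul_apply, smul_eq_mul, abs_mul] at h3
  exact (mul_le_iff_le_one_left (abs_pos.2 hk)).1 h3

/-- The relation obtained from `r` by eliminating the vertex `i` with the help of `ρ = ∑ c v`. -/
noncomputable def cross {U : Type*} (c r : U →₀ ℚ) (i ρ : U) : U →₀ ℚ :=
  c i • r - r i • c + Finsupp.single ρ (r i)

theorem cross_apply_self {U : Type*} {c r : U →₀ ℚ} {i ρ : U} (hr : r ρ = 0) (hc : c ρ = 0) :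
    cross c r i ρ ρ = r i := by simp [cross, hr, hc]

theorem cross_apply_of_ne {U : Type*} (c r : U →₀ ℚ) {i ρ k : U} (hk : k ≠ ρ) :
    cross c r i ρ k = c i * r k - r i * c k := by
  simp [cross, Ne.symm hk]

theorem IsRelation.cross {δ : Finset V} {c r : V →₀ ℚ} {i ρ : V} (h : IsRelation π δ r)
    (hc : c.support ⊆ δ) (hρ : ρ ∉ δ) (hci : c i ≠ 0)
    (hcρ : Finsupp.linearCombination ℚ π c = π ρ) :
    IsRelation π (insert ρ (δ.erase i)) (cross c r i ρ) := by
  have hδ : ∀ a : V →₀ ℚ, a.support ⊆ δ → ∀ k, k ∉ δ → a k = 0 := fun a ha k hk => by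
    by_contra h0
    exact hk (ha (Finsupp.mem_support_iff.2 h0))
  have hrρ := hδ r h.2 ρ hρ
  have hcρ' := hδ c hc ρ hρ
  refine ⟨?_, ?_, ?_⟩
  · obtain ⟨k, hk⟩ := h.exists_ne
    intro h0
    have h1 : r i = 0 := by rw [← cross_apply_self (i := i) hrρ hcρ', h0]; rfl
    have h2 := cross_apply_of_ne c r (i := i) (ρ := ρ) (k := k) (fun e => hk (e ▸ hrρ))
    rw [h0, h1] at h2
    simp [hci, hk] at h2
  · intro k hk
    rw [Finsupp.mem_support_iff] at hk
    by_cases hkρ : k = ρ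
    · simp [hkρ]
    rw [cross_apply_of_ne c r hkρ] at hk
    refine Finset.mem_insert_of_mem (Finset.mem_erase.2 ⟨?_, ?_⟩)
    · rintro rfl
      exact hk (by ring)
    · by_contra hkδ
      exact hk (by simp [hδ r h.2 k hkδ, hδ c hc k hkδ])
  · simp [ToricFan.cross, h.3, hcρ]

/-- Subtracting `(c b / r b) • r` from `c` eliminates `b` from the expression of `π ρ` and leaves
the coefficient `c a - c b * r a / r b` at `a`. Exchanging `a` for `ρ` in `δ.erase b`, of
multiplicity `|r b|`, then gives the minor. -/
theorem IsNormalRelation.mult_insert_erase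
    (hker : ∀ x y : V, π x = 0 → π y = 0 → x ≠ 0 → ∃ c : ℚ, y = c • x) {δ : Finset V}
    (hδ : LinearIndepOn ℚ id (δ : Set V)) (hv : ∀ v ∈ δ, π v ∈ L) {c r : V →₀ ℚ} {a b ρ : V}
    (h : IsNormalRelation π L δ r) (hc : c.support ⊆ δ) (hρL : π ρ ∈ L)
    (hcρ : Finsupp.linearCombination ℚ π c = π ρ) (hrb : r b ≠ 0) (ha : a ∈ δ) (hab : a ≠ b)
    (hne : c a * r b - c b * r a ≠ 0) :
    (mult π L (insert ρ ((δ.erase b).erase a)) : ℚ) = |c a * r b - c b * r a| := by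
  have h1 : insert a ((δ.erase b).erase a) = δ.erase b :=
    Finset.insert_erase (Finset.mem_erase.2 ⟨hab, ha⟩)
  have hi := h.1.linearIndepOn_erase hker hδ hrb
  rw [← h1] at hi
  rw [mult_replace (β := c a - c b * r a / r b) (w := a) (L := L)
    (fun v hv' => hv v (Finset.mem_of_mem_erase (Finset.mem_of_mem_erase hv'))) (hv a ha)
    hρL (Finset.notMem_erase _ _) hi, h1, h.2 b hrb, ← abs_mul]
  · congr 1
    field_simp
  · intro h0
    apply hne
    field_simp at h0
    linarith
  · have : Finsupp.linearCombination ℚ π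
        (c - (c b / r b) • r - Finsupp.single a (c a - c b * r a / r b)) =
        π ρ - (c a - c b * r a / r b) • π a := by
      simp [h.1.3, hcρ, sub_smul]
    rw [← this]
    refine linearCombination_mem fun v hv' => ?_
    rw [Finsupp.mem_support_iff] at hv'
    have hva : v ≠ a := by
      rintro rfl
      apply hv'
      simp
      ring
    have hvb : v ≠ b := by
      rintro rfl
      simp [hab, hrb] at hv'
    refine Finset.mem_erase.2 ⟨hva, Finset.mem_erase.2 ⟨hvb, ?_⟩⟩
    by_contra hvδ
    have e1 : r v = 0 := by
      by_contra h0; exact hvδ (h.1.mem h0)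
    have e2 : c v = 0 := by
      by_contra h0; exact hvδ (hc (Finsupp.mem_support_iff.2 h0))
    exact hv' (by simp [Ne.symm hva, e1, e2])

/-- Omitting `ρ` from the new cone leaves the old facet `δ.erase i`, and omitting another vertex `k`
leaves a cone whose multiplicity is the minor of `c` and `r` at `i` and `k`. -/
theorem IsNormalRelation.cross
    (hker : ∀ x y : V, π x = 0 → π y = 0 → x ≠ 0 → ∃ c : ℚ, y = c • x) {δ : Finset V}
    (hδ : LinearIndepOn ℚ id (δ : Set V)) (hv : ∀ v ∈ δ, π v ∈ L) {c r : V →₀ ℚ} {i ρ : V}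
    (h : IsNormalRelation π L δ r) (hc : c.support ⊆ δ) (hρ : ρ ∉ δ) (hci : c i ≠ 0)
    (hρL : π ρ ∈ L) (hcρ : Finsupp.linearCombination ℚ π c = π ρ) :
    IsNormalRelation π L (insert ρ (δ.erase i)) (cross c r i ρ) := by
  have hrel := h.1.cross hc hρ hci hcρ
  refine ⟨hrel, fun k hk => ?_⟩
  have hrρ : r ρ = 0 := by by_contra h0; exact hρ (h.1.mem h0)
  have hcρ' : c ρ = 0 := by by_contra h0; exact hρ (hc (Finsupp.mem_support_iff.2 h0))
  by_cases hkρ : k = ρ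
  · subst hkρ
    rw [cross_apply_self hrρ hcρ'] at hk ⊢
    rw [Finset.erase_insert (fun h' => hρ (Finset.mem_of_mem_erase h')), h.2 i hk]
  · have hkm := hrel.mem hk
    rw [cross_apply_of_ne c r hkρ] at hk ⊢
    have hki : k ≠ i := by
      rintro rfl
      exact hk (by ring)
    have hkδ : k ∈ δ :=
      Finset.mem_of_mem_erase ((Finset.mem_insert.1 hkm).resolve_left hkρ)
    have hiδ : i ∈ δ := hc (Finsupp.mem_support_iff.2 hci)
    rw [Finset.erase_insert_of_ne (Ne.symm hkρ)]
    -- The exchange formula starts from a facet omitting a vertex of the circuit. That vertex is `i`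
    -- if `r k = 0`, since the minor would vanish if also `r i = 0`, and `k` otherwise.
    by_cases hrk : r k = 0
    · have hri : r i ≠ 0 := by
        intro h0; exact hk (by simp [hrk, h0])
      rw [h.mult_insert_erase hker hδ hv hc hρL hcρ hri hkδ hki, abs_sub_comm, mul_comm (c k)]
      intro h0
      exact hk (by linarith)
    · rw [Finset.erase_right_comm, h.mult_insert_erase hker hδ hv hc hρL hcρ hrk hiδ
        (Ne.symm hki), mul_comm (c k)]
      intro h0
      exact hk (by linarith)

end Relations
-- Complexes of vertex sets and their star subdivisions
section Complexes
open scoped Classical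

theorem exists_nonneg_sub_nonneg {U : Type*} (r : U →₀ ℚ) : ∃ p n : U →₀ ℚ,
    p.support ⊆ r.support ∧ n.support ⊆ r.support ∧ (∀ v, 0 ≤ p v) ∧ (∀ v, 0 ≤ n v) ∧
      r = p - n := by
  refine ⟨r.mapRange (fun q => max q 0) (by simp), r.mapRange (fun q => max (-q) 0) (by simp),
    Finsupp.support_mapRange, Finsupp.support_mapRange, fun v => by simp, fun v => by simp, ?_⟩
  ext v
  simp only [Finsupp.sub_apply, Finsupp.mapRange_apply]
  rcases le_total 0 (r v) with h | h
  · rw [max_eq_left h, max_eq_right (by linarith)]; ring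
  · rw [max_eq_right h, max_eq_left (by linarith)]; ring

variable {V W : Type*} [AddCommGroup V] [Module ℚ V] [AddCommGroup W] [Module ℚ W]
  {π : V →ₗ[ℚ] W} {L : AddSubgroup W}

/-- The hypotheses on the projection `π` and on the lattice `L` of its target. -/
structure IsLatticeProjection (π : V →ₗ[ℚ] W) (L : AddSubgroup W) : Prop where
  fg : L.FG
  ker : ∀ x y : V, π x = 0 → π y = 0 → x ≠ 0 → ∃ c : ℚ, y = c • x

/-- The vertex sets of the cones of a simplicial fan whose vertices project to `L`. -/
structure IsFanComplex (π : V →ₗ[ℚ] W) (L : AddSubgroup W) (K : Finset (Finset V)) : Prop where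
  down : ∀ s ∈ K, ∀ t ⊆ s, t ∈ K
  uniq : ∀ a b : V →₀ ℚ, (∀ v, 0 ≤ a v) → (∀ v, 0 ≤ b v) → a.support ∈ K → b.support ∈ K →
    Finsupp.linearCombination ℚ id a = Finsupp.linearCombination ℚ id b → a = b
  integral : ∀ s ∈ K, ∀ v ∈ s, π v ∈ L

/-- The coefficients of a point at which `K` is to be subdivided. -/
structure IsCenter (π : V →ₗ[ℚ] W) (L : AddSubgroup W) (K : Finset (Finset V)) (c : V →₀ ℚ) :
    Prop where
  nonneg : ∀ v, 0 ≤ c v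
  mem : c.support ∈ K
  ne_zero : c ≠ 0
  ne_single : ∀ v, c ≠ Finsupp.single v 1
  integral : Finsupp.linearCombination ℚ π c ∈ L

/-- The point with coefficients `c`. -/
noncomputable def point (c : V →₀ ℚ) : V := Finsupp.linearCombination ℚ id c

/-- The star subdivision of `K` at the point with coefficients `c`. -/
noncomputable def subdivide (K : Finset (Finset V)) (c : V →₀ ℚ) : Finset (Finset V) :=
  K.filter (fun t => ¬ c.support ⊆ t) ∪
    (K.filter (fun t => ¬ c.support ⊆ t ∧ t ∪ c.support ∈ K)).image (insert (point c))

theorem mem_subdivide {K : Finset (Finset V)} {c : V →₀ ℚ} {t : Finset V} :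
    t ∈ subdivide K c ↔ (t ∈ K ∧ ¬ c.support ⊆ t) ∨
      ∃ η ∈ K, ¬ c.support ⊆ η ∧ η ∪ c.support ∈ K ∧ t = insert (point c) η := by
  simp only [subdivide, Finset.mem_union, Finset.mem_filter, Finset.mem_image, and_assoc]
  refine or_congr_right ⟨?_, ?_⟩
  · rintro ⟨η, h1, h2, h3, rfl⟩; exact ⟨η, h1, h2, h3, rfl⟩
  · rintro ⟨η, h1, h2, h3, rfl⟩; exact ⟨η, h1, h2, h3, rfl⟩

variable {K : Finset (Finset V)}

theorem IsFanComplex.linearIndepOn (hK : IsFanComplex π L K) {s : Finset V} (hs : s ∈ K) :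
    LinearIndepOn ℚ id (s : Set V) := by
  refine (linearIndepOn_iff_support (π := LinearMap.id)).2 fun r hr h0 => ?_
  obtain ⟨p, n, hps, hns, hp, hn, hsub⟩ := exists_nonneg_sub_nonneg r
  rw [hsub, hK.uniq p n hp hn (hK.down s hs _ (hps.trans hr)) (hK.down s hs _ (hns.trans hr)),
    sub_self]
  rw [← sub_eq_zero, ← map_sub, ← hsub]
  exact h0

/-- The center is a genuinely new vertex; `IsCenter.ne_single` is there for this. A center on a ray
is still allowed: subdividing there only replaces the generator of the ray. -/
theorem IsFanComplex.point_notMem (hK : IsFanComplex π L K) {c : V →₀ ℚ} (hc : IsCenter π L K c)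
    {t : Finset V} (ht : t ∈ K) : point c ∉ t := by
  intro h
  refine hc.ne_single (point c) (hK.uniq _ _ hc.nonneg (fun v => ?_) hc.mem ?_ ?_)
  · by_cases hv : v = point c
    · simp [hv]
    · rw [Finsupp.single_eq_of_ne hv]
  · rw [Finsupp.support_single _ one_ne_zero]
    exact hK.down t ht _ (by simpa using h)
  · simp [point]

theorem map_point (c : V →₀ ℚ) : π (point c) = Finsupp.linearCombination ℚ π c :=
  (linearCombination_eq_map c).symm

/-- Expanding the center through `c` turns a combination on the subdivision into one on `K`. The
index in the support of `c` where `a` vanishes allows the coefficient of the center to be recovered.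
-/
theorem IsFanComplex.exists_of_support_mem_subdivide (hK : IsFanComplex π L K) {c : V →₀ ℚ}
    (hc : IsCenter π L K c) {a : V →₀ ℚ} (ha : ∀ v, 0 ≤ a v) (hs : a.support ∈ subdivide K c) :
    (∀ v, 0 ≤ (a.erase (point c) + a (point c) • c) v) ∧
      (a.erase (point c) + a (point c) • c).support ∈ K ∧
      Finsupp.linearCombination ℚ id (a.erase (point c) + a (point c) • c) =
        Finsupp.linearCombination ℚ id a ∧
      ∃ i ∈ c.support, a i = 0 := by
  refine ⟨fun v => ?_, ?_, ?_, ?_⟩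
  · rw [Finsupp.add_apply, Finsupp.smul_apply, smul_eq_mul, Finsupp.erase_apply]
    have := mul_nonneg (ha (point c)) (hc.nonneg v)
    split_ifs
    · linarith
    · have := ha v; linarith
  · rcases mem_subdivide.1 hs with ⟨h1, -⟩ | ⟨η, h1, -, h3, h4⟩
    · have h0 : a (point c) = 0 := by
        rw [← Finsupp.notMem_support_iff]; exact hK.point_notMem hc h1
      rwa [h0, zero_smul, add_zero, Finsupp.erase_of_notMem_support (hK.point_notMem hc h1)]
    · refine hK.down _ h3 _ (Finsupp.support_add.trans (Finset.union_subset_union ?_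
        Finsupp.support_smul))
      rw [Finsupp.support_erase, h4, Finset.erase_insert (hK.point_notMem hc h1)]
  · have : a = a.erase (point c) + Finsupp.single (point c) (a (point c)) := by
      rw [Finsupp.erase_add_single]
    conv_rhs => rw [this]
    rw [map_add, map_add, map_smul, Finsupp.linearCombination_single]
    rfl
  · have : ∃ i ∈ c.support, i ∉ a.support := by
      rw [← Finset.not_subset]
      rcases mem_subdivide.1 hs with ⟨-, h2⟩ | ⟨η, h1, h2, h3, h4⟩
      · exact h2
      · rw [h4]
        intro h
        exact h2 ((Finset.subset_insert_iff_of_notMem (hK.point_notMem hc hc.mem)).1 h)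
    simpa using this

theorem IsFanComplex.subdivide (hK : IsFanComplex π L K) {c : V →₀ ℚ} (hc : IsCenter π L K c) :
    IsFanComplex π L (subdivide K c) where
  down := by
    intro s hs t hts
    rcases mem_subdivide.1 hs with ⟨h1, h2⟩ | ⟨η, h1, h2, h3, rfl⟩
    · exact mem_subdivide.2 (.inl ⟨hK.down s h1 t hts, fun h => h2 (h.trans hts)⟩)
    · by_cases hp : point c ∈ t
      · have ht : t.erase (point c) ⊆ η := by
          rwa [← Finset.subset_insert_iff]
        exact mem_subdivide.2 (.inr ⟨t.erase (point c), hK.down η h1 _ ht, fun h => h2 (h.trans ht),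
          hK.down _ h3 _ (Finset.union_subset_union_left ht), (Finset.insert_erase hp).symm⟩)
      · have ht := (Finset.subset_insert_iff_of_notMem hp).1 hts
        exact mem_subdivide.2 (.inl ⟨hK.down η h1 t ht, fun h => h2 (h.trans ht)⟩)
  uniq := by
    intro a b ha hb has hbs hab
    obtain ⟨a1, a2, a3, i, hi, hai⟩ := hK.exists_of_support_mem_subdivide hc ha has
    obtain ⟨b1, b2, b3, j, hj, hbj⟩ := hK.exists_of_support_mem_subdivide hc hb hbs
    have h := hK.uniq _ _ a1 b1 a2 b2 (by rw [a3, b3, hab])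
    have hne : ∀ k ∈ c.support, k ≠ point c := fun k hk e =>
      hK.point_notMem hc hc.mem (e ▸ hk)
    have hpos : ∀ k ∈ c.support, 0 < c k := fun k hk =>
      lt_of_le_of_ne (hc.nonneg k) (Ne.symm (Finsupp.mem_support_iff.1 hk))
    have hi' := DFunLike.congr_fun h i
    have hj' := DFunLike.congr_fun h j
    simp only [Finsupp.add_apply, Finsupp.smul_apply, smul_eq_mul,
      Finsupp.erase_ne (hne i hi), Finsupp.erase_ne (hne j hj), hai, hbj] at hi' hj'
    -- At `i`, where `a` vanishes, comparison gives `a (point c) * c i = b i + b (point c) * c i ≥ b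
    -- (point c) * c i`; at `j`, where `b` vanishes, it gives the opposite inequality.
    have e : a (point c) = b (point c) := by
      apply le_antisymm
      · have := ha j
        exact le_of_mul_le_mul_right (by linarith) (hpos j hj)
      · have := hb i
        exact le_of_mul_le_mul_right (by linarith) (hpos i hi)
    rw [e, add_left_inj] at h
    rw [← Finsupp.erase_add_single (point c) a, ← Finsupp.erase_add_single (point c) b, h, e]
  integral := by
    intro s hs v hv
    rcases mem_subdivide.1 hs with ⟨h1, -⟩ | ⟨η, h1, -, -, rfl⟩
    · exact hK.integral s h1 v hv
    · rcases Finset.mem_insert.1 hv with rfl | hv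
      · rw [map_point]; exact hc.integral
      · exact hK.integral η h1 v hv

/-- `η` spans with the center `c` a new cone of the subdivision. -/
structure IsLink {U : Type*} (K : Finset (Finset U)) (c : U →₀ ℚ) (η : Finset U) : Prop where
  mem : η ∈ K
  not_subset : ¬ c.support ⊆ η
  union_mem : η ∪ c.support ∈ K

theorem IsLink.exists_notMem {U : Type*} {K : Finset (Finset U)} {c : U →₀ ℚ} {η : Finset U}
    (h : IsLink K c η) :
    ∃ i, c i ≠ 0 ∧ i ∉ η := by
  obtain ⟨i, hi, hη⟩ := Finset.not_subset.1 h.not_subset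
  exact ⟨i, Finsupp.mem_support_iff.1 hi, hη⟩

theorem insert_point_subset {c : V →₀ ℚ} {η : Finset V} {i : V}
    (hi : i ∉ η) : insert (point c) η ⊆ insert (point c) ((η ∪ c.support).erase i) :=
  Finset.insert_subset_insert _ (Finset.subset_erase.2 ⟨Finset.subset_union_left, hi⟩)

/-- For `i ∉ η` this new cone contains `insert (point c) η` as a face. Relations and multiplicities
are computed on it, where `cross` applies, and then restricted to the face. -/
theorem IsLink.insert_erase_mem (hK : IsFanComplex π L K) {c : V →₀ ℚ} {η : Finset V}
    (h : IsLink K c η) {i : V} (hci : c i ≠ 0) :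
    insert (point c) ((η ∪ c.support).erase i) ∈ ToricFan.subdivide K c := by
  have hi : i ∈ c.support := Finsupp.mem_support_iff.2 hci
  refine mem_subdivide.2 (.inr ⟨_, hK.down _ h.union_mem _ (Finset.erase_subset _ _),
    fun hs => Finset.notMem_erase i _ (hs hi), ?_, rfl⟩)
  refine hK.down _ h.union_mem _ (Finset.union_subset (Finset.erase_subset _ _)
    Finset.subset_union_right)

/-- Over an independent cone, exchanging `i` for the center multiplies the multiplicity by the
coefficient `c i`; passing to a face does not increase it. -/
theorem IsLink.mult_le_of_linearIndepOn (hπ : IsLatticeProjection π L) (hK : IsFanComplex π L K)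
    {c : V →₀ ℚ} (hc : IsCenter π L K c) {η : Finset V} (h : IsLink K c η)
    (hi : LinearIndepOn ℚ π ((η ∪ c.support : Finset V) : Set V)) {i : V} (hci : c i ≠ 0)
    (hη : i ∉ η) :
    LinearIndepOn ℚ π ((insert (point c) η : Finset V) : Set V) ∧
      (mult π L (insert (point c) η) : ℚ) ≤ c i * mult π L (η ∪ c.support) := by
  have hiδ : i ∈ η ∪ c.support := Finset.mem_union_right _ (Finsupp.mem_support_iff.2 hci)
  have hI : LinearIndepOn ℚ π
      ((insert i ((η ∪ c.support).erase i) : Finset V) : Set V) := by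
    rwa [Finset.insert_erase hiδ]
  have hspan : π (point c) - c i • π i ∈
      Submodule.span ℚ (π '' (((η ∪ c.support).erase i : Finset V) : Set V)) := by
    have : Finsupp.linearCombination ℚ π (c.erase i) = π (point c) - c i • π i := by
      rw [map_point, ← Finsupp.erase_add_single i c, map_add, Finsupp.linearCombination_single]
      simp
    rw [← this]
    refine linearCombination_mem ?_
    rw [Finsupp.support_erase]
    exact Finset.erase_subset_erase _ Finset.subset_union_right
  have hnot := notMem_span_of_linearIndepOn_insert (Finset.notMem_erase _ _) hI
  have hI' : LinearIndepOn ℚ π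
      ((insert (point c) ((η ∪ c.support).erase i) : Finset V) : Set V) := by
    rw [Finset.coe_insert]
    refine LinearIndepOn.insert (hi.mono (by simp)) fun hp => hnot ?_
    have := Submodule.smul_mem _ (c i)⁻¹ (sub_mem hp hspan)
    simpa [smul_smul, hci] using this
  have hint := (hK.subdivide hc).integral _ (h.insert_erase_mem hK hci)
  have hδ := hK.integral _ h.union_mem
  refine ⟨hI'.mono (by exact_mod_cast insert_point_subset hη), ?_⟩
  refine le_trans (b := (mult π L (insert (point c) ((η ∪ c.support).erase i)) : ℚ))
    (by exact_mod_cast mult_mono hπ.fg (insert_point_subset hη) hint hI') ?_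
  rw [mult_replace (β := c i) (w := i) (L := L)
    (fun v hv => hδ v (Finset.mem_of_mem_erase hv)) (hδ i hiδ)
    (hint _ (Finset.mem_insert_self _ _)) (Finset.notMem_erase _ _) hI hci hspan,
    Finset.insert_erase hiδ, abs_of_nonneg (hc.nonneg i)]

theorem IsLink.normal_cross (hπ : IsLatticeProjection π L) (hK : IsFanComplex π L K)
    {c : V →₀ ℚ} (hc : IsCenter π L K c) {η : Finset V} (h : IsLink K c η) {r : V →₀ ℚ}
    (hr : IsNormalRelation π L (η ∪ c.support) r) {i : V} (hci : c i ≠ 0) :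
    IsNormalRelation π L (insert (point c) ((η ∪ c.support).erase i)) (cross c r i (point c)) :=
  hr.cross hπ.ker (hK.linearIndepOn h.union_mem) (hK.integral _ h.union_mem)
    Finset.subset_union_right (hK.point_notMem hc h.union_mem) hci
    (by rw [map_point]; exact hc.integral) (map_point c).symm

theorem IsLink.exists_mult_le (hπ : IsLatticeProjection π L) (hK : IsFanComplex π L K)
    {c : V →₀ ℚ} (hc : IsCenter π L K c) {η : Finset V} (h : IsLink K c η) {r : V →₀ ℚ}
    (hr : IsNormalRelation π L (η ∪ c.support) r) {i : V} (hci : c i ≠ 0) (hη : i ∉ η)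
    (hi : LinearIndepOn ℚ π ((insert (point c) η : Finset V) : Set V)) :
    ∃ k, c i * r k - r i * c k ≠ 0 ∧
      (mult π L (insert (point c) η) : ℚ) ≤ |c i * r k - r i * c k| := by
  have hm := h.insert_erase_mem hK hci
  obtain ⟨k, hk, h1, h2⟩ := (h.normal_cross hπ hK hc hr hci).exists_mult_le hπ.fg hπ.ker
    ((hK.subdivide hc).linearIndepOn hm) ((hK.subdivide hc).integral _ hm)
    (insert_point_subset hη) hi
  have hkρ : k ≠ point c := fun e => hk (e ▸ Finset.mem_insert_self _ _)
  rw [cross_apply_of_ne c r hkρ] at h1 h2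
  exact ⟨k, h1, h2⟩

theorem IsFanComplex.exists_normal (hK : IsFanComplex π L K) (hπ : IsLatticeProjection π L)
    {δ : Finset V} (hδ : δ ∈ K) (hd : ¬ LinearIndepOn ℚ π (δ : Set V)) :
    ∃ r, IsNormalRelation π L δ r := by
  obtain ⟨r, hr⟩ := exists_isRelation hd
  obtain ⟨θ, -, h⟩ := hr.exists_normal hπ.fg hπ.ker (hK.linearIndepOn hδ) (hK.integral δ hδ)
  exact ⟨_, h⟩

theorem IsRelation.not_linearIndepOn {δ : Finset V} {r : V →₀ ℚ} (h : IsRelation π δ r) :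
    ¬ LinearIndepOn ℚ π (δ : Set V) := fun hi =>
  h.1 (linearIndepOn_iff_support.1 hi r h.2 h.3)

/-- A new cone over an independent cone is independent, so dependence of the new cone is inherited
from the old one. -/
theorem IsLink.exists_relation (hπ : IsLatticeProjection π L) (hK : IsFanComplex π L K)
    {c : V →₀ ℚ} (hc : IsCenter π L K c) {η : Finset V} (h : IsLink K c η) {q : V →₀ ℚ}
    (hq : IsNormalRelation π L (insert (point c) η) q) :
    ∃ r, IsNormalRelation π L (η ∪ c.support) r := by
  by_contra hcon
  obtain ⟨i, hci, hη⟩ := h.exists_notMem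
  have hi : LinearIndepOn ℚ π ((η ∪ c.support : Finset V) : Set V) := by
    by_contra hd
    exact hcon (hK.exists_normal hπ h.union_mem hd)
  exact hq.1.not_linearIndepOn (h.mult_le_of_linearIndepOn hπ hK hc hi hci hη).1

theorem IsLink.exists_smul_cross (hπ : IsLatticeProjection π L) (hK : IsFanComplex π L K)
    {c : V →₀ ℚ} (hc : IsCenter π L K c) {η : Finset V} (h : IsLink K c η) {r q : V →₀ ℚ}
    (hr : IsNormalRelation π L (η ∪ c.support) r)
    (hq : IsNormalRelation π L (insert (point c) η) q) {i : V} (hci : c i ≠ 0) (hη : i ∉ η) :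
    ∃ θ : ℚ, θ ≠ 0 ∧ |θ| ≤ 1 ∧ q = θ • cross c r i (point c) := by
  have hm := h.insert_erase_mem hK hci
  exact (h.normal_cross hπ hK hc hr hci).exists_smul hπ.fg hπ.ker
    ((hK.subdivide hc).linearIndepOn hm) ((hK.subdivide hc).integral _ hm) hq
    (insert_point_subset hη)

end Complexes
-- Signs of circuits and the subdivision at a circuit
section Circuits
open scoped Classical

/-- Both signs attain `M`, and there are several coefficients of each sign. -/
def IsBad {U : Type*} (M : ℚ) (r : U →₀ ℚ) : Prop :=
  (∃ l, r l = M) ∧ (∃ l, r l = -M) ∧ (∃ k l, k ≠ l ∧ 0 < r k ∧ 0 < r l) ∧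
    ∃ k l, k ≠ l ∧ r k < 0 ∧ r l < 0

/-- Both signs attain `M`, there is one positive coefficient and there are several negative ones. -/
def IsGoodPos {U : Type*} (M : ℚ) (r : U →₀ ℚ) : Prop :=
  (∃ j, r j = M ∧ ∀ k, 0 < r k → k = j) ∧ (∃ l, r l = -M) ∧ ∃ k l, k ≠ l ∧ r k < 0 ∧ r l < 0

/-- Both signs attain `M`, and exactly one of the signs occurs only once. -/
def IsGood {U : Type*} (M : ℚ) (r : U →₀ ℚ) : Prop := IsGoodPos M r ∨ IsGoodPos M (-r)

/-- The sign of a relation is chosen for the subdivision at the sum of its positive vertices. -/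
structure IsOriented {U : Type*} (r : U →₀ ℚ) : Prop where
  exists_max : ∃ l, ∀ k, |r k| ≤ r l
  pos_or_neg : (∃ l, ∀ k, |r k| ≤ -r l) →
    (∃ j, ∀ k, 0 < r k → k = j) ∨ ∃ k l, k ≠ l ∧ r k < 0 ∧ r l < 0

section
variable {U : Type*} {M : ℚ} {r : U →₀ ℚ}

theorem IsBad.neg (h : IsBad M r) : IsBad M (-r) := by
  obtain ⟨⟨a, ha⟩, ⟨b, hb⟩, ⟨c, d, hcd, hc, hd⟩, e, f, hef, he, hf⟩ := h
  exact ⟨⟨b, by simp [hb]⟩, ⟨a, by simp [ha]⟩, ⟨e, f, hef, by simpa using he, by simpa using hf⟩,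
    c, d, hcd, by simpa using hc, by simpa using hd⟩

theorem IsGood.neg (h : IsGood M r) : IsGood M (-r) := by
  unfold IsGood at *
  rw [neg_neg]
  exact h.symm

theorem isOriented_or_neg (hr : r ≠ 0) : IsOriented r ∨ IsOriented (-r) := by
  have key : ∀ r : U →₀ ℚ, (∃ l, ∀ k, |r k| ≤ r l) → IsOriented r ∨ IsOriented (-r) := by
    intro r h1
    by_cases h2 : (∃ l, ∀ k, |r k| ≤ -r l) →
      (∃ j, ∀ k, 0 < r k → k = j) ∨ ∃ k l, k ≠ l ∧ r k < 0 ∧ r l < 0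
    · exact .inl ⟨h1, h2⟩
    -- When the tie-break fails, the maximum is attained with both signs but there is only one
    -- negative coefficient. Then `-r` has only one positive coefficient and is oriented.
    · push Not at h2
      obtain ⟨⟨l, hl⟩, -, h4⟩ := h2
      refine .inr ⟨⟨l, by simpa using hl⟩, fun _ => ?_⟩
      by_cases hneg : ∃ j, r j < 0
      · obtain ⟨j, hj⟩ := hneg
        refine .inl ⟨j, fun k hk => ?_⟩
        have hk : r k < 0 := by simpa using hk
        by_contra hkj
        exact absurd hj (not_lt.2 (h4 k j hkj hk))
      · push Not at hneg
        refine .inl ⟨l, fun k hk => ?_⟩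
        have hk : r k < 0 := by simpa using hk
        exact absurd hk (not_lt.2 (hneg k))
  obtain ⟨k, hk⟩ := Finsupp.ne_iff.1 hr
  obtain ⟨l, -, hl⟩ := Finset.exists_max_image r.support (fun k => |r k|)
    ⟨k, Finsupp.mem_support_iff.2 hk⟩
  have hl : ∀ k, |r k| ≤ |r l| := fun k => by
    by_cases hk : r k = 0
    · rw [hk, abs_zero]; exact abs_nonneg _
    · exact hl k (Finsupp.mem_support_iff.2 hk)
  rcases le_total 0 (r l) with h | h
  · rw [abs_of_nonneg h] at hl
    exact key r ⟨l, hl⟩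
  · rw [abs_of_nonpos h] at hl
    have := key (-r) ⟨l, by simpa using hl⟩
    rwa [neg_neg, or_comm] at this

theorem IsOriented.smul (h : IsOriented r) {θ : ℚ} (hθ : 0 < θ) : IsOriented (θ • r) := by
  have e : ∀ k, |(θ • r) k| = θ * |r k| := fun k => by
    rw [Finsupp.smul_apply, smul_eq_mul, abs_mul, abs_of_pos hθ]
  refine ⟨?_, ?_⟩
  · obtain ⟨l, hl⟩ := h.1
    exact ⟨l, fun k => by rw [e]; exact mul_le_mul_of_nonneg_left (hl k) hθ.le⟩
  · rintro ⟨l, hl⟩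
    have := h.2 ⟨l, fun k => by
      have := hl k
      rw [e, Finsupp.smul_apply, smul_eq_mul, ← mul_neg] at this
      exact le_of_mul_le_mul_left this hθ⟩
    simpa [hθ, mul_neg_iff, hθ.le, not_lt.2 hθ.le] using this

/-- An oriented relation that is not bad and attains `-M` has only one positive coefficient,
and it equals `M`. -/
theorem IsOriented.exists_unique_pos (h : IsOriented r) (hM : 0 < M) (hb : ∀ k, |r k| ≤ M)
    (hbad : ¬ IsBad M r) {l : U} (hl : r l = -M) : ∃ j, r j = M ∧ ∀ k, 0 < r k → k = j := by
  obtain ⟨j, hj⟩ := h.1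
  have hjM : r j = M := by
    apply le_antisymm ((le_abs_self _).trans (hb j))
    have := hj l
    rwa [hl, abs_neg, abs_of_pos hM] at this
  refine ⟨j, hjM, ?_⟩
  rcases h.2 ⟨l, fun k => by rw [hl, neg_neg]; exact hb k⟩ with ⟨j', hj'⟩ | h2
  · intro k hk
    rw [hj' k hk, hj' j (hjM ▸ hM)]
  · intro k hk
    by_contra hkj
    exact hbad ⟨⟨j, hjM⟩, ⟨l, hl⟩, ⟨k, j, hkj, hk, hjM ▸ hM⟩, h2⟩

end

/-- The coefficients of an interior point of the cone of the circuit `r` that has the same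
projection as the sum of the vertices with positive coefficient. -/
noncomputable def circuitCenter {U : Type*} (r : U →₀ ℚ) : U →₀ ℚ :=
  r.mapRange (fun q => if 0 < q then 1 else 0) (by simp) - (1 + ∑ v ∈ r.support, |r v|)⁻¹ • r

section
variable {U : Type*} {r : U →₀ ℚ}

theorem circuitCenter_apply (r : U →₀ ℚ) (v : U) : circuitCenter r v =
    (if 0 < r v then 1 else 0) - (1 + ∑ v ∈ r.support, |r v|)⁻¹ * r v := by
  simp [circuitCenter]

theorem abs_mul_lt_one (r : U →₀ ℚ) (v : U) :
    0 < (1 + ∑ v ∈ r.support, |r v|)⁻¹ ∧ (1 + ∑ v ∈ r.support, |r v|)⁻¹ * |r v| < 1 := by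
  have h0 : 0 ≤ ∑ v ∈ r.support, |r v| := Finset.sum_nonneg fun v _ => abs_nonneg _
  have h1 : |r v| ≤ ∑ v ∈ r.support, |r v| := by
    by_cases hv : r v = 0
    · rwa [hv, abs_zero]
    · exact Finset.single_le_sum (f := fun v => |r v|) (fun v _ => abs_nonneg _)
        (Finsupp.mem_support_iff.2 hv)
  refine ⟨by positivity, ?_⟩
  rw [inv_mul_lt_iff₀ (by positivity)]
  linarith

theorem circuitCenter_pos {v : U} (hv : r v ≠ 0) : 0 < circuitCenter r v := by
  obtain ⟨h0, h1⟩ := abs_mul_lt_one r v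
  rw [circuitCenter_apply]
  split_ifs with h
  · rw [abs_of_pos h] at h1; linarith
  · have : r v < 0 := lt_of_le_of_ne (not_lt.1 h) hv
    have := mul_pos_of_neg_of_neg (neg_lt_zero.2 h0) this
    linarith

theorem circuitCenter_eq_zero {v : U} (hv : r v = 0) : circuitCenter r v = 0 := by
  simp [circuitCenter_apply, hv]

theorem circuitCenter_ne_zero_iff {v : U} : circuitCenter r v ≠ 0 ↔ r v ≠ 0 :=
  ⟨fun h h0 => h (circuitCenter_eq_zero h0), fun h => (circuitCenter_pos h).ne'⟩

theorem support_circuitCenter (r : U →₀ ℚ) : (circuitCenter r).support = r.support := by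
  ext v
  simp only [Finsupp.mem_support_iff, circuitCenter_ne_zero_iff]

/-- The multiple of `r` inside the center cancels in every minor. It serves only to move the center
into the relative interior of the circuit, so the minors see just the indicator function of the
positive vertices. -/
theorem circuitCenter_cross (r : U →₀ ℚ) (θ : ℚ) (i k : U) :
    circuitCenter r i * (θ • r) k - (θ • r) i * circuitCenter r k =
      (if 0 < r i then 1 else 0) * (θ • r) k - (θ • r) i * (if 0 < r k then 1 else 0) := by
  rw [circuitCenter_apply, circuitCenter_apply]
  simp only [Finsupp.smul_apply, smul_eq_mul]
  ring

end

variable {V W : Type*} [AddCommGroup V] [Module ℚ V] [AddCommGroup W] [Module ℚ W]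
  {π : V →ₗ[ℚ] W} {L : AddSubgroup W} {K : Finset (Finset V)}

theorem IsFanComplex.isCenter_circuitCenter (hK : IsFanComplex π L K) {r : V →₀ ℚ}
    (hr : IsRelation π r.support r) (hs : r.support ∈ K) : IsCenter π L K (circuitCenter r) where
  nonneg v := by
    by_cases h : r v = 0
    · rw [circuitCenter_eq_zero h]
    · exact (circuitCenter_pos h).le
  mem := by rwa [support_circuitCenter]
  ne_zero := by
    obtain ⟨v, hv⟩ := hr.exists_ne
    intro h
    have := circuitCenter_pos hv
    simp [h] at this
  ne_single v h := by
    have h1 : circuitCenter r v = 1 := by simp [h]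
    have hv : r v ≠ 0 := circuitCenter_ne_zero_iff.1 (by rw [h1]; exact one_ne_zero)
    obtain ⟨h2, h3⟩ := abs_mul_lt_one r v
    rw [circuitCenter_apply] at h1
    split_ifs at h1 with h4
    · have := mul_pos h2 h4
      linarith
    · rw [abs_of_nonpos (not_lt.1 h4)] at h3
      linarith
  integral := by
    rw [circuitCenter, map_sub, map_smul, hr.3, smul_zero, sub_zero,
      Finsupp.linearCombination_apply]
    refine sum_mem fun v hv => ?_
    have hv' : v ∈ r.support := Finsupp.support_mapRange hv
    simp only [Finsupp.mapRange_apply]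
    split_ifs
    · simpa using hK.integral _ hs v hv'
    · simp

/-- All independent cones of `K` have multiplicity at most `M`. -/
def IsMultBound (π : V →ₗ[ℚ] W) (L : AddSubgroup W) (K : Finset (Finset V)) (M : ℕ) : Prop :=
  ∀ t ∈ K, LinearIndepOn ℚ π (t : Set V) → mult π L t ≤ M

theorem IsMultBound.abs_le {M : ℕ} (hM : IsMultBound π L K M) (hπ : IsLatticeProjection π L)
    (hK : IsFanComplex π L K) {δ : Finset V} (hδ : δ ∈ K) {r : V →₀ ℚ}
    (hr : IsNormalRelation π L δ r) (k : V) : |r k| ≤ M := by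
  by_cases hk : r k = 0
  · simp [hk]
  · rw [← hr.2 k hk]
    exact_mod_cast hM _ (hK.down δ hδ _ (Finset.erase_subset _ _))
      (hr.1.linearIndepOn_erase hπ.ker (hK.linearIndepOn hδ) hk)

/-- The relation on `η ∪ supp r₀` and on the new cones in the subdivision at a circuit. -/
theorem IsLink.exists_circuit_normal (hπ : IsLatticeProjection π L) (hK : IsFanComplex π L K)
    {r₀ : V →₀ ℚ} (hr₀ : IsRelation π r₀.support r₀) {η : Finset V}
    (h : IsLink K (circuitCenter r₀) η) :
    ∃ θ : ℚ, 0 < θ ∧ IsNormalRelation π L (η ∪ (circuitCenter r₀).support) (θ • r₀) :=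
  (hr₀.mono (by rw [support_circuitCenter]; exact Finset.subset_union_right)).exists_normal hπ.fg
    hπ.ker (hK.linearIndepOn h.union_mem) (hK.integral _ h.union_mem)

theorem cross_circuitCenter_of_pos {U : Type*} {r₀ : U →₀ ℚ} {θ : ℚ} (hθ : 0 < θ) {i : U}
    (hi : 0 < r₀ i) (k : U) :
    circuitCenter r₀ i * (θ • r₀) k - (θ • r₀) i * circuitCenter r₀ k =
      if 0 < (θ • r₀) k then (θ • r₀) k - (θ • r₀) i else (θ • r₀) k := by
  rw [circuitCenter_cross, if_pos hi]
  simp [hθ]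
  split_ifs <;> ring

theorem cross_circuitCenter_of_neg {U : Type*} {r₀ : U →₀ ℚ} {θ : ℚ} (hθ : 0 < θ) {i : U}
    (hi : r₀ i < 0) (k : U) :
    circuitCenter r₀ i * (θ • r₀) k - (θ • r₀) i * circuitCenter r₀ k =
      if 0 < (θ • r₀) k then -(θ • r₀) i else 0 := by
  rw [circuitCenter_cross, if_neg (not_lt.2 hi.le)]
  simp [hθ]
  split_ifs <;> ring

/-- Every minor is zero, a coefficient of `θ • r₀` up to sign, or a difference of two positive
coefficients; none of these exceeds `M` in absolute value. -/
theorem abs_cross_circuitCenter_le {U : Type*} {r₀ : U →₀ ℚ} {θ M : ℚ} (hθ : 0 < θ)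
    (hM : ∀ k, |(θ • r₀) k| ≤ M) (i k : U) :
    |circuitCenter r₀ i * (θ • r₀) k - (θ • r₀) i * circuitCenter r₀ k| ≤ M := by
  have hi := abs_le.1 (hM i)
  have hk := abs_le.1 (hM k)
  rcases lt_trichotomy (r₀ i) 0 with h | h | h
  · rw [cross_circuitCenter_of_neg hθ h]
    split_ifs <;> rw [abs_le] <;> constructor <;> linarith
  · rw [circuitCenter_eq_zero h]
    simp [h]
    linarith
  · rw [cross_circuitCenter_of_pos hθ h]
    have hi0 : 0 < (θ • r₀) i := by simpa [hθ] using h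
    split_ifs <;> rw [abs_le] <;> constructor <;> linarith

theorem IsMultBound.circuit {M : ℕ} (hM : IsMultBound π L K M) (hπ : IsLatticeProjection π L)
    (hK : IsFanComplex π L K) {r₀ : V →₀ ℚ} (hr₀ : IsRelation π r₀.support r₀)
    (hs : r₀.support ∈ K) : IsMultBound π L (subdivide K (circuitCenter r₀)) M := by
  intro t ht hi
  have hc := hK.isCenter_circuitCenter hr₀ hs
  rcases mem_subdivide.1 ht with ⟨h, -⟩ | ⟨η, h1, h2, h3, rfl⟩
  · exact hM t h hi
  · have h : IsLink K (circuitCenter r₀) η := ⟨h1, h2, h3⟩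
    obtain ⟨θ, hθ, hr⟩ := h.exists_circuit_normal hπ hK hr₀
    obtain ⟨i, hci, hη⟩ := h.exists_notMem
    obtain ⟨k, -, hk⟩ := h.exists_mult_le hπ hK hc hr hci hη hi
    exact_mod_cast hk.trans (abs_cross_circuitCenter_le hθ (hM.abs_le hπ hK h3 hr) i k)

/-- A relation that attains the bound comes with coefficient one from the old fan. -/
theorem IsLink.eq_or_eq_neg {M : ℕ} (hM : IsMultBound π L K M) (hM0 : 0 < M)
    (hπ : IsLatticeProjection π L)
    (hK : IsFanComplex π L K) {r₀ : V →₀ ℚ} (hr₀ : IsRelation π r₀.support r₀)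
    (hs : r₀.support ∈ K) {η : Finset V} (h : IsLink K (circuitCenter r₀) η) {θ : ℚ} (hθ : 0 < θ)
    (hr : IsNormalRelation π L (η ∪ (circuitCenter r₀).support) (θ • r₀)) {q : V →₀ ℚ}
    (hq : IsNormalRelation π L (insert (point (circuitCenter r₀)) η) q)
    (hqM : ∃ k, |q k| = M) {i : V} (hci : r₀ i ≠ 0) (hη : i ∉ η) :
    q = cross (circuitCenter r₀) (θ • r₀) i (point (circuitCenter r₀)) ∨
    q = -cross (circuitCenter r₀) (θ • r₀) i (point (circuitCenter r₀)) := by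
  have hc := hK.isCenter_circuitCenter hr₀ hs
  obtain ⟨τ, hτ0, hτ, rfl⟩ := h.exists_smul_cross hπ hK hc hr hq
    (circuitCenter_ne_zero_iff.2 hci) hη
  obtain ⟨k, hk⟩ := hqM
  have hb := hM.abs_le hπ hK h.union_mem hr
  have hρ := hK.point_notMem hc h.union_mem
  have hle : |cross (circuitCenter r₀) (θ • r₀) i (point (circuitCenter r₀)) k| ≤ M := by
    by_cases hkρ : k = point (circuitCenter r₀)
    · rw [hkρ, cross_apply_self]
      · exact hb i
      · by_contra h0; exact hρ (hr.1.mem h0)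
      · by_contra h0; exact hρ (Finset.mem_union_right _ (Finsupp.mem_support_iff.2 h0))
    · rw [cross_apply_of_ne _ _ hkρ]
      exact abs_cross_circuitCenter_le hθ hb i k
  have hM1 : (0 : ℚ) < M := by exact_mod_cast hM0
  rw [Finsupp.smul_apply, smul_eq_mul, abs_mul] at hk
  -- A product of `|τ| ≤ 1` and a coefficient of absolute value at most `M` equals `M`, so no
  -- shrinking takes place.
  have hτ1 : |τ| = 1 := by
    apply le_antisymm hτ
    by_contra hlt
    have := mul_lt_mul_of_pos_right (not_le.1 hlt) hM1
    have h2 := mul_le_mul_of_nonneg_left hle (abs_nonneg τ)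
    linarith
  rcases (abs_eq zero_le_one).1 hτ1 with rfl | rfl
  · left; simp
  · right; simp

end Circuits
-- Inheritance of bad and good relations under circuit subdivisions
section Types
open scoped Classical

section
variable {U : Type*}

/-- The relation `q` arises from `r` by eliminating a positive vertex `i`. -/
structure IsPosChild (r q : U →₀ ℚ) (i ρ : U) : Prop where
  pos : 0 < r i
  apply_self : q ρ = r i
  apply_ne : ∀ k, k ≠ ρ → q k = if 0 < r k then r k - r i else r k

/-- The relation `q` arises from `r` by eliminating a negative vertex `i`. -/
structure IsNegChild (r q : U →₀ ℚ) (i ρ : U) : Prop where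
  neg : r i < 0
  apply_self : q ρ = r i
  apply_ne : ∀ k, k ≠ ρ → q k = if 0 < r k then -r i else 0

variable {r q : U →₀ ℚ} {i ρ : U} {M : ℚ}

theorem IsPosChild.apply_lt (h : IsPosChild r q i ρ) (hM : 0 < M) (hb : ∀ k, |r k| ≤ M)
    {k : U} (hk : k ≠ ρ) : q k < M := by
  have := h.pos
  have hkM := (abs_le.1 (hb k)).2
  rw [h.apply_ne k hk]
  split_ifs <;> linarith

theorem IsPosChild.eq_of_apply_eq (h : IsPosChild r q i ρ) (hM : 0 < M) (hb : ∀ k, |r k| ≤ M)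
    {k : U} (hk : q k = M) : r i = M := by
  by_cases hkρ : k = ρ
  · rw [← h.apply_self, ← hkρ, hk]
  · exact absurd hk (h.apply_lt hM hb hkρ).ne

theorem IsPosChild.eq_of_apply_eq_neg (h : IsPosChild r q i ρ) (hM : 0 < M)
    (hb : ∀ k, |r k| ≤ M) {k : U} (hk : q k = -M) : r k = -M := by
  have hi := h.pos
  by_cases hkρ : k = ρ
  · have := h.apply_self
    rw [← hkρ, hk] at this
    linarith
  · rw [h.apply_ne k hkρ] at hk
    have := (abs_le.1 (hb i)).2
    split_ifs at hk <;> linarith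

theorem IsPosChild.eq_of_pos (h : IsPosChild r q i ρ) (hb : ∀ k, |r k| ≤ M)
    (hi : r i = M) {k : U} (hk : 0 < q k) : k = ρ := by
  by_contra hkρ
  rw [h.apply_ne k hkρ] at hk
  have := (abs_le.1 (hb k)).2
  split_ifs at hk <;> linarith

theorem IsNegChild.eq_of_neg (h : IsNegChild r q i ρ) {k : U} (hk : q k < 0) : k = ρ := by
  by_contra hkρ
  have := h.neg
  rw [h.apply_ne k hkρ] at hk
  split_ifs at hk <;> linarith

theorem IsNegChild.not_isBad (h : IsNegChild r q i ρ) : ¬ IsBad M q := by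
  rintro ⟨-, -, -, k, l, hkl, hk, hl⟩
  exact hkl ((h.eq_of_neg hk).trans (h.eq_of_neg hl).symm)

theorem IsPosChild.not_isBad (h : IsPosChild r q i ρ) (hM : 0 < M) (hb : ∀ k, |r k| ≤ M) :
    ¬ IsBad M q := by
  rintro ⟨⟨m, hm⟩, -, ⟨k, l, hkl, hk, hl⟩, -⟩
  have hi := h.eq_of_apply_eq hM hb hm
  exact hkl ((h.eq_of_pos hb hi hk).trans (h.eq_of_pos hb hi hl).symm)

/-- The only negative coefficient of `q` sits at `ρ`, so a good `q` would have `-M` there and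
several positive coefficients. But then `r i = -M`, orientation leaves `r` with a single positive
vertex, and `q` has no other positive coefficient. -/
theorem IsNegChild.not_isGood (h : IsNegChild r q i ρ) (hM : 0 < M) (hb : ∀ k, |r k| ≤ M)
    (ho : IsOriented r) (hbad : ¬ IsBad M r) : ¬ IsGood M q := by
  rintro (⟨-, -, k, l, hkl, hk, hl⟩ | ⟨⟨j, hj, -⟩, -, k, l, hkl, hk, hl⟩)
  · exact hkl ((h.eq_of_neg hk).trans (h.eq_of_neg hl).symm)
  · have hj : q j = -M := by
      rw [Finsupp.neg_apply] at hj; linarith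
    have hk : 0 < q k := by simpa using hk
    have hl : 0 < q l := by simpa using hl
    have hjρ := h.eq_of_neg (k := j) (by linarith)
    rw [hjρ, h.apply_self] at hj
    obtain ⟨j', -, hj'⟩ := ho.exists_unique_pos hM hb hbad hj
    have key : ∀ k, 0 < q k → k = j' := by
      intro k hk
      have hkρ : k ≠ ρ := by
        rintro rfl
        rw [h.apply_self] at hk
        linarith
      rw [h.apply_ne k hkρ] at hk
      split_ifs at hk with h'
      · exact hj' k h'
      · exact absurd hk (lt_irrefl _)
    exact hkl ((key k hk).trans (key l hl).symm)

/-- If `q` attains `M`, then `r i = M` and `ρ` is the only positive vertex of `q`. The value `-M` of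
`q` already occurs in `r`, so orientation makes `i` the only positive vertex of `r`, and the
negative coefficients are unchanged. -/
theorem IsPosChild.isGoodPos (h : IsPosChild r q i ρ) (hM : 0 < M) (hb : ∀ k, |r k| ≤ M)
    (ho : IsOriented r) (hbad : ¬ IsBad M r) (hg : IsGood M q) :
    IsGoodPos M r ∧ ∀ k, 0 < r k → k = i := by
  rcases hg with ⟨⟨m, hm, -⟩, ⟨l, hl⟩, k, k', hkk, hk, hk'⟩ | ⟨-, ⟨m, hm⟩, k, k', hkk, hk, hk'⟩
  · have hi := h.eq_of_apply_eq hM hb hm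
    have hl := h.eq_of_apply_eq_neg hM hb hl
    obtain ⟨j, hj, hj'⟩ := ho.exists_unique_pos hM hb hbad hl
    have hij := hj' i h.pos
    subst hij
    have key : ∀ k, q k < 0 → r k < 0 := by
      intro k hk
      have hkρ : k ≠ ρ := by
        rintro rfl
        rw [h.apply_self] at hk
        linarith
      rw [h.apply_ne k hkρ] at hk
      split_ifs at hk with h'
      · rw [hj' k h', sub_self] at hk
        exact absurd hk (lt_irrefl _)
      · exact hk
    exact ⟨⟨⟨i, hj, hj'⟩, ⟨l, hl⟩, k, k', hkk, key k hk, key k' hk'⟩, hj'⟩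
  · have hm : q m = M := by
      rw [Finsupp.neg_apply] at hm; linarith
    have hi := h.eq_of_apply_eq hM hb hm
    exact absurd ((h.eq_of_pos hb hi (k := k) (by simpa using hk)).trans
      (h.eq_of_pos hb hi (k := k') (by simpa using hk')).symm) hkk

end

variable {V W : Type*} [AddCommGroup V] [Module ℚ V] [AddCommGroup W] [Module ℚ W]
  {π : V →ₗ[ℚ] W} {L : AddSubgroup W} {K : Finset (Finset V)}

theorem cross_isChild {U : Type*} {r₀ : U →₀ ℚ} {θ : ℚ} (hθ : 0 < θ) {i ρ : U}
    (hi : r₀ i ≠ 0) (hρ : r₀ ρ = 0) :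
    IsPosChild (θ • r₀) (cross (circuitCenter r₀) (θ • r₀) i ρ) i ρ ∨
    IsNegChild (θ • r₀) (cross (circuitCenter r₀) (θ • r₀) i ρ) i ρ := by
  have h1 : (θ • r₀) ρ = 0 := by simp [hρ]
  rcases lt_or_gt_of_ne hi with h | h
  · right
    refine ⟨by simpa using mul_neg_of_pos_of_neg hθ h,
      cross_apply_self h1 (circuitCenter_eq_zero hρ), fun k hk => ?_⟩
    rw [cross_apply_of_ne _ _ hk, cross_circuitCenter_of_neg hθ h]
  · left
    refine ⟨by simpa [hθ] using h,
      cross_apply_self h1 (circuitCenter_eq_zero hρ), fun k hk => ?_⟩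
    rw [cross_apply_of_ne _ _ hk, cross_circuitCenter_of_pos hθ h]

/-- The cones of `K` whose multiplicity attains the bound `M` and is of the type `T`. -/
noncomputable def typeCones (π : V →ₗ[ℚ] W) (L : AddSubgroup W) (K : Finset (Finset V))
    (T : (V →₀ ℚ) → Prop) : Finset (Finset V) :=
  K.filter fun δ => ∃ r, IsNormalRelation π L δ r ∧ T r

/-- The independent cones of multiplicity `M`. -/
noncomputable def multCones (π : V →ₗ[ℚ] W) (L : AddSubgroup W) (K : Finset (Finset V))
    (M : ℕ) : Finset (Finset V) :=
  K.filter fun t => LinearIndepOn ℚ π (t : Set V) ∧ mult π L t = M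

theorem mem_typeCones {T : (V →₀ ℚ) → Prop} {δ : Finset V} :
    δ ∈ typeCones π L K T ↔ δ ∈ K ∧ ∃ r, IsNormalRelation π L δ r ∧ T r := by
  simp [typeCones]

theorem mem_multCones {M : ℕ} {t : Finset V} :
    t ∈ multCones π L K M ↔ t ∈ K ∧ LinearIndepOn ℚ π (t : Set V) ∧ mult π L t = M := by
  simp [multCones]

theorem IsFanComplex.relation_point_eq_zero (hK : IsFanComplex π L K) {r₀ : V →₀ ℚ}
    (hr₀ : IsRelation π r₀.support r₀) (hs : r₀.support ∈ K) : r₀ (point (circuitCenter r₀)) = 0 :=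
  Finsupp.notMem_support_iff.1 (hK.point_notMem (hK.isCenter_circuitCenter hr₀ hs) hs)

/-- The subdivision at a circuit creates no bad cones. -/
theorem bad_subdivide_subset {M : ℕ} (hM : IsMultBound π L K M) (hM0 : 0 < M)
    (hπ : IsLatticeProjection π L) (hK : IsFanComplex π L K) {r₀ : V →₀ ℚ}
    (hr₀ : IsRelation π r₀.support r₀) (hs : r₀.support ∈ K) :
    typeCones π L (subdivide K (circuitCenter r₀)) (IsBad M) ⊆
      (typeCones π L K (IsBad M)).filter (fun δ => ¬ r₀.support ⊆ δ) := by
  intro d hd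
  rw [mem_typeCones] at hd
  obtain ⟨hd, q, hq, hqb⟩ := hd
  rw [Finset.mem_filter, mem_typeCones]
  rcases mem_subdivide.1 hd with ⟨h1, h2⟩ | ⟨η, h1, h2, h3, rfl⟩
  · rw [support_circuitCenter] at h2
    exact ⟨⟨h1, q, hq, hqb⟩, h2⟩
  · exfalso
    have h : IsLink K (circuitCenter r₀) η := ⟨h1, h2, h3⟩
    obtain ⟨θ, hθ, hr⟩ := h.exists_circuit_normal hπ hK hr₀
    obtain ⟨i, hci, hη⟩ := h.exists_notMem
    rw [circuitCenter_ne_zero_iff] at hci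
    have hM1 : (0 : ℚ) < M := by exact_mod_cast hM0
    have hqM : ∃ k, |q k| = M := by
      obtain ⟨⟨l, hl⟩, -⟩ := hqb
      exact ⟨l, by rw [hl, abs_of_pos hM1]⟩
    have hb := hM.abs_le hπ hK h3 hr
    have hnb : ¬ IsBad M
        (cross (circuitCenter r₀) (θ • r₀) i (point (circuitCenter r₀))) := by
      rcases cross_isChild hθ hci (hK.relation_point_eq_zero hr₀ hs) with hc | hc
      · exact hc.not_isBad hM1 hb
      · exact hc.not_isBad
    rcases h.eq_or_eq_neg hM hM0 hπ hK hr₀ hs hθ hr hq hqM hci hη with rfl | rfl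
    · exact hnb hqb
    · exact hnb (by simpa using hqb.neg)

/-- In the absence of bad cones, the subdivision at a circuit does not increase the number of
good cones. -/
theorem card_good_subdivide_le {M : ℕ} (hM : IsMultBound π L K M) (hM0 : 0 < M)
    (hπ : IsLatticeProjection π L) (hK : IsFanComplex π L K)
    (hbad : typeCones π L K (IsBad M) = ∅) {r₀ : V →₀ ℚ}
    (hr₀ : IsRelation π r₀.support r₀) (hs : r₀.support ∈ K) (ho : IsOriented r₀) :
    (typeCones π L (subdivide K (circuitCenter r₀)) (IsGood M)).card ≤
      (typeCones π L K (IsGood M)).card := by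
  set ρ := point (circuitCenter r₀) with hρdef
  have hc := hK.isCenter_circuitCenter hr₀ hs
  have hρ0 := hK.relation_point_eq_zero hr₀ hs
  have hM1 : (0 : ℚ) < M := by exact_mod_cast hM0
  -- Every vertex of the circuit missing from `η` turns out to be its unique positive vertex. Hence
  -- `η` is recovered from `η ∪ r₀.support` by deleting that vertex.
  have hnew : ∀ η, IsLink K (circuitCenter r₀) η →
      insert ρ η ∈ typeCones π L (subdivide K (circuitCenter r₀)) (IsGood M) →
      η ∪ r₀.support ∈ typeCones π L K (IsGood M) ∧ ∃ i, 0 < r₀ i ∧ (∀ k, 0 < r₀ k → k = i) ∧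
        η = (η ∪ r₀.support).erase i := by
    intro η h hd
    obtain ⟨-, q, hq, hqg⟩ := mem_typeCones.1 hd
    obtain ⟨θ, hθ, hr⟩ := h.exists_circuit_normal hπ hK hr₀
    have hb := hM.abs_le hπ hK h.union_mem hr
    have hqM : ∃ k, |q k| = M := by
      rcases hqg with ⟨-, ⟨l, hl⟩, -⟩ | ⟨-, ⟨l, hl⟩, -⟩
      · exact ⟨l, by rw [hl, abs_neg, abs_of_pos hM1]⟩
      · rw [Finsupp.neg_apply, neg_inj] at hl
        exact ⟨l, by rw [hl, abs_of_pos hM1]⟩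
    have hrb : ¬ IsBad (M : ℚ) (θ • r₀) := fun hb => by
      have : η ∪ (circuitCenter r₀).support ∈ typeCones π L K (IsBad M) :=
        mem_typeCones.2 ⟨h.union_mem, _, hr, hb⟩
      rw [hbad] at this
      simp at this
    have key : ∀ i, r₀ i ≠ 0 → i ∉ η → 0 < r₀ i ∧ IsGoodPos M (θ • r₀) ∧
        ∀ k, 0 < r₀ k → k = i := by
      intro i hi hη
      have hg : IsGood M (cross (circuitCenter r₀) (θ • r₀) i ρ) := by
        rcases h.eq_or_eq_neg hM hM0 hπ hK hr₀ hs hθ hr hq hqM hi hη with rfl | rfl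
        · exact hqg
        · simpa using hqg.neg
      rcases cross_isChild hθ hi hρ0 with hch | hch
      · obtain ⟨hgp, hu⟩ := hch.isGoodPos hM1 hb (ho.smul hθ) hrb hg
        exact ⟨by simpa [hθ] using hch.pos, hgp, fun k hk => hu k (by simpa [hθ] using hk)⟩
      · exact absurd hg (hch.not_isGood hM1 hb (ho.smul hθ) hrb)
    obtain ⟨i, hci, hη⟩ := h.exists_notMem
    rw [circuitCenter_ne_zero_iff] at hci
    obtain ⟨hi, hgp, hu⟩ := key i hci hη
    have hU := h.union_mem
    rw [support_circuitCenter] at hU hr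
    refine ⟨mem_typeCones.2 ⟨hU, _, hr, .inl hgp⟩, i, hi, hu, ?_⟩
    ext k
    simp only [Finset.mem_erase, Finset.mem_union, Finsupp.mem_support_iff]
    constructor
    · intro hk
      exact ⟨fun e => hη (e ▸ hk), .inl hk⟩
    · rintro ⟨hki, hk | hk⟩
      · exact hk
      · by_contra hkη
        exact hki (hu k (key k hk hkη).1)
  have hlink : ∀ d ∈ typeCones π L (subdivide K (circuitCenter r₀)) (IsGood M), ρ ∈ d →
      IsLink K (circuitCenter r₀) (d.erase ρ) := by
    intro d hd hρd
    rcases mem_subdivide.1 (mem_typeCones.1 hd).1 with ⟨h1, -⟩ | ⟨η, h1, h2, h3, rfl⟩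
    · exact absurd hρd (hK.point_notMem hc h1)
    · rw [Finset.erase_insert (hK.point_notMem hc h1)]
      exact ⟨h1, h2, h3⟩
  have hold : ∀ d ∈ typeCones π L (subdivide K (circuitCenter r₀)) (IsGood M), ρ ∉ d →
      d ∈ typeCones π L K (IsGood M) ∧ ¬ r₀.support ⊆ d := by
    intro d hd hρd
    obtain ⟨hd, q, hq⟩ := mem_typeCones.1 hd
    rcases mem_subdivide.1 hd with ⟨h1, h2⟩ | ⟨η, h1, h2, h3, rfl⟩
    · rw [support_circuitCenter] at h2
      exact ⟨mem_typeCones.2 ⟨h1, q, hq⟩, h2⟩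
    · exact absurd (Finset.mem_insert_self _ _) hρd
  -- New good cones go to the old cones above them, and old good cones to themselves. The images of
  -- the former contain the circuit and the latter do not, so they cannot collide.
  refine Finset.card_le_card_of_injOn
    (fun d => if ρ ∈ d then d.erase ρ ∪ r₀.support else d) ?_ ?_
  · intro d hd
    dsimp only
    split_ifs with hρd
    · exact (hnew _ (hlink d hd hρd) (by rwa [Finset.insert_erase hρd])).1
    · exact (hold d hd hρd).1
  · intro d hd d' hd' hdd
    dsimp only at hdd
    split_ifs at hdd with h1 h2 h2
    · obtain ⟨-, i, hi, hu, he⟩ := hnew _ (hlink d hd h1) (by rwa [Finset.insert_erase h1])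
      obtain ⟨-, i', hi', -, he'⟩ := hnew _ (hlink d' hd' h2) (by rwa [Finset.insert_erase h2])
      rw [hu i' hi', ← hdd, ← he] at he'
      rw [← Finset.insert_erase h1, ← Finset.insert_erase h2, he']
    · exact absurd (hdd ▸ Finset.subset_union_right) (hold d' hd' h2).2
    · exact absurd (hdd ▸ Finset.subset_union_right) (hold d hd h1).2
    · exact hdd

/-- In the absence of bad and good cones, the subdivision at a circuit that is not a parallel pair
creates no new independent cones of maximal multiplicity. -/
theorem multCones_subdivide_subset {M : ℕ} (hM : IsMultBound π L K M) (hM0 : 0 < M)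
    (hπ : IsLatticeProjection π L) (hK : IsFanComplex π L K)
    (hbad : typeCones π L K (IsBad M) = ∅) (hgood : typeCones π L K (IsGood M) = ∅)
    {r₀ : V →₀ ℚ} (hr₀ : IsRelation π r₀.support r₀) (hs : r₀.support ∈ K) (ho : IsOriented r₀)
    (hpar : ∀ j l, 0 < r₀ j → r₀ l < 0 → ∃ k, r₀ k ≠ 0 ∧ k ≠ j ∧ k ≠ l) :
    multCones π L (subdivide K (circuitCenter r₀)) M ⊆ multCones π L K M := by
  intro t ht
  obtain ⟨ht, hi, hmt⟩ := mem_multCones.1 ht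
  rcases mem_subdivide.1 ht with ⟨h1, -⟩ | ⟨η, h1, h2, h3, rfl⟩
  · exact mem_multCones.2 ⟨h1, hi, hmt⟩
  · exfalso
    have hc := hK.isCenter_circuitCenter hr₀ hs
    have h : IsLink K (circuitCenter r₀) η := ⟨h1, h2, h3⟩
    have hM1 : (0 : ℚ) < M := by exact_mod_cast hM0
    obtain ⟨θ, hθ, hr⟩ := h.exists_circuit_normal hπ hK hr₀
    have hb := hM.abs_le hπ hK h.union_mem hr
    have hno : ∀ T : (V →₀ ℚ) → Prop, typeCones π L K T = ∅ → ¬ T (θ • r₀) := by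
      intro T hT hTr
      have : η ∪ (circuitCenter r₀).support ∈ typeCones π L K T :=
        mem_typeCones.2 ⟨h.union_mem, _, hr, hTr⟩
      rw [hT] at this
      simp at this
    -- Otherwise orientation gives a single positive vertex `j`, with coefficient `M`. The third
    -- vertex supplied by `hpar` is a second negative one, and the relation is good.
    have hX : ∀ l, (θ • r₀) l ≠ -M := by
      intro l hl
      obtain ⟨j, hj, hj'⟩ := (ho.smul hθ).exists_unique_pos hM1 hb (hno _ hbad) hl
      have hl0 : r₀ l < 0 := by
        by_contra h0
        have : 0 ≤ (θ • r₀) l := mul_nonneg hθ.le (not_lt.1 h0)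
        linarith
      have hj0 : 0 < r₀ j := by
        by_contra h0
        have : (θ • r₀) j ≤ 0 := mul_nonpos_of_nonneg_of_nonpos hθ.le (not_lt.1 h0)
        linarith
      obtain ⟨k, hk, hkj, hkl⟩ := hpar j l hj0 hl0
      have hkn : (θ • r₀) k < 0 := by
        refine lt_of_le_of_ne (not_lt.1 fun h0 => hkj (hj' k h0)) ?_
        simpa using ⟨hθ.ne', hk⟩
      exact hno _ hgood (.inl ⟨⟨j, hj, hj'⟩, ⟨l, hl⟩, k, l, hkl, hkn, by linarith⟩)
    obtain ⟨i, hci, hη⟩ := h.exists_notMem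
    obtain ⟨k, -, hk⟩ := h.exists_mult_le hπ hK hc hr hci hη hi
    rw [circuitCenter_ne_zero_iff] at hci
    rw [hmt] at hk
    have hbi := abs_le.1 (hb i)
    have hbk := abs_le.1 (hb k)
    have hXi := lt_of_le_of_ne hbi.1 (Ne.symm (hX i))
    have hXk := lt_of_le_of_ne hbk.1 (Ne.symm (hX k))
    -- With `-M` excluded, every minor is strictly smaller than `M` in absolute value.
    refine absurd hk (not_le.2 ?_)
    rcases lt_or_gt_of_ne hci with h0 | h0
    · rw [cross_circuitCenter_of_neg hθ h0]
      have : (θ • r₀) i < 0 := mul_neg_of_pos_of_neg hθ h0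
      split_ifs
      · rw [abs_of_pos (by linarith)]; linarith
      · simpa using hM0
    · rw [cross_circuitCenter_of_pos hθ h0]
      have : 0 < (θ • r₀) i := mul_pos hθ h0
      split_ifs <;> rw [abs_lt] <;> constructor <;> linarith

end Types
-- Parallelotope points on codefinite faces, and levels of circuits
section Steps
open scoped Classical

variable {V W : Type*} [AddCommGroup V] [Module ℚ V] [AddCommGroup W] [Module ℚ W]
  {π : V →ₗ[ℚ] W} {L : AddSubgroup W} {K : Finset (Finset V)}

/-- `t` is independent and its projection is part of a basis of the lattice. -/
def IsUnimodular (π : V →ₗ[ℚ] W) (L : AddSubgroup W) (t : Finset V) : Prop :=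
  LinearIndepOn ℚ π (t : Set V) ∧ mult π L t = 1

/-- A star subdivision in the relative interior of a cone that is not unimodular. -/
def IsStep (π : V →ₗ[ℚ] W) (L : AddSubgroup W) (K K' : Finset (Finset V)) : Prop :=
  ∃ c, IsCenter π L K c ∧ ¬ IsUnimodular π L c.support ∧ K' = subdivide K c

theorem IsFanComplex.isStep_circuit (hK : IsFanComplex π L K) {r : V →₀ ℚ}
    (hr : IsRelation π r.support r) (hs : r.support ∈ K) :
    IsStep π L K (ToricFan.subdivide K (circuitCenter r)) := by
  refine ⟨_, hK.isCenter_circuitCenter hr hs, fun h => ?_, rfl⟩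
  rw [support_circuitCenter] at h
  exact hr.not_linearIndepOn h.1

/-- No circuit of `K` has coefficients of both signs on `s`. -/
def IsCodefinite (π : V →ₗ[ℚ] W) (K : Finset (Finset V)) (s : Finset V) : Prop :=
  ∀ r : V →₀ ℚ, r.support ∈ K → IsRelation π r.support r → (∃ a ∈ s, 0 < r a) →
    ¬ ∃ b ∈ s, r b < 0

/-- If the carrier were unimodular, the coefficients of a point with lattice projection would be
integers, whereas some coefficient lies strictly between `0` and `1`. -/
theorem IsCenter.isStep {c : V →₀ ℚ} (hc : IsCenter π L K c) (h1 : ∀ v, c v < 1) :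
    IsStep π L K (subdivide K c) := by
  refine ⟨c, hc, fun h => ?_, rfl⟩
  obtain ⟨v, hv⟩ := Finsupp.ne_iff.1 hc.ne_zero
  have hv0 : 0 < c v := lt_of_le_of_ne (hc.nonneg v) (Ne.symm hv)
  obtain ⟨n, hn⟩ := exists_int_of_mult_eq_one h.1 h.2 subset_rfl hc.integral v
  have hv1 := h1 v
  rw [hn] at hv0 hv1
  have a1 : (0 : ℤ) < n := by exact_mod_cast hv0
  have a2 : n < (1 : ℤ) := by exact_mod_cast hv1
  omega

/-- If `c k = 0`, only `c i * r k` is left. Otherwise `r i` and `r k` do not have opposite signs, so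
the two products partly cancel instead of adding up. Each product is below `M` in absolute value
because the coefficients of `c` are below `1`. -/
theorem IsCodefinite.abs_cross_lt (hK : IsFanComplex π L K) {c : V →₀ ℚ} (hc : IsCenter π L K c)
    (h1 : ∀ v, c v < 1) (hs : IsCodefinite π K c.support) {M : ℚ} (hM : 0 < M) {δ : Finset V}
    (hδ : δ ∈ K) {r : V →₀ ℚ} (hr : IsRelation π δ r) (hb : ∀ k, |r k| ≤ M) {i k : V}
    (hi : c i ≠ 0) : |c i * r k - r i * c k| < M := by
  have hci := h1 i
  have hci0 := lt_of_le_of_ne (hc.nonneg i) (Ne.symm hi)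
  have hbk := abs_le.1 (hb k)
  have hbi := abs_le.1 (hb i)
  have hlt : ∀ x y : ℚ, 0 ≤ x → x < 1 → |y| ≤ M → |x * y| < M := by
    intro x y hx hx1 hy
    rw [abs_mul, abs_of_nonneg hx]
    nlinarith [abs_nonneg y]
  by_cases hk : c k = 0
  · rw [hk, mul_zero, sub_zero]
    exact hlt _ _ hci0.le hci (hb k)
  have hck0 := lt_of_le_of_ne (hc.nonneg k) (Ne.symm hk)
  have e1 := abs_lt.1 (hlt _ _ hci0.le hci (hb k))
  have e2 := abs_lt.1 (hlt _ _ hck0.le (h1 k) (hb i))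
  have hrel : IsRelation π r.support r := ⟨hr.1, subset_rfl, hr.3⟩
  have hm := hK.down δ hδ _ hr.2
  have hno : ∀ a b, c a ≠ 0 → c b ≠ 0 → 0 < r a → ¬ r b < 0 := fun a b ha hb h h' =>
    hs r hm hrel ⟨a, Finsupp.mem_support_iff.2 ha, h⟩ ⟨b, Finsupp.mem_support_iff.2 hb, h'⟩
  rcases lt_or_ge 0 (r i) with h | h
  · have h' := not_lt.1 (hno i k hi hk h)
    have := mul_nonneg hci0.le h'
    have := mul_pos hck0 h
    rw [abs_lt]
    constructor <;> linarith
  · rcases lt_or_ge 0 (r k) with h' | h'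
    · rw [le_antisymm h (not_lt.1 (hno k i hk hi h')), zero_mul, sub_zero]
      exact abs_lt.2 e1
    have := mul_nonneg hci0.le (neg_nonneg.2 h')
    have := mul_nonneg hck0.le (neg_nonneg.2 h)
    rw [abs_lt]
    constructor <;> linarith

/-- The effect of the subdivision at a codefinite point of a parallelotope. -/
theorem IsCodefinite.subdivide (hπ : IsLatticeProjection π L) (hK : IsFanComplex π L K)
    {c : V →₀ ℚ} (hc : IsCenter π L K c) (h1 : ∀ v, c v < 1)
    (hs : IsCodefinite π K c.support) {M : ℕ} (hM0 : 0 < M) (hM : IsMultBound π L K M)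
    {η : Finset V} (h : IsLink K c η) :
    (LinearIndepOn ℚ π ((insert (point c) η : Finset V) : Set V) →
      mult π L (insert (point c) η) < M) ∧
    ∀ q, IsNormalRelation π L (insert (point c) η) q → ∀ k, k ≠ point c → |q k| < M := by
  have hM1 : (0 : ℚ) < M := by exact_mod_cast hM0
  obtain ⟨i, hci, hη⟩ := h.exists_notMem
  constructor
  · intro hi
    by_cases hd : LinearIndepOn ℚ π ((η ∪ c.support : Finset V) : Set V)
    · have h2 := (h.mult_le_of_linearIndepOn hπ hK hc hd hci hη).2
      have h3 : (mult π L (η ∪ c.support) : ℚ) ≤ M := by exact_mod_cast hM _ h.union_mem hd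
      have h4 := h1 i
      have h5 := hc.nonneg i
      have : (mult π L (insert (point c) η) : ℚ) < M := by nlinarith
      exact_mod_cast this
    · obtain ⟨r, hr⟩ := hK.exists_normal hπ h.union_mem hd
      obtain ⟨k, -, hk⟩ := h.exists_mult_le hπ hK hc hr hci hη hi
      exact_mod_cast hk.trans_lt (hs.abs_cross_lt hK hc h1 hM1 h.union_mem hr.1
        (hM.abs_le hπ hK h.union_mem hr) hci)
  · intro q hq k hk
    obtain ⟨r, hr⟩ := h.exists_relation hπ hK hc hq
    obtain ⟨θ, -, hθ, rfl⟩ := h.exists_smul_cross hπ hK hc hr hq hci hη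
    have h2 := hs.abs_cross_lt hK hc h1 hM1 h.union_mem hr.1
        (hM.abs_le hπ hK h.union_mem hr) (k := k) hci
    rw [Finsupp.smul_apply, smul_eq_mul, abs_mul, cross_apply_of_ne _ _ hk]
    exact (mul_le_of_le_one_left (abs_nonneg _) hθ).trans_lt h2

theorem IsCodefinite.isMultBound (hπ : IsLatticeProjection π L) (hK : IsFanComplex π L K)
    {c : V →₀ ℚ} (hc : IsCenter π L K c) (h1 : ∀ v, c v < 1)
    (hs : IsCodefinite π K c.support) {M : ℕ} (hM0 : 0 < M) (hM : IsMultBound π L K M) :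
    IsMultBound π L (ToricFan.subdivide K c) M := by
  intro t ht hi
  rcases mem_subdivide.1 ht with ⟨h, -⟩ | ⟨η, a, b, d, rfl⟩
  · exact hM t h hi
  · exact ((hs.subdivide hπ hK hc h1 hM0 hM ⟨a, b, d⟩).1 hi).le

/-- A relation on a new cone can reach absolute value `M` only at the center, so it cannot attain
both `M` and `-M`. -/
theorem IsCodefinite.typeCones_subset (hπ : IsLatticeProjection π L) (hK : IsFanComplex π L K)
    {c : V →₀ ℚ} (hc : IsCenter π L K c) (h1 : ∀ v, c v < 1)
    (hs : IsCodefinite π K c.support) {M : ℕ} (hM0 : 0 < M) (hM : IsMultBound π L K M)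
    {T : (V →₀ ℚ) → Prop} (hT : ∀ r, T r → (∃ l, r l = M) ∧ ∃ l, r l = -M) :
    typeCones π L (ToricFan.subdivide K c) T ⊆
      (typeCones π L K T).filter (fun δ => ¬ c.support ⊆ δ) := by
  intro d hd
  obtain ⟨hd, q, hq, hTq⟩ := mem_typeCones.1 hd
  rw [Finset.mem_filter, mem_typeCones]
  rcases mem_subdivide.1 hd with ⟨h2, h3⟩ | ⟨η, a, b, d, rfl⟩
  · exact ⟨⟨h2, q, hq, hTq⟩, h3⟩
  · exfalso
    have hM1 : (0 : ℚ) < M := by exact_mod_cast hM0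
    have hlt := (hs.subdivide hπ hK hc h1 hM0 hM ⟨a, b, d⟩).2 q hq
    obtain ⟨⟨l, hl⟩, l', hl'⟩ := hT q hTq
    have e : l = point c := by
      by_contra hne
      have := hlt l hne
      rw [hl, abs_of_pos hM1] at this
      exact lt_irrefl _ this
    have e' : l' = point c := by
      by_contra hne
      have := hlt l' hne
      rw [hl', abs_neg, abs_of_pos hM1] at this
      exact lt_irrefl _ this
    rw [e] at hl
    rw [e', hl] at hl'
    linarith

theorem IsCodefinite.multCones_subset (hπ : IsLatticeProjection π L) (hK : IsFanComplex π L K)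
    {c : V →₀ ℚ} (hc : IsCenter π L K c) (h1 : ∀ v, c v < 1)
    (hs : IsCodefinite π K c.support) {M : ℕ} (hM0 : 0 < M) (hM : IsMultBound π L K M) :
    multCones π L (ToricFan.subdivide K c) M ⊆
      (multCones π L K M).filter (fun δ => ¬ c.support ⊆ δ) := by
  intro t ht
  obtain ⟨ht, hi, hmt⟩ := mem_multCones.1 ht
  rw [Finset.mem_filter, mem_multCones]
  rcases mem_subdivide.1 ht with ⟨h2, h3⟩ | ⟨η, a, b, d, rfl⟩
  · exact ⟨⟨h2, hi, hmt⟩, h3⟩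
  · exact absurd hmt ((hs.subdivide hπ hK hc h1 hM0 hM ⟨a, b, d⟩).1 hi).ne

/-- The levels along which circuits become simpler. -/
def IsLevel {U : Type*} (n : ℕ) (r : U →₀ ℚ) : Prop :=
  (∀ k, |r k| ≤ (n / 2 : ℕ)) ∧
    (Even n → (∀ k, r k < (n / 2 : ℕ)) ∨ ∀ k, -((n / 2 : ℕ) : ℚ) < r k)

theorem IsLevel.neg {U : Type*} {n : ℕ} {r : U →₀ ℚ} (h : IsLevel n r) : IsLevel n (-r) := by
  refine ⟨fun k => by simpa using h.1 k, fun hn => ?_⟩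
  rcases h.2 hn with h | h
  · right; intro k; simpa using h k
  · left; intro k
    have := h k
    rw [Finsupp.neg_apply]
    linarith

theorem IsLevel.succ {U : Type*} {n : ℕ} {r : U →₀ ℚ} (h : IsLevel n r) : IsLevel (n + 1) r := by
  rcases Nat.even_or_odd' n with ⟨m, rfl | rfl⟩
  · have e1 : 2 * m / 2 = m := by omega
    have e2 : (2 * m + 1) / 2 = m := by omega
    refine ⟨fun k => ?_, fun hn => ?_⟩
    · have := h.1 k
      rwa [e1, ← e2] at this
    · exact absurd hn (by simp)
  · have e1 : (2 * m + 1) / 2 = m := by omega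
    have e2 : (2 * m + 1 + 1) / 2 = m + 1 := by omega
    have h1 := h.1
    rw [e1] at h1
    refine ⟨fun k => ?_, fun hn => .inl fun k => ?_⟩
    · rw [e2]; push_cast; linarith [h1 k]
    · rw [e2]; push_cast; linarith [h1 k, le_abs_self (r k)]

/-- The circuits that are not codefinite on `s` and not of level `n`. -/
noncomputable def badCircuits (π : V →ₗ[ℚ] W) (L : AddSubgroup W) (K : Finset (Finset V))
    (s : Finset V) (n : ℕ) : Finset (Finset V) :=
  K.filter fun σ => ∃ r : V →₀ ℚ, r.support = σ ∧ IsNormalRelation π L σ r ∧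
    (∃ a ∈ s, 0 < r a) ∧ (∃ b ∈ s, r b < 0) ∧ ¬ IsLevel n r

/-- Level `2m + 1` means `|r| ≤ m`; level `2m` also forbids attaining both `m` and `-m`. A circuit
with both signs away from the center must come from eliminating a positive vertex `i` with `r₀ i`
below the maximum of `r₀`. All its coefficients, up to a factor of absolute value at most one, are
then strictly below that maximum, while the negative ones do not get more negative than before. From
level `2m + 1` this excludes `m` on one side. From level `2m + 2` it excludes absolute value `m +
1`, since there orientation rules out `-(m + 1)`. -/
theorem IsLink.isLevel_of_circuit (hπ : IsLatticeProjection π L) (hK : IsFanComplex π L K)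
    {r₀ : V →₀ ℚ} (hr₀ : IsNormalRelation π L r₀.support r₀) (hs : r₀.support ∈ K)
    (ho : IsOriented r₀) {n : ℕ} (hn : IsLevel (n + 1) r₀) {η : Finset V}
    (h : IsLink K (circuitCenter r₀) η) {q : V →₀ ℚ}
    (hq : IsNormalRelation π L (insert (point (circuitCenter r₀)) η) q)
    (hqs : q.support = insert (point (circuitCenter r₀)) η) {a b : V}
    (ha : a ≠ point (circuitCenter r₀)) (hb : b ≠ point (circuitCenter r₀)) (hqa : 0 < q a)
    (hqb : q b < 0) : IsLevel n q := by
  have hc := hK.isCenter_circuitCenter hr₀.1 hs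
  have hρ0 := hK.relation_point_eq_zero hr₀.1 hs
  set ρ := point (circuitCenter r₀) with hρdef
  obtain ⟨i, hci, hη⟩ := h.exists_notMem
  -- A relation involving every vertex of the new cone leaves no room for vertices outside the old
  -- circuit.
  have hηs : η ∪ (circuitCenter r₀).support = r₀.support := by
    obtain ⟨θ, hθ, hr⟩ := h.exists_circuit_normal hπ hK hr₀.1
    obtain ⟨τ, -, -, rfl⟩ := h.exists_smul_cross hπ hK hc hr hq hci hη
    rw [support_circuitCenter]
    refine Finset.union_eq_right.2 fun k hk => ?_
    have hkρ : k ≠ ρ := by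
      rintro rfl
      exact hK.point_notMem hc h.mem hk
    have hk' : k ∈ (τ • cross (circuitCenter r₀) (θ • r₀) i ρ).support :=
      hqs ▸ Finset.mem_insert_of_mem hk
    rw [Finsupp.mem_support_iff] at hk' ⊢
    intro h0
    apply hk'
    rw [Finsupp.smul_apply, cross_apply_of_ne _ _ hkρ, circuitCenter_eq_zero h0]
    simp [h0]
  obtain ⟨θ, hθ0, hθ, rfl⟩ := h.exists_smul_cross hπ hK hc (r := r₀) (by rwa [hηs]) hq hci hη
  rw [circuitCenter_ne_zero_iff] at hci
  have hch := cross_isChild one_pos hci hρ0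
  rw [one_smul] at hch
  set x := cross (circuitCenter r₀) r₀ i ρ with hx
  have hpos : ∃ k, k ≠ ρ ∧ 0 < x k := by
    rw [Finsupp.smul_apply, smul_eq_mul] at hqa hqb
    rcases pos_and_pos_or_neg_and_neg_of_mul_pos hqa with ⟨_, h2⟩ | ⟨h1, _⟩
    · exact ⟨a, ha, h2⟩
    · exact ⟨b, hb, by nlinarith⟩
  have hneg : ∃ k, k ≠ ρ ∧ x k < 0 := by
    rw [Finsupp.smul_apply, smul_eq_mul] at hqa hqb
    rcases pos_and_pos_or_neg_and_neg_of_mul_pos hqa with ⟨h1, _⟩ | ⟨_, h2⟩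
    · exact ⟨b, hb, by nlinarith⟩
    · exact ⟨a, ha, h2⟩
  have hch : IsPosChild r₀ x i ρ := by
    rcases hch with hch | hch
    · exact hch
    · obtain ⟨k, hk, hxk⟩ := hneg
      exact absurd (hch.eq_of_neg hxk) hk
  obtain ⟨l, hl⟩ := ho.1
  -- A positive coefficient away from the center has the form `r₀ k - r₀ i`, so `r₀ i` is not the
  -- maximum.
  have hil : r₀ i < r₀ l := by
    obtain ⟨k, hk, hxk⟩ := hpos
    rw [hch.apply_ne k hk] at hxk
    have := (le_abs_self _).trans (hl k)
    have := (le_abs_self _).trans (hl i)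
    have := hch.pos
    split_ifs at hxk <;> linarith
  have hi0 := hch.pos
  have hxlt : ∀ R : ℚ, r₀ l ≤ R → ∀ k, x k < R := by
    intro R hR k
    by_cases hk : k = ρ
    · rw [hk, hch.apply_self]; linarith
    · rw [hch.apply_ne k hk]
      have := (le_abs_self _).trans (hl k)
      split_ifs <;> linarith
  have hxle : ∀ R : ℚ, (∀ k, -R < r₀ k) → r₀ l ≤ R → ∀ k, -R < x k := by
    intro R hR1 hR k
    by_cases hk : k = ρ
    · rw [hk, hch.apply_self]; linarith
    · rw [hch.apply_ne k hk]
      have := hR1 k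
      split_ifs <;> linarith
  have hxle' : ∀ R : ℚ, r₀ l ≤ R → ∀ k, -R ≤ x k := by
    intro R hR k
    by_cases hk : k = ρ
    · rw [hk, hch.apply_self]; linarith
    · rw [hch.apply_ne k hk]
      have := (abs_le.1 (hl k)).1
      split_ifs <;> linarith
  rcases Nat.even_or_odd' n with ⟨m, rfl | rfl⟩
  · have e1 : 2 * m / 2 = m := by omega
    have e2 : (2 * m + 1) / 2 = m := by omega
    have hlm : r₀ l ≤ m := by
      have := hn.1 l
      rw [e2] at this
      exact (le_abs_self _).trans this
    have hx1 := hxlt m hlm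
    have hx2 := hxle' m hlm
    have hxa : ∀ k, |x k| ≤ m := fun k => abs_le.2 ⟨hx2 k, (hx1 k).le⟩
    refine ⟨fun k => ?_, fun _ => ?_⟩
    · rw [e1, Finsupp.smul_apply, smul_eq_mul, abs_mul]
      exact (mul_le_of_le_one_left (abs_nonneg _) hθ).trans (hxa k)
    · rw [e1]
      have hm : (0 : ℚ) < m := by linarith
      rcases lt_or_gt_of_ne hθ0 with hθ1 | hθ1
      · right
        intro k
        rw [abs_of_neg hθ1] at hθ
        rw [Finsupp.smul_apply, smul_eq_mul]
        nlinarith [hx1 k]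
      · left
        intro k
        rw [abs_of_pos hθ1] at hθ
        rw [Finsupp.smul_apply, smul_eq_mul]
        nlinarith [hx1 k]
  · have e1 : (2 * m + 1) / 2 = m := by omega
    have e2 : (2 * m + 1 + 1) / 2 = m + 1 := by omega
    have hlm : r₀ l ≤ ((m + 1 : ℕ) : ℚ) := by
      have := hn.1 l
      rw [e2] at this
      exact (le_abs_self _).trans this
    have hstrict : ∀ k, -((m + 1 : ℕ) : ℚ) < r₀ k := by
      have h2 := hn.2 ⟨m + 1, by ring⟩
      rw [e2] at h2
      rcases h2 with h2 | h2
      · intro k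
        have := h2 l
        have := (abs_le.1 (hl k)).1
        linarith
      · exact h2
    have hx1 := hxlt _ hlm
    have hx2 := hxle _ hstrict hlm
    refine ⟨fun k => ?_, fun hev => ?_⟩
    · rw [e1]
      by_cases hk : (θ • x) k = 0
      · rw [hk, abs_zero]; positivity
      · have h3 : |(θ • x) k| < ((m + 1 : ℕ) : ℚ) := by
          rw [Finsupp.smul_apply, smul_eq_mul, abs_mul]
          exact (mul_le_of_le_one_left (abs_nonneg _) hθ).trans_lt (abs_lt.2 ⟨hx2 k, hx1 k⟩)
        -- Normalized coefficients are multiplicities, hence integers up to sign: strictly below `m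
        -- + 1` means at most `m`.
        rw [← hq.2 k hk] at h3 ⊢
        have h4 : mult π L ((insert ρ η).erase k) < m + 1 := by exact_mod_cast h3
        exact_mod_cast Nat.lt_succ_iff.1 h4
    · exact absurd hev (by simp)

end Steps
-- Termination: lowering the maximal multiplicity
section Phases
open scoped Classical
open Relation

variable {V W : Type*} [AddCommGroup V] [Module ℚ V] [AddCommGroup W] [Module ℚ W]
  {π : V →ₗ[ℚ] W} {L : AddSubgroup W} {K : Finset (Finset V)}

theorem mem_badCircuits {s : Finset V} {n : ℕ} {σ : Finset V} : σ ∈ badCircuits π L K s n ↔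
    σ ∈ K ∧ ∃ r : V →₀ ℚ, r.support = σ ∧ IsNormalRelation π L σ r ∧
      (∃ a ∈ s, 0 < r a) ∧ (∃ b ∈ s, r b < 0) ∧ ¬ IsLevel n r := by
  simp [badCircuits]

theorem exists_isMultBound (π : V →ₗ[ℚ] W) (L : AddSubgroup W) (K : Finset (Finset V)) :
    ∃ M, IsMultBound π L K M :=
  ⟨K.sup (mult π L), fun _ ht _ => Finset.le_sup (f := mult π L) ht⟩

theorem IsNormalRelation.exists_oriented {δ : Finset V} {r : V →₀ ℚ}
    (h : IsNormalRelation π L δ r) :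
    ∃ r' : V →₀ ℚ, (r' = r ∨ r' = -r) ∧ IsOriented r' ∧ IsNormalRelation π L δ r' ∧
      r'.support = r.support := by
  rcases isOriented_or_neg h.1.1 with ho | ho
  · exact ⟨r, .inl rfl, ho, h, rfl⟩
  · exact ⟨-r, .inr rfl, ho, h.neg, Finsupp.support_neg r⟩

/-- The vertices of a cone can be made codefinite by subdivisions at circuits. -/
theorem exists_isCodefinite (hπ : IsLatticeProjection π L) {s : Finset V}
    {P : Finset (Finset V) → Prop} (hP : ∀ K, P K → IsFanComplex π L K) (hs : ∀ K, P K → s ∈ K)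
    (hstep : ∀ K r, P K → r.support ∈ K → IsNormalRelation π L r.support r → IsOriented r →
      (∃ a ∈ s, 0 < r a) → (∃ b ∈ s, r b < 0) → P (subdivide K (circuitCenter r)))
    (hK : P K) : ∃ K', ReflTransGen (IsStep π L) K K' ∧ P K' ∧ IsCodefinite π K' s := by
  have hnormal : ∀ K, P K → ∀ r : V →₀ ℚ, r.support ∈ K → IsRelation π r.support r →
      ∃ θ : ℚ, 0 < θ ∧ IsNormalRelation π L r.support (θ • r) := fun K hK r hr h =>
    h.exists_normal hπ.fg hπ.ker ((hP K hK).linearIndepOn hr) ((hP K hK).integral _ hr)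
  -- Outer induction on the level, inner induction on the number of indefinite circuits of level `n
  -- + 1` that are not of level `n`. Subdividing at one of them removes it, and the indefinite
  -- circuits it creates have level `n`.
  have main : ∀ n K, P K → badCircuits π L K s n = ∅ →
      ∃ K', ReflTransGen (IsStep π L) K K' ∧ P K' ∧ IsCodefinite π K' s := by
    intro n
    induction n with
    | zero =>
      intro K hK h0
      refine ⟨K, .refl, hK, ?_⟩
      rintro r hr h ⟨a, ha, hra⟩ ⟨b, hb, hrb⟩
      obtain ⟨θ, hθ, hn⟩ := hnormal K hK r hr h
      have : r.support ∈ badCircuits π L K s 0 := by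
        refine mem_badCircuits.2 ⟨hr, θ • r, Finsupp.support_smul_eq hθ.ne', hn,
          ⟨a, ha, mul_pos hθ hra⟩, ⟨b, hb, mul_neg_of_pos_of_neg hθ hrb⟩, fun hl => ?_⟩
        have := hl.1 a
        have h3 : 0 < (θ • r) a := mul_pos hθ hra
        rw [abs_of_pos h3] at this
        simp only [Nat.zero_div, Nat.cast_zero] at this
        linarith
      rw [h0] at this
      simp at this
    | succ n ih =>
      have inner : ∀ m K, P K → badCircuits π L K s (n + 1) = ∅ →
          (badCircuits π L K s n).card ≤ m →
          ∃ K', ReflTransGen (IsStep π L) K K' ∧ P K' ∧ IsCodefinite π K' s := by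
        intro m
        induction m with
        | zero =>
          intro K hK _ h
          exact ih K hK (Finset.card_eq_zero.1 (Nat.le_zero.1 h))
        | succ m ihm =>
          intro K hK h1 h2
          by_cases h0 : badCircuits π L K s n = ∅
          · exact ih K hK h0
          obtain ⟨σ, hσ⟩ := Finset.nonempty_iff_ne_empty.2 h0
          obtain ⟨hσK, r, rfl, hr, ⟨a, ha, hra⟩, ⟨b, hb, hrb⟩, hlev⟩ := mem_badCircuits.1 hσ
          have hlev1 : IsLevel (n + 1) r := by
            by_contra hcon
            have : r.support ∈ badCircuits π L K s (n + 1) :=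
              mem_badCircuits.2 ⟨hσK, r, rfl, hr, ⟨a, ha, hra⟩, ⟨b, hb, hrb⟩, hcon⟩
            rw [h1] at this
            simp at this
          obtain ⟨r', hr', ho, hn', hsupp⟩ := hr.exists_oriented
          have hF := hP K hK
          have hpn : (∃ a ∈ s, 0 < r' a) ∧ (∃ b ∈ s, r' b < 0) ∧ IsLevel (n + 1) r' := by
            rcases hr' with rfl | rfl
            · exact ⟨⟨a, ha, hra⟩, ⟨b, hb, hrb⟩, hlev1⟩
            · exact ⟨⟨b, hb, by simpa using hrb⟩, ⟨a, ha, by simpa using hra⟩, hlev1.neg⟩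
          rw [← hsupp] at hn' hσK hσ
          have hP1 := hstep K r' hK hσK hn' ho hpn.1 hpn.2.1
          have hc := hF.isCenter_circuitCenter hn'.1 hσK
          have hsub : ∀ k, k ≤ n + 1 → n ≤ k →
              badCircuits π L (subdivide K (circuitCenter r')) s k ⊆
                (badCircuits π L K s k).erase r'.support := by
            intro k hk hk' τ hτ
            obtain ⟨hτK, q, hqs, hq, ⟨x, hx, hqx⟩, ⟨y, hy, hqy⟩, hql⟩ := mem_badCircuits.1 hτ
            rcases mem_subdivide.1 hτK with ⟨h3, h4⟩ | ⟨η, e1, e2, e3, rfl⟩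
            · rw [support_circuitCenter] at h4
              exact Finset.mem_erase.2 ⟨fun e => h4 (e ▸ subset_rfl), mem_badCircuits.2
                ⟨h3, q, hqs, hq, ⟨x, hx, hqx⟩, ⟨y, hy, hqy⟩, hql⟩⟩
            · exfalso
              have hne : ∀ x ∈ s, x ≠ point (circuitCenter r') := by
                rintro x hx rfl
                exact hF.point_notMem hc (hs K hK) hx
              have hl : IsLevel n q := IsLink.isLevel_of_circuit hπ hF hn' hσK ho hpn.2.2
                ⟨e1, e2, e3⟩ hq hqs (hne x hx) (hne y hy) hqx hqy
              rcases (show k = n ∨ k = n + 1 by omega) with rfl | rfl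
              · exact hql hl
              · exact hql hl.succ
          obtain ⟨K', hK', h⟩ := ihm _ hP1
            (Finset.subset_empty.1 ((hsub (n + 1) le_rfl (Nat.le_succ n)).trans
              (by rw [h1]; simp)))
            (by
              have h3 := Finset.card_le_card (hsub n (Nat.le_succ n) le_rfl)
              rw [Finset.card_erase_of_mem hσ] at h3
              omega)
          exact ⟨K', .head (hF.isStep_circuit hn'.1 hσK) hK', h⟩
      intro K hK h1
      exact inner _ K hK h1 le_rfl
  obtain ⟨M, hM⟩ := exists_isMultBound π L K
  -- At the odd level `2 * M + 1` only the bound `M` on the coefficients is required, without a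
  -- condition on the extreme values.
  refine main (2 * M + 1) K hK ?_
  by_contra h
  obtain ⟨σ, hσ⟩ := Finset.nonempty_iff_ne_empty.2 h
  obtain ⟨hσK, r, rfl, hr, -, -, hlev⟩ := mem_badCircuits.1 hσ
  refine hlev ⟨fun k => ?_, fun hev => absurd hev (by simp)⟩
  have e : (2 * M + 1) / 2 = M := by omega
  rw [e]
  exact hM.abs_le hπ (hP K hK) hσK hr k

theorem IsGood.attains {U : Type*} {M : ℚ} {r : U →₀ ℚ} (h : IsGood M r) :
    (∃ l, r l = M) ∧ ∃ l, r l = -M := by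
  rcases h with ⟨⟨j, hj, -⟩, hl, -⟩ | ⟨⟨j, hj, -⟩, ⟨l, hl⟩, -⟩
  · exact ⟨⟨j, hj⟩, hl⟩
  · rw [Finsupp.neg_apply] at hj hl
    exact ⟨⟨l, by linarith⟩, ⟨j, by linarith⟩⟩

/-- Subdivisions at bad circuits remove all bad cones. -/
theorem exists_bad_eq_empty (hπ : IsLatticeProjection π L) {M : ℕ} (hM0 : 0 < M)
    (hK : IsFanComplex π L K) (hM : IsMultBound π L K M) :
    ∃ K', ReflTransGen (IsStep π L) K K' ∧ IsFanComplex π L K' ∧ IsMultBound π L K' M ∧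
      typeCones π L K' (IsBad M) = ∅ := by
  induction h : (typeCones π L K (IsBad M)).card using Nat.strong_induction_on generalizing K with
  | _ m ih =>
  by_cases h0 : typeCones π L K (IsBad M) = ∅
  · exact ⟨K, .refl, hK, hM, h0⟩
  obtain ⟨δ, hδ⟩ := Finset.nonempty_iff_ne_empty.2 h0
  obtain ⟨hδK, r, hr, -⟩ := mem_typeCones.1 hδ
  have hrel : IsRelation π r.support r := ⟨hr.1.1, subset_rfl, hr.1.3⟩
  have hs := hK.down δ hδK _ hr.1.2
  have hsub := bad_subdivide_subset hM hM0 hπ hK hrel hs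
  have hlt : (typeCones π L (subdivide K (circuitCenter r)) (IsBad M)).card < m := by
    rw [← h]
    refine Finset.card_lt_card ((Finset.ssubset_iff_of_subset
      (hsub.trans (Finset.filter_subset _ _))).2 ⟨δ, hδ, fun hd => ?_⟩)
    exact (Finset.mem_filter.1 (hsub hd)).2 hr.1.2
  obtain ⟨K', hK', h'⟩ := ih _ hlt (hK.subdivide (hK.isCenter_circuitCenter hrel hs))
    (hM.circuit hπ hK hrel hs) rfl
  exact ⟨K', .head (hK.isStep_circuit hrel hs) hK', h'⟩

/-- A point of the parallelotope of an independent cone whose multiplicity is not one. -/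
theorem IsFanComplex.exists_center (hK : IsFanComplex π L K) {t : Finset V} (ht : t ∈ K)
    (hmt : mult π L t ≠ 1) : ∃ c : V →₀ ℚ, c.support ⊆ t ∧ (∀ v, c v < 1) ∧
      ∀ K', c.support ∈ K' → IsCenter π L K' c := by
  obtain ⟨c, h0, h1, h2, h3, h4⟩ := exists_of_mult_ne_one (hK.integral t ht) hmt
  refine ⟨c, h1, h3, fun K' hK' => ⟨h2, hK', h0, fun v hv => ?_, h4⟩⟩
  have := h3 v
  simp [hv] at this

/-- In the absence of bad cones, the good cones can be removed. -/
theorem exists_good_eq_empty (hπ : IsLatticeProjection π L) {M : ℕ} (hM2 : 2 ≤ M)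
    (hK : IsFanComplex π L K) (hM : IsMultBound π L K M)
    (hbad : typeCones π L K (IsBad M) = ∅) :
    ∃ K', ReflTransGen (IsStep π L) K K' ∧ IsFanComplex π L K' ∧ IsMultBound π L K' M ∧
      typeCones π L K' (IsBad M) = ∅ ∧ typeCones π L K' (IsGood M) = ∅ := by
  have hM0 : 0 < M := by omega
  have hM1 : (0 : ℚ) < M := by exact_mod_cast hM0
  induction h : (typeCones π L K (IsGood M)).card using Nat.strong_induction_on generalizing K with
  | _ m ih =>
  by_cases h0 : typeCones π L K (IsGood M) = ∅
  · exact ⟨K, .refl, hK, hM, hbad, h0⟩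
  obtain ⟨δ, hδ⟩ := Finset.nonempty_iff_ne_empty.2 h0
  obtain ⟨hδK, hr⟩ := mem_typeCones.1 hδ
  obtain ⟨r, hr, ⟨j, hj, hju⟩, -, -⟩ : ∃ r, IsNormalRelation π L δ r ∧ IsGoodPos M r := by
    obtain ⟨r, hr, hg | hg⟩ := hr
    · exact ⟨r, hr, hg⟩
    · exact ⟨-r, hr.neg, hg⟩
  have hjm : (mult π L (δ.erase j) : ℚ) = M := by
    rw [hr.2 j (by rw [hj]; exact hM1.ne'), hj, abs_of_pos hM1]
  have hjm : mult π L (δ.erase j) = M := by exact_mod_cast hjm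
  obtain ⟨c, hcs, hc1, hc⟩ := hK.exists_center (hK.down δ hδK _ (Finset.erase_subset j δ))
    (by omega)
  obtain ⟨K₁, hK₁, ⟨hF₁, hB₁, hbad₁, hg₁, hδ₁⟩, hcod⟩ := exists_isCodefinite hπ (s := c.support)
    (K := K) (P := fun K' => IsFanComplex π L K' ∧ IsMultBound π L K' M ∧
      typeCones π L K' (IsBad M) = ∅ ∧ (typeCones π L K' (IsGood M)).card ≤ m ∧ δ ∈ K')
    (fun K' h => h.1)
    (fun K' h => h.1.down δ h.2.2.2.2 _ (hcs.trans (Finset.erase_subset j δ)))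
    (by
      rintro K' x ⟨a1, a2, a3, a4, a5⟩ hxs hx ho ⟨a, ha, hxa⟩ ⟨b, hb, hxb⟩
      refine ⟨a1.subdivide (a1.isCenter_circuitCenter hx.1 hxs), a2.circuit hπ a1 hx.1 hxs,
        Finset.subset_empty.1 ?_, (card_good_subdivide_le a2 hM0 hπ a1 a3 hx.1 hxs ho).trans a4,
        mem_subdivide.2 (.inl ⟨a5, fun hsub => ?_⟩)⟩
      · exact (bad_subdivide_subset a2 hM0 hπ a1 hx.1 hxs).trans (by rw [a3]; simp)
      · rw [support_circuitCenter] at hsub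
        -- A circuit inside `δ` is a multiple of `r`, whose only positive vertex `j` is outside the
        -- support of `c`. It cannot have both signs on that support, so `δ` survives.
        obtain ⟨θ, rfl⟩ := hr.1.exists_smul hπ.ker (a1.linearIndepOn a5) hsub hx.1.3
        have hle : ∀ v ∈ c.support, r v ≤ 0 := by
          intro v hv
          by_contra hcon
          exact (Finset.mem_erase.1 (hcs hv)).1 (hju v (not_le.1 hcon))
        have h1 := hle a ha
        have h2 := hle b hb
        rw [Finsupp.smul_apply, smul_eq_mul] at hxa hxb
        rcases le_total 0 θ with hθ | hθ
        · exact absurd hxa (not_lt.2 (mul_nonpos_of_nonneg_of_nonpos hθ h1))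
        · exact absurd hxb (not_lt.2 (mul_nonneg_of_nonpos_of_nonpos hθ h2)))
    ⟨hK, hM, hbad, h.le, hδK⟩
  have hcs' : c.support ⊆ δ := hcs.trans (Finset.erase_subset j δ)
  have hcc := hc K₁ (hF₁.down δ hδ₁ _ hcs')
  have hsubg := hcod.typeCones_subset hπ hF₁ hcc hc1 hM0 hB₁ (T := IsGood M)
    (fun r hr => hr.attains)
  have hsubb := hcod.typeCones_subset hπ hF₁ hcc hc1 hM0 hB₁ (T := IsBad M)
    (fun r hr => ⟨hr.1, hr.2.1⟩)
  have hδg : δ ∈ typeCones π L K₁ (IsGood M) :=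
    mem_typeCones.2 ⟨hδ₁, (mem_typeCones.1 hδ).2⟩
  have hlt : (typeCones π L (subdivide K₁ c) (IsGood M)).card < m := by
    refine (Finset.card_lt_card ((Finset.ssubset_iff_of_subset
      (hsubg.trans (Finset.filter_subset _ _))).2 ⟨δ, hδg, fun hd => ?_⟩)).trans_le hg₁
    exact (Finset.mem_filter.1 (hsubg hd)).2 hcs'
  obtain ⟨K', hK', h'⟩ := ih _ hlt (hF₁.subdivide hcc) (hcod.isMultBound hπ hF₁ hcc hc1 hM0 hB₁)
    (Finset.subset_empty.1 (hsubb.trans (by rw [hbad₁]; simp))) rfl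
  exact ⟨K', hK₁.trans (.head (hcc.isStep hc1) hK'), h'⟩

/-- In the absence of bad and good cones, the cones of maximal multiplicity can be removed. -/
theorem exists_mult_eq_empty (hπ : IsLatticeProjection π L) {M : ℕ} (hM2 : 2 ≤ M)
    (hK : IsFanComplex π L K) (hM : IsMultBound π L K M)
    (hbad : typeCones π L K (IsBad M) = ∅) (hgood : typeCones π L K (IsGood M) = ∅) :
    ∃ K', ReflTransGen (IsStep π L) K K' ∧ IsFanComplex π L K' ∧ IsMultBound π L K' M ∧
      multCones π L K' M = ∅ := by
  have hM0 : 0 < M := by omega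
  induction h : (multCones π L K M).card using Nat.strong_induction_on generalizing K with
  | _ m ih =>
  by_cases h0 : multCones π L K M = ∅
  · exact ⟨K, .refl, hK, hM, h0⟩
  obtain ⟨t, ht⟩ := Finset.nonempty_iff_ne_empty.2 h0
  obtain ⟨htK, hti, htm⟩ := mem_multCones.1 ht
  obtain ⟨c, hcs, hc1, hc⟩ := hK.exists_center htK (by omega)
  obtain ⟨K₁, hK₁, ⟨hF₁, hB₁, hbad₁, hg₁, hm₁, ht₁⟩, hcod⟩ := exists_isCodefinite hπ
    (s := c.support) (K := K) (P := fun K' => IsFanComplex π L K' ∧ IsMultBound π L K' M ∧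
      typeCones π L K' (IsBad M) = ∅ ∧ typeCones π L K' (IsGood M) = ∅ ∧
      (multCones π L K' M).card ≤ m ∧ t ∈ K')
    (fun K' h => h.1)
    (fun K' h => h.1.down t h.2.2.2.2.2 _ hcs)
    (by
      rintro K' x ⟨a1, a2, a3, a4, a5, a6⟩ hxs hx ho ⟨a, ha, hxa⟩ ⟨b, hb, hxb⟩
      have hnot : ¬ x.support ⊆ t := fun hsub =>
        hx.1.1 (linearIndepOn_iff_support.1 hti x hsub hx.1.3)
      refine ⟨a1.subdivide (a1.isCenter_circuitCenter hx.1 hxs), a2.circuit hπ a1 hx.1 hxs,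
        Finset.subset_empty.1 ?_, Finset.card_eq_zero.1 (Nat.le_zero.1 ?_),
        (Finset.card_le_card (multCones_subdivide_subset a2 hM0 hπ a1 a3 a4 hx.1 hxs ho ?_)).trans
          a5, mem_subdivide.2 (.inl ⟨a6, by rwa [support_circuitCenter]⟩)⟩
      · exact (bad_subdivide_subset a2 hM0 hπ a1 hx.1 hxs).trans (by rw [a3]; simp)
      · exact (card_good_subdivide_le a2 hM0 hπ a1 a3 hx.1 hxs ho).trans (by rw [a4]; simp)
      -- A circuit on just two vertices with both signs on the support of `c` would be contained in
      -- the independent cone `t`.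
      · intro j l hj hl
        by_contra hcon
        push Not at hcon
        apply hnot
        have hmem : ∀ v ∈ c.support, v ∈ t := fun v hv => hcs hv
        intro k hk
        by_cases hkj : k = j
        · by_cases haj : a = j
          · rw [hkj, ← haj]; exact hcs ha
          · have := hcon a hxa.ne' haj
            rw [this] at hxa
            linarith
        · have hkl := hcon k (Finsupp.mem_support_iff.1 hk) hkj
          by_cases hbj : b = j
          · rw [hbj] at hxb; linarith
          · rw [hkl, ← hcon b hxb.ne hbj]; exact hcs hb)
    ⟨hK, hM, hbad, hgood, h.le, htK⟩
  have hcc := hc K₁ (hF₁.down t ht₁ _ hcs)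
  have hsubg := hcod.typeCones_subset hπ hF₁ hcc hc1 hM0 hB₁ (T := IsGood M)
    (fun r hr => hr.attains)
  have hsubb := hcod.typeCones_subset hπ hF₁ hcc hc1 hM0 hB₁ (T := IsBad M)
    (fun r hr => ⟨hr.1, hr.2.1⟩)
  have hsubm := hcod.multCones_subset hπ hF₁ hcc hc1 hM0 hB₁
  have hlt : (multCones π L (subdivide K₁ c) M).card < m := by
    refine (Finset.card_lt_card ((Finset.ssubset_iff_of_subset
      (hsubm.trans (Finset.filter_subset _ _))).2
        ⟨t, mem_multCones.2 ⟨ht₁, hti, htm⟩, fun hd => ?_⟩)).trans_le hm₁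
    exact (Finset.mem_filter.1 (hsubm hd)).2 hcs
  obtain ⟨K', hK', h'⟩ := ih _ hlt (hF₁.subdivide hcc) (hcod.isMultBound hπ hF₁ hcc hc1 hM0 hB₁)
    (Finset.subset_empty.1 (hsubb.trans (by rw [hbad₁]; simp)))
    (Finset.subset_empty.1 (hsubg.trans (by rw [hg₁]; simp))) rfl
  exact ⟨K', hK₁.trans (.head (hcc.isStep hc1) hK'), h'⟩

/-- The three removals are carried out in turn for each value of the bound. They stop at one because
the parallelotope points they use require multiplicity at least two. -/
theorem exists_isMultBound_one (hπ : IsLatticeProjection π L) {M : ℕ}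
    (hK : IsFanComplex π L K) (hM : IsMultBound π L K M) :
    ∃ K', ReflTransGen (IsStep π L) K K' ∧ IsMultBound π L K' 1 := by
  induction M generalizing K with
  | zero => exact ⟨K, .refl, fun t ht hi => (hM t ht hi).trans zero_le_one⟩
  | succ M ih =>
    by_cases hM2 : 2 ≤ M + 1
    · obtain ⟨K₁, hK₁, hF₁, hB₁, hbad₁⟩ := exists_bad_eq_empty hπ (by omega) hK hM
      obtain ⟨K₂, hK₂, hF₂, hB₂, hbad₂, hg₂⟩ := exists_good_eq_empty hπ hM2 hF₁ hB₁ hbad₁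
      obtain ⟨K₃, hK₃, hF₃, hB₃, hm₃⟩ := exists_mult_eq_empty hπ hM2 hF₂ hB₂ hbad₂ hg₂
      obtain ⟨K', hK', h⟩ := ih hF₃ (fun t ht hi => by
        refine Nat.lt_succ_iff.1 (lt_of_le_of_ne (hB₃ t ht hi) fun he => ?_)
        have : t ∈ multCones π L K₃ (M + 1) := mem_multCones.2 ⟨ht, hi, he⟩
        rw [hm₃] at this
        simp at this)
      exact ⟨K', ((hK₁.trans hK₂).trans hK₃).trans hK', h⟩
    · exact ⟨K, .refl, fun t ht hi => (hM t ht hi).trans (by omega)⟩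

theorem exists_isUnimodular (hπ : IsLatticeProjection π L) (hK : IsFanComplex π L K) :
    ∃ K', ReflTransGen (IsStep π L) K K' ∧
      ∀ t ∈ K', LinearIndepOn ℚ π (t : Set V) → IsUnimodular π L t := by
  obtain ⟨M, hM⟩ := exists_isMultBound π L K
  obtain ⟨K', h1, h2⟩ := exists_isMultBound_one hπ hK hM
  exact ⟨K', h1, fun t ht hi =>
    ⟨hi, le_antisymm (h2 t ht hi) (Nat.one_le_iff_ne_zero.2 (mult_ne_zero hπ.fg t))⟩⟩

theorem IsUnimodular.mono (hπ : IsLatticeProjection π L) {s t : Finset V}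
    (ht : IsUnimodular π L t) (hst : s ⊆ t) (hv : ∀ v ∈ t, π v ∈ L) : IsUnimodular π L s :=
  ⟨ht.1.mono (by exact_mod_cast hst), le_antisymm (ht.2 ▸ mult_mono hπ.fg hst hv ht.1)
    (Nat.one_le_iff_ne_zero.2 (mult_ne_zero hπ.fg s))⟩

/-- A cone that disappears has the carrier of the center as a face, and faces of unimodular cones
are unimodular. -/
theorem IsStep.mem_of_isUnimodular (hπ : IsLatticeProjection π L) (hK : IsFanComplex π L K)
    {K' : Finset (Finset V)} (h : IsStep π L K K') {t : Finset V} (ht : t ∈ K)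
    (hu : IsUnimodular π L t) : t ∈ K' := by
  obtain ⟨c, -, hn, rfl⟩ := h
  exact mem_subdivide.2 (.inl ⟨ht, fun hs => hn (hu.mono hπ hs (hK.integral t ht))⟩)

end Phases
-- Cones spanned by vertex sets and their faces
section Cones
open scoped Classical

variable {V : Type*} [AddCommGroup V] [Module ℚ V]

/-- The cone generated by a finite set of vertices. -/
noncomputable def cone (t : Finset V) : PointedCone ℚ V := PointedCone.hull ℚ (t : Set V)

theorem mem_cone {t : Finset V} {x : V} : x ∈ cone t ↔
    ∃ a : V →₀ ℚ, a.support ⊆ t ∧ (∀ v, 0 ≤ a v) ∧ Finsupp.linearCombination ℚ id a = x := by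
  rw [cone, PointedCone.mem_hull_set]
  simp only [Finset.coe_subset]
  rfl

theorem subset_cone {t : Finset V} {v : V} (hv : v ∈ t) : v ∈ cone t :=
  PointedCone.subset_hull hv

theorem cone_mono {s t : Finset V} (h : s ⊆ t) : cone s ≤ cone t :=
  Submodule.span_mono (by exact_mod_cast h)

theorem cone_le {t : Finset V} {C : PointedCone ℚ V} : cone t ≤ C ↔ ∀ v ∈ t, v ∈ C := by
  rw [cone, Submodule.span_le]
  rfl

theorem eq_of_linearIndepOn {t : Finset V} (ht : LinearIndepOn ℚ id (t : Set V)) {a b : V →₀ ℚ}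
    (ha : a.support ⊆ t) (hb : b.support ⊆ t)
    (h : Finsupp.linearCombination ℚ id a = Finsupp.linearCombination ℚ id b) : a = b :=
  sub_eq_zero.1 ((linearIndepOn_iff_support (π := LinearMap.id)).1 ht (a - b)
    (Finsupp.support_sub.trans (Finset.union_subset ha hb)) (by
      have : Finsupp.linearCombination ℚ id (a - b) = 0 := by rw [map_sub, h, sub_self]
      exact this))

theorem linearCombination_mem_cone_iff {t u : Finset V} (ht : LinearIndepOn ℚ id (t : Set V))
    (hu : u ⊆ t) {a : V →₀ ℚ} (ha : a.support ⊆ t) (ha0 : ∀ v, 0 ≤ a v) :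
    Finsupp.linearCombination ℚ id a ∈ cone u ↔ a.support ⊆ u := by
  constructor
  · intro h
    obtain ⟨b, hb, -, hab⟩ := mem_cone.1 h
    rwa [eq_of_linearIndepOn ht ha (hb.trans hu) hab.symm]
  · intro h
    exact mem_cone.2 ⟨a, h, ha0, rfl⟩

theorem support_single_one {U : Type*} (v : U) : (Finsupp.single v (1 : ℚ)).support = {v} :=
  Finsupp.support_single _ one_ne_zero

theorem single_one_nonneg {U : Type*} (v u : U) : 0 ≤ Finsupp.single v (1 : ℚ) u := by
  rw [Finsupp.single_apply]
  split_ifs <;> norm_num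

theorem mem_cone_iff_mem {t u : Finset V} (ht : LinearIndepOn ℚ id (t : Set V))
    (hu : u ⊆ t) {v : V} (hv : v ∈ t) : v ∈ cone u ↔ v ∈ u := by
  have := linearCombination_mem_cone_iff ht hu (a := Finsupp.single v 1)
    (by simpa [support_single_one] using hv) (single_one_nonneg v)
  simpa [support_single_one] using this

theorem isFaceOf_cone {t u : Finset V} (ht : LinearIndepOn ℚ id (t : Set V)) (hu : u ⊆ t) :
    (cone u).IsFaceOf (cone t) := by
  refine ⟨cone_mono hu, ?_⟩
  intro x y α hx hy hα h
  obtain ⟨a, ha, ha0, rfl⟩ := mem_cone.1 hx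
  obtain ⟨b, hb, hb0, rfl⟩ := mem_cone.1 hy
  rw [← map_smul, ← map_add, linearCombination_mem_cone_iff ht hu
    (Finsupp.support_add.trans (Finset.union_subset (Finsupp.support_smul.trans ha) hb))
    (fun v => add_nonneg (mul_nonneg hα.le (ha0 v)) (hb0 v))] at h
  refine mem_cone.2 ⟨a, fun v hv => h ?_, ha0, rfl⟩
  rw [Finsupp.mem_support_iff] at hv ⊢
  have h1 : 0 < a v := lt_of_le_of_ne (ha0 v) (Ne.symm hv)
  have h2 : 0 < α * a v := mul_pos hα h1
  have h3 := hb0 v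
  simp only [Finsupp.add_apply, Finsupp.smul_apply, smul_eq_mul]
  linarith

theorem mem_of_linearCombination_mem {t : Finset V} {F : PointedCone ℚ V}
    (hF : F.IsFaceOf (cone t)) {a : V →₀ ℚ} (ha : a.support ⊆ t) (ha0 : ∀ v, 0 ≤ a v)
    (h : Finsupp.linearCombination ℚ id a ∈ F) {v : V} (hv : v ∈ a.support) : v ∈ F := by
  have hpos : 0 < a v := lt_of_le_of_ne (ha0 v) (Ne.symm (Finsupp.mem_support_iff.1 hv))
  have e : a v • v + Finsupp.linearCombination ℚ id (a.erase v) =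
      Finsupp.linearCombination ℚ id a := by
    conv_rhs => rw [← Finsupp.single_add_erase v a]
    simp
  refine hF.mem_of_smul_add_mem (a := a v) (subset_cone (ha hv))
    (y := Finsupp.linearCombination ℚ id (a.erase v)) (mem_cone.2 ⟨_, ?_, fun u => ?_, rfl⟩) hpos
    (by rwa [e])
  · rw [Finsupp.support_erase]
    exact (Finset.erase_subset _ _).trans ha
  · rw [Finsupp.erase_apply]
    split_ifs
    · exact le_rfl
    · exact ha0 u

theorem IsFaceOf.eq_cone {t : Finset V} {F : PointedCone ℚ V} (hF : F.IsFaceOf (cone t)) :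
    F = cone (t.filter (· ∈ F)) := by
  apply le_antisymm
  · intro x hx
    obtain ⟨a, ha, ha0, rfl⟩ := mem_cone.1 (hF.le hx)
    exact mem_cone.2 ⟨a, fun v hv => Finset.mem_filter.2
      ⟨ha hv, mem_of_linearCombination_mem hF ha ha0 hx hv⟩, ha0, rfl⟩
  · exact cone_le.2 fun v hv => (Finset.mem_filter.1 hv).2

variable {W : Type*} [AddCommGroup W] [Module ℚ W] {π : V →ₗ[ℚ] W} {L : AddSubgroup W}
  {K : Finset (Finset V)}

theorem IsFanComplex.linearCombination_mem_cone_iff (hK : IsFanComplex π L K) {t : Finset V}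
    (ht : t ∈ K) {c : V →₀ ℚ} (hc : ∀ v, 0 ≤ c v) (hs : c.support ∈ K) :
    Finsupp.linearCombination ℚ id c ∈ cone t ↔ c.support ⊆ t := by
  constructor
  · intro h
    obtain ⟨a, ha, ha0, hac⟩ := mem_cone.1 h
    rwa [← hK.uniq a c ha0 hc (hK.down t ht _ ha) hs hac]
  · intro h
    exact mem_cone.2 ⟨c, h, hc, rfl⟩

theorem IsFanComplex.cone_le_cone_iff (hK : IsFanComplex π L K) {s t : Finset V} (hs : s ∈ K)
    (ht : t ∈ K) : cone s ≤ cone t ↔ s ⊆ t := by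
  refine ⟨fun h v hv => ?_, cone_mono⟩
  have := (hK.linearCombination_mem_cone_iff ht (c := Finsupp.single v 1) (single_one_nonneg v)
    (by rw [support_single_one]; exact hK.down s hs _ (by simpa using hv))).1
    (by simpa using h (subset_cone hv))
  simpa [support_single_one] using this

theorem IsFanComplex.inf_cone (hK : IsFanComplex π L K) {s t : Finset V} (hs : s ∈ K)
    (ht : t ∈ K) : cone s ⊓ cone t = cone (s ∩ t) := by
  apply le_antisymm
  · rintro x ⟨h1, h2⟩
    obtain ⟨a, ha, ha0, rfl⟩ := mem_cone.1 h1
    exact mem_cone.2 ⟨a, Finset.subset_inter ha ((hK.linearCombination_mem_cone_iff ht ha0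
      (hK.down s hs _ ha)).1 h2), ha0, rfl⟩
  · exact le_inf (cone_mono Finset.inter_subset_left) (cone_mono Finset.inter_subset_right)

theorem cone_insert (v : V) (t : Finset V) :
    cone (insert v t) = cone t ⊔ PointedCone.hull ℚ {v} := by
  rw [cone, cone, Finset.coe_insert, Set.insert_eq, sup_comm]
  exact Submodule.span_union _ _

/-- The fan of the cones of a complex. -/
def fan (K : Finset (Finset V)) : Set (PointedCone ℚ V) := cone '' (K : Set (Finset V))

theorem cone_mem_fan {t : Finset V} (ht : t ∈ K) : cone t ∈ fan K := ⟨t, ht, rfl⟩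

end Cones

/-! ### From complexes to fans -/

section Fans
open scoped Classical

variable {N : Type*} [AddCommGroup N] {L : AddSubgroup (NQ N)} {K : Finset (Finset (NPlusQ N))}

theorem IsPiStrictlyConvex.anti {σ τ : PointedCone ℚ (NPlusQ N)} (h : σ ≤ τ)
    (hτ : IsPiStrictlyConvex τ) : IsPiStrictlyConvex σ := by
  refine ConvexCone.Salient.anti ?_ hτ
  rintro _ ⟨x, hx, rfl⟩
  exact ⟨x, h hx, rfl⟩

theorem IsFanComplex.isSimplicialFan (hK : IsFanComplex (proj N) L K)
    (h : ∀ σ ∈ fan K, IsPiStrictlyConvex σ) : IsSimplicialFan (fan K) where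
  finite := K.finite_toSet.image _
  simplicial := by
    rintro _ ⟨t, ht, rfl⟩
    exact ⟨t, t.finite_toSet, hK.linearIndepOn ht, rfl⟩
  piStrictlyConvex := h
  face_mem := by
    rintro _ ⟨t, ht, rfl⟩ τ hτ
    rw [IsFaceOf.eq_cone hτ]
    exact cone_mem_fan (hK.down t ht _ (Finset.filter_subset _ _))
  inf_face := by
    rintro _ ⟨s, hs, rfl⟩ _ ⟨t, ht, rfl⟩
    rw [hK.inf_cone hs ht]
    exact ⟨isFaceOf_cone (hK.linearIndepOn hs) Finset.inter_subset_left,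
      isFaceOf_cone (hK.linearIndepOn ht) Finset.inter_subset_right⟩

/-- By uniqueness of coefficients, the center lies in `cone t` exactly when `c.support ⊆ t`. A cone
containing both `t` and the center thus exists exactly when `t ∪ c.support ∈ K`. -/
theorem IsFanComplex.fan_subdivide (hK : IsFanComplex (proj N) L K) {c : NPlusQ N →₀ ℚ}
    (hc : IsCenter (proj N) L K c) :
    fan (ToricFan.subdivide K c) = starSubdivision (fan K) (point c) := by
  have hmem : ∀ t ∈ K, point c ∈ cone t ↔ c.support ⊆ t := fun t ht =>
    hK.linearCombination_mem_cone_iff ht hc.nonneg hc.mem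
  ext σ
  constructor
  · rintro ⟨t, ht, rfl⟩
    rcases mem_subdivide.1 ht with ⟨h1, h2⟩ | ⟨η, h1, h2, h3, rfl⟩
    · exact .inl ⟨cone_mem_fan h1, by rwa [hmem t h1]⟩
    · refine .inr ⟨cone η, cone_mem_fan h1, by rwa [hmem η h1], ⟨_, cone_mem_fan h3,
        cone_mono Finset.subset_union_left, ?_⟩, cone_insert _ _⟩
      rw [hmem _ h3]
      exact Finset.subset_union_right
  · rintro (⟨⟨t, ht, rfl⟩, h⟩ | ⟨_, ⟨t, ht, rfl⟩, h, ⟨_, ⟨δ, hδ, rfl⟩, h1, h2⟩, rfl⟩)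
    · rw [hmem t ht] at h
      exact cone_mem_fan (mem_subdivide.2 (.inl ⟨ht, h⟩))
    · rw [hmem t ht] at h
      rw [hmem δ hδ] at h2
      rw [hK.cone_le_cone_iff ht hδ] at h1
      rw [← cone_insert]
      exact cone_mem_fan (mem_subdivide.2 (.inr ⟨t, ht, h,
        hK.down δ hδ _ (Finset.union_subset h1 h2), rfl⟩))

theorem IsStep.isStarSubdivision (hK : IsFanComplex (proj N) L K)
    {K' : Finset (Finset (NPlusQ N))} (h : IsStep (proj N) L K K') :
    IsStarSubdivision (fan K) (fan K') := by
  obtain ⟨c, hc, -, rfl⟩ := h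
  refine ⟨point c, fun h0 => ?_, ⟨_, cone_mem_fan hc.mem, mem_cone.2 ⟨c, subset_rfl, hc.nonneg,
    rfl⟩⟩, hK.fan_subdivide hc⟩
  refine hc.ne_zero (hK.uniq c 0 hc.nonneg (fun v => le_rfl) hc.mem
    (hK.down _ hc.mem _ (by simp)) ?_)
  rw [map_zero]
  exact h0

theorem IsStep.isPiStrictlyConvex (hK : IsFanComplex (proj N) L K)
    {K' : Finset (Finset (NPlusQ N))} (h : IsStep (proj N) L K K')
    (hs : ∀ σ ∈ fan K, IsPiStrictlyConvex σ) : ∀ σ ∈ fan K', IsPiStrictlyConvex σ := by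
  obtain ⟨c, hc, -, rfl⟩ := h
  rintro _ ⟨t, ht, rfl⟩
  rcases mem_subdivide.1 ht with ⟨h1, h2⟩ | ⟨η, h1, h2, h3, rfl⟩
  · exact hs _ (cone_mem_fan h1)
  · refine (hs _ (cone_mem_fan h3)).anti (cone_le.2 fun v hv => ?_)
    rcases Finset.mem_insert.1 hv with rfl | hv
    · exact (hK.linearCombination_mem_cone_iff h3 hc.nonneg hc.mem).2 Finset.subset_union_right
    · exact subset_cone (Finset.mem_union_left _ hv)

/-- The positive and negative parts of a linear relation among the projected vertices are two points
of the cone with the same image. -/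
theorem isPiIndependent_cone {t : Finset (NPlusQ N)}
    (ht : LinearIndepOn ℚ id (t : Set (NPlusQ N))) :
    IsPiIndependent (cone t) ↔ LinearIndepOn ℚ (proj N) (t : Set (NPlusQ N)) := by
  constructor
  · intro h
    refine linearIndepOn_iff_support.2 fun r hr h0 => ?_
    obtain ⟨p, n, hps, hns, hp, hn, hsub⟩ := exists_nonneg_sub_nonneg r
    replace hps := hps.trans hr
    replace hns := hns.trans hr
    have := h (mem_cone.2 ⟨p, hps, hp, rfl⟩)
      (mem_cone.2 ⟨n, hns, hn, rfl⟩) (by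
        rw [← linearCombination_eq_map, ← linearCombination_eq_map, ← sub_eq_zero, ← map_sub,
          ← hsub, h0])
    rw [hsub, eq_of_linearIndepOn ht hps hns this, sub_self]
  · intro h x hx y hy hxy
    obtain ⟨a, ha, -, rfl⟩ := mem_cone.1 hx
    obtain ⟨b, hb, -, rfl⟩ := mem_cone.1 hy
    rw [← linearCombination_eq_map, ← linearCombination_eq_map, ← sub_eq_zero, ← map_sub] at hxy
    rw [sub_eq_zero.1 (linearIndepOn_iff_support.1 h _
      (Finsupp.support_sub.trans (Finset.union_subset ha hb)) hxy)]

theorem map_cone (t : Finset (NPlusQ N)) : PointedCone.map (proj N) (cone t) =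
    PointedCone.hull ℚ (proj N '' (t : Set (NPlusQ N))) := by
  rw [PointedCone.map, cone]
  exact Submodule.map_span _ _

end Fans
-- Nonsingular cones and unimodular vertex sets
section Lattice
open scoped Classical

variable {N : Type*} [AddCommGroup N]

/-- The lattice `N` in `N_ℚ`. -/
def lattice (N : Type*) [AddCommGroup N] : AddSubgroup (NQ N) :=
  ((TensorProduct.mk ℤ ℚ N 1).toAddMonoidHom).range

theorem exists_nsmul_mem_lattice (x : NQ N) : ∃ n : ℕ, 0 < n ∧ (n : ℚ) • x ∈ lattice N := by
  induction x using TensorProduct.induction_on with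
  | zero => exact ⟨1, one_pos, by simp [(lattice N).zero_mem]⟩
  | tmul q m =>
    refine ⟨q.den, q.den_pos, q.num • m, ?_⟩
    change (1 : ℚ) ⊗ₜ[ℤ] (q.num • m) = _
    rw [TensorProduct.tmul_smul, TensorProduct.smul_tmul', TensorProduct.smul_tmul',
      zsmul_eq_mul, mul_one, smul_eq_mul, Rat.den_mul_eq_num]
  | add x y hx hy =>
    obtain ⟨n, hn, hx⟩ := hx
    obtain ⟨m, hm, hy⟩ := hy
    refine ⟨n * m, Nat.mul_pos hn hm, ?_⟩
    rw [smul_add]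
    refine add_mem ?_ ?_
    · have := (lattice N).nsmul_mem hx m
      rw [← Nat.cast_smul_eq_nsmul ℚ, smul_smul, mul_comm] at this
      exact_mod_cast this
    · have := (lattice N).nsmul_mem hy n
      rw [← Nat.cast_smul_eq_nsmul ℚ, smul_smul] at this
      exact_mod_cast this

theorem isLatticeProjection_proj (N : Type*) [AddCommGroup N] [Module.Finite ℤ N] :
    IsLatticeProjection (proj N) (lattice N) where
  fg := by
    have : AddGroup.FG N := Module.Finite.iff_addGroup_fg.1 inferInstance
    exact (AddGroup.fg_iff_addSubgroup_fg _).1 (AddGroup.fg_range _)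
  ker := by
    intro x y hx hy hx0
    let e := TensorProduct.prodRight ℤ ℚ ℚ N ℤ
    have hproj : ∀ z, proj N z = (e z).1 := by
      intro z
      have : proj N = LinearMap.fst ℚ _ _ ∘ₗ e.toLinearMap := by
        ext z
        · simp [proj, e]
        · simp [proj, e]
      rw [this]; rfl
    let f := TensorProduct.AlgebraTensorModule.rid ℤ ℚ ℚ
    have hfx : f (e x).2 ≠ 0 := by
      intro h0
      apply hx0
      apply e.injective
      rw [map_zero]
      exact Prod.ext (by rw [← hproj, hx]; rfl) (f.injective (by rw [h0, Prod.snd_zero, map_zero]))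
    refine ⟨f (e y).2 / f (e x).2, e.injective (Prod.ext ?_ (f.injective ?_))⟩
    · rw [← hproj, ← hproj, map_smul, hx, hy, smul_zero]
    · rw [map_smul, Prod.smul_snd, map_smul, smul_eq_mul, div_mul_cancel₀ _ hfx]

/-- `x` belongs to a basis of the lattice. -/
def IsBasisVector (x : NQ N) : Prop :=
  ∃ (b : Module.Basis (Fin (Module.finrank ℤ N)) ℤ N) (i : Fin (Module.finrank ℤ N)),
    (1 : ℚ) ⊗ₜ[ℤ] b i = x

theorem IsBasisVector.mem_lattice {x : NQ N} (h : IsBasisVector x) : x ∈ lattice N := by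
  obtain ⟨b, i, rfl⟩ := h
  exact ⟨_, rfl⟩

theorem IsBasisVector.isInt {x : NQ N} (h : IsBasisVector x) {q : ℚ} (hq : q • x ∈ lattice N) :
    ∃ n : ℤ, q = n := by
  obtain ⟨b, i, rfl⟩ := h
  obtain ⟨m, hm⟩ := hq
  refine ⟨b.repr m i, ?_⟩
  have h1 := congrArg (fun z => (b.baseChange ℚ).repr z i) hm
  have h2 : (b.baseChange ℚ) i = (1 : ℚ) ⊗ₜ[ℤ] b i := Module.Basis.baseChange_apply ..
  simp only [← h2, map_smul, Module.Basis.repr_self] at h1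
  change ((b.baseChange ℚ).repr ((1 : ℚ) ⊗ₜ[ℤ] m)) i = _ at h1
  rw [Module.Basis.baseChange_repr_tmul] at h1
  simpa using h1.symm

/-- Both `q` and `q⁻¹` are integers, since basis vectors are primitive. -/
theorem IsBasisVector.eq_of_smul {x : NQ N} (h : IsBasisVector x) {q : ℚ} (hq0 : 0 < q)
    (hq : IsBasisVector (q • x)) : q = 1 := by
  obtain ⟨n, hn⟩ := h.isInt hq.mem_lattice
  obtain ⟨m, hm⟩ := hq.isInt (q := q⁻¹) (by
    rw [smul_smul, inv_mul_cancel₀ hq0.ne', one_smul]; exact h.mem_lattice)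
  have h1 : (n : ℚ) * m = 1 := by rw [← hn, ← hm, mul_inv_cancel₀ hq0.ne']
  have h1 : n * m = 1 := by exact_mod_cast h1
  have h2 : 0 < n := by
    have : (0 : ℚ) < n := hn ▸ hq0
    exact_mod_cast this
  rw [hn, Int.eq_one_or_neg_one_of_mul_eq_one h1 |>.resolve_right (by omega)]
  rfl

theorem baseChange_eq (b : Module.Basis (Fin (Module.finrank ℤ N)) ℤ N) :
    (fun i => (1 : ℚ) ⊗ₜ[ℤ] b i) = b.baseChange ℚ := by
  funext i
  exact (Module.Basis.baseChange_apply ..).symm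

/-- The rays of a simplicial cone are generated by its vertices. -/
theorem exists_smul_mem_of_isFaceOf {W : Type*} [AddCommGroup W] [Module ℚ W] {t : Finset W}
    (ht : LinearIndepOn ℚ id (t : Set W)) {w : W} (hw0 : w ≠ 0)
    (h : (PointedCone.hull ℚ {w}).IsFaceOf (cone t)) : ∃ q : ℚ, 0 < q ∧ q • w ∈ t := by
  have he := IsFaceOf.eq_cone h
  have : ∃ v ∈ t, v ∈ PointedCone.hull ℚ {w} := by
    by_contra hcon
    push Not at hcon
    rw [Finset.filter_eq_empty_iff.2 (fun v hv => hcon v hv)] at he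
    have hwm : w ∈ PointedCone.hull ℚ {w} := PointedCone.subset_hull rfl
    rw [he, cone, Finset.coe_empty] at hwm
    exact hw0 (by simpa [PointedCone.hull] using hwm)
  obtain ⟨v, hv, hvw⟩ := this
  obtain ⟨⟨q, hq⟩, rfl⟩ := Submodule.mem_span_singleton.1 hvw
  refine ⟨q, lt_of_le_of_ne hq fun h0 => ?_, hv⟩
  subst h0
  exact ht.ne_zero hv (zero_smul ℚ w)

/-- Two linearly independent sets that generate the same cone agree up to positive scalars. -/
theorem exists_smul_mem_of_cone_eq {W : Type*} [AddCommGroup W] [Module ℚ W] {s t : Finset W}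
    (hs : LinearIndepOn ℚ id (s : Set W)) (ht : LinearIndepOn ℚ id (t : Set W))
    (h : cone s = cone t) {w : W} (hw : w ∈ s) : ∃ q : ℚ, 0 < q ∧ q • w ∈ t := by
  refine exists_smul_mem_of_isFaceOf ht (hs.ne_zero hw) ?_
  have := isFaceOf_cone hs (u := {w}) (by simpa using hw)
  rwa [cone, Finset.coe_singleton, h] at this

/-- A nonsingular cone with suitably normalized vertices is unimodular. -/
theorem isUnimodular_of_isPiNonsingularCone {t : Finset (NPlusQ N)}
    (ht : LinearIndepOn ℚ id (t : Set (NPlusQ N)))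
    (hn : ∀ v ∈ t, ∀ q : ℚ, 0 < q → IsBasisVector (q • proj N v) → IsBasisVector (proj N v))
    (h : IsPiNonsingularCone (cone t)) : IsUnimodular (proj N) (lattice N) t := by
  have hi := (isPiIndependent_cone ht).1 h.1
  refine ⟨hi, ?_⟩
  obtain ⟨-, b, s, hs⟩ := h
  have hbi := (b.baseChange ℚ).linearIndependent
  rw [← baseChange_eq] at hbi
  have hBI : LinearIndepOn ℚ id (((fun i => (1 : ℚ) ⊗ₜ[ℤ] b i) '' s)) :=
    (hbi.linearIndepOn s).id_image
  have hmem : ∀ v ∈ t, ∃ i, (1 : ℚ) ⊗ₜ[ℤ] b i = proj N v := by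
    intro v hv
    have hfin : ((fun i => (1 : ℚ) ⊗ₜ[ℤ] b i) '' s).Finite := s.toFinite.image _
    obtain ⟨q, hq, hqv⟩ := exists_smul_mem_of_cone_eq (s := t.image (proj N))
      (t := hfin.toFinset) (by rw [Finset.coe_image]; exact hi.id_image)
      (by rw [hfin.coe_toFinset]; exact hBI)
      (by rw [cone, cone, hfin.coe_toFinset, ← hs, map_cone, Finset.coe_image])
      (Finset.mem_image_of_mem _ hv)
    obtain ⟨i, -, hiq⟩ := hfin.mem_toFinset.1 hqv
    have hq1 : IsBasisVector (q • proj N v) := ⟨b, i, hiq⟩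
    -- Normalization makes `proj N v` itself a basis vector, and positively proportional basis
    -- vectors coincide; so the vertices project into the given basis `b`.
    have := (hn v hv q hq hq1).eq_of_smul hq hq1
    subst this
    exact ⟨i, by simpa using hiq⟩
  rw [mult, latticeIndex, AddSubgroup.relIndex_eq_one]
  set I := {i | (1 : ℚ) ⊗ₜ[ℤ] b i ∈ proj N '' (t : Set (NPlusQ N))} with hI
  have hT : proj N '' (t : Set (NPlusQ N)) = b.baseChange ℚ '' I := by
    rw [← baseChange_eq]
    ext x
    constructor
    · rintro ⟨v, hv, rfl⟩
      obtain ⟨i, hi⟩ := hmem v hv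
      exact ⟨i, by rw [hI, Set.mem_ofPred_eq, hi]; exact ⟨v, hv, rfl⟩, hi⟩
    · rintro ⟨i, hi, rfl⟩
      exact hi
  rintro x ⟨⟨m, rfl⟩, hx⟩
  change (1 : ℚ) ⊗ₜ[ℤ] m ∈ _ at hx
  change (1 : ℚ) ⊗ₜ[ℤ] m ∈ _
  replace hx : (1 : ℚ) ⊗ₜ[ℤ] m ∈ Submodule.span ℚ (proj N '' (t : Set (NPlusQ N))) := hx
  rw [hT, Module.Basis.mem_span_image] at hx
  have hm : (1 : ℚ) ⊗ₜ[ℤ] m = ∑ i, b.repr m i • ((1 : ℚ) ⊗ₜ[ℤ] b i) := by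
    conv_lhs => rw [← b.sum_repr m]
    rw [TensorProduct.tmul_sum]
    exact Finset.sum_congr rfl fun i _ => TensorProduct.tmul_smul _ _ _
  rw [hm]
  refine sum_mem fun i _ => ?_
  by_cases hi0 : b.repr m i = 0
  · rw [hi0, zero_smul]; exact zero_mem _
  · refine AddSubgroup.zsmul_mem _ (AddSubgroup.subset_closure ?_) _
    refine hx (?_ : i ∈ _)
    rw [Finset.mem_coe, Finsupp.mem_support_iff, Module.Basis.baseChange_repr_tmul]
    simpa using hi0

/-- A unimodular cone is nonsingular. -/
theorem IsUnimodular.isPiNonsingularCone [Module.Free ℤ N] [Module.Finite ℤ N]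
    {t : Finset (NPlusQ N)}
    (ht : LinearIndepOn ℚ id (t : Set (NPlusQ N))) (hv : ∀ v ∈ t, proj N v ∈ lattice N)
    (h : IsUnimodular (proj N) (lattice N) t) : IsPiNonsingularCone (cone t) := by
  refine ⟨(isPiIndependent_cone ht).2 h.1, ?_⟩
  choose! g hg using hv
  replace hg : ∀ v ∈ t, (1 : ℚ) ⊗ₜ[ℤ] g v = proj N v := hg
  obtain ⟨hi, h1⟩ := h
  rw [mult, latticeIndex, AddSubgroup.relIndex_eq_one] at h1
  have hinj : ∀ m m' : N, (1 : ℚ) ⊗ₜ[ℤ] m = (1 : ℚ) ⊗ₜ[ℤ] m' → m = m' := by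
    intro m m' hmm
    let b := Module.finBasis ℤ N
    apply b.repr.injective
    ext i
    have := congrArg (fun z => (b.baseChange ℚ).repr z i) hmm
    simpa [Module.Basis.baseChange_repr_tmul] using this
  have hgi : LinearIndependent ℤ (fun v : t => g v) := by
    rw [Fintype.linearIndependent_iff]
    intro c hc v
    have h2 : LinearIndependent ℚ (fun v : t => proj N v) := hi
    rw [Fintype.linearIndependent_iff] at h2
    have := h2 (fun v => (c v : ℚ)) (by
      have h3 := congrArg (fun m => (1 : ℚ) ⊗ₜ[ℤ] m) hc
      simp only [TensorProduct.tmul_zero, TensorProduct.tmul_sum] at h3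
      rw [← h3]
      refine Finset.sum_congr rfl fun v _ => ?_
      rw [← hg v v.2, TensorProduct.tmul_smul, Int.cast_smul_eq_zsmul]) v
    exact_mod_cast this
  set P := Submodule.span ℤ (Set.range fun v : t => g v) with hP
  have hmemP : ∀ m : N, (1 : ℚ) ⊗ₜ[ℤ] m ∈
      AddSubgroup.closure (proj N '' (t : Set (NPlusQ N))) → m ∈ P := by
    intro m hm
    have : AddSubgroup.closure (proj N '' (t : Set (NPlusQ N))) ≤
        P.toAddSubgroup.map (TensorProduct.mk ℤ ℚ N 1).toAddMonoidHom := by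
      rw [AddSubgroup.closure_le]
      rintro _ ⟨v, hv, rfl⟩
      exact ⟨g v, Submodule.subset_span ⟨⟨v, hv⟩, rfl⟩, hg v hv⟩
    obtain ⟨m', hm', he⟩ := this hm
    rw [← hinj m' m he]
    exact hm'
  have hPspan : ∀ m ∈ P, (1 : ℚ) ⊗ₜ[ℤ] m ∈
      Submodule.span ℚ (proj N '' (t : Set (NPlusQ N))) := by
    intro m hm
    induction hm using Submodule.span_induction with
    | mem m hm =>
      obtain ⟨v, rfl⟩ := hm
      exact Submodule.subset_span ⟨v, v.2, (hg v v.2).symm⟩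
    | zero => simp
    | add x y _ _ hx hy => rw [TensorProduct.tmul_add]; exact add_mem hx hy
    | smul a x _ hx =>
      rw [TensorProduct.tmul_smul, ← Int.cast_smul_eq_zsmul ℚ]
      exact Submodule.smul_mem _ _ hx
  -- Index one says that `P` is saturated. The quotient is then free, and a basis of it extends the
  -- basis of `P` to one of `N`.
  have htf : Module.IsTorsionFree ℤ (N ⧸ P) := by
    refine Module.isTorsionFree_iff_smul_eq_zero.2 fun a x hax => ?_
    obtain ⟨m, rfl⟩ := P.mkQ_surjective x
    refine or_iff_not_imp_left.2 fun ha => ?_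
    have ham : a • m ∈ P := by
      rw [← map_smul] at hax
      exact (Submodule.Quotient.mk_eq_zero P).1 hax
    refine (Submodule.Quotient.mk_eq_zero P).2 (hmemP m (h1 ⟨⟨m, rfl⟩, ?_⟩))
    have h4 := Submodule.smul_mem _ (a : ℚ)⁻¹ (hPspan _ ham)
    rw [TensorProduct.tmul_smul, ← Int.cast_smul_eq_zsmul ℚ, smul_smul,
      inv_mul_cancel₀ (Int.cast_ne_zero.2 ha), one_smul] at h4
    exact h4
  have hfree : Module.Free ℤ (N ⧸ P) := inferInstance
  let bP : Module.Basis t ℤ P := Module.Basis.span hgi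
  have hbP : ∀ v : t, (bP v : N) = g v := fun v => Module.Basis.coe_span_apply hgi v
  let bQ := Module.Free.chooseBasis ℤ (N ⧸ P)
  let b₀ := Module.Basis.sumQuot bP bQ
  have hcard : Nonempty (t ⊕ Module.Free.ChooseBasisIndex ℤ (N ⧸ P) ≃
      Fin (Module.finrank ℤ N)) := by
    rw [← Fintype.card_eq, Fintype.card_fin, Module.finrank_eq_card_basis b₀]
  obtain ⟨e⟩ := hcard
  refine ⟨b₀.reindex e, Set.range (fun v : t => e (Sum.inl v)), ?_⟩
  rw [map_cone]
  congr 1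
  ext x
  constructor
  · rintro ⟨v, hv, rfl⟩
    refine ⟨_, ⟨⟨v, hv⟩, rfl⟩, ?_⟩
    rw [← hg v hv]
    simp [b₀, hbP]
  · rintro ⟨_, ⟨v, rfl⟩, rfl⟩
    refine ⟨v, v.2, ?_⟩
    rw [← hg v v.2]
    simp [b₀, hbP]

end Lattice
-- Normalized vertices for the initial fan
section Initial
open scoped Classical

theorem hull_singleton_smul {W : Type*} [AddCommGroup W] [Module ℚ W] {q : ℚ} (hq : 0 < q)
    (w : W) : PointedCone.hull ℚ {q • w} = PointedCone.hull ℚ {w} := by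
  apply le_antisymm <;> refine Submodule.span_le.2 (Set.singleton_subset_iff.2 ?_)
  · exact Submodule.mem_span_singleton.2 ⟨⟨q, hq.le⟩, rfl⟩
  · refine Submodule.mem_span_singleton.2 ⟨⟨q⁻¹, (inv_pos.2 hq).le⟩, ?_⟩
    change q⁻¹ • q • w = w
    rw [smul_smul, inv_mul_cancel₀ hq.ne', one_smul]

variable {N : Type*} [AddCommGroup N]

/-- A vertex is normalized if its projection lies in the lattice, and belongs to a basis of the
lattice whenever a positive multiple of it does. -/
def IsNormalized (v : NPlusQ N) : Prop :=
  proj N v ∈ lattice N ∧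
    ∀ q : ℚ, 0 < q → IsBasisVector (q • proj N v) → IsBasisVector (proj N v)

/-- Take a multiple projecting to a basis vector if there is one; otherwise clear denominators, and
the second condition is vacuous. -/
theorem exists_isNormalized_smul (v : NPlusQ N) : ∃ q : ℚ, 0 < q ∧ IsNormalized (q • v) := by
  by_cases h : ∃ q : ℚ, 0 < q ∧ IsBasisVector (q • proj N v)
  · obtain ⟨q, hq, h⟩ := h
    rw [← map_smul] at h
    exact ⟨q, hq, h.mem_lattice, fun _ _ _ => h⟩
  · obtain ⟨n, hn, hmem⟩ := exists_nsmul_mem_lattice (proj N v)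
    refine ⟨n, by exact_mod_cast hn, by rwa [map_smul], fun q hq hb => absurd ?_ h⟩
    rw [map_smul, smul_smul] at hb
    exact ⟨_, mul_pos hq (by exact_mod_cast hn), hb⟩

/-- The generator is a function of the ray alone, so that cones sharing a ray share the
corresponding vertex. -/
theorem exists_normalized_generators (N : Type*) [AddCommGroup N] :
    ∃ g : PointedCone ℚ (NPlusQ N) → NPlusQ N, ∀ v : NPlusQ N, v ≠ 0 →
      IsNormalized (g (PointedCone.hull ℚ {v})) ∧
        ∃ q : ℚ, 0 < q ∧ g (PointedCone.hull ℚ {v}) = q • v := by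
  have h1 : ∀ ρ : PointedCone ℚ (NPlusQ N), (∃ v : NPlusQ N, v ≠ 0 ∧ PointedCone.hull ℚ {v} = ρ) →
      ∃ w : NPlusQ N, w ≠ 0 ∧ PointedCone.hull ℚ {w} = ρ ∧ IsNormalized w := by
    rintro _ ⟨v, hv, rfl⟩
    obtain ⟨q, hq, h⟩ := exists_isNormalized_smul v
    exact ⟨q • v, smul_ne_zero hq.ne' hv, hull_singleton_smul hq v, h⟩
  choose! g hg0 hg hgn using h1
  refine ⟨g, fun v hv => ⟨hgn _ ⟨v, hv, rfl⟩, ?_⟩⟩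
  have h2 := hg _ ⟨v, hv, rfl⟩
  have hi : ∀ w : NPlusQ N, w ≠ 0 →
      LinearIndepOn ℚ id ((({w} : Finset (NPlusQ N)) : Set (NPlusQ N))) := fun w hw => by
    rw [Finset.coe_singleton]
    exact LinearIndepOn.singleton hw
  obtain ⟨q, hq, h⟩ := exists_smul_mem_of_cone_eq (s := {v}) (t := {g (PointedCone.hull ℚ {v})})
    (hi _ hv) (hi _ (hg0 _ ⟨v, hv, rfl⟩)) (by simp [cone, h2]) (Finset.mem_singleton_self v)
  exact ⟨q, hq, (Finset.mem_singleton.1 h).symm⟩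

/-- The vertices of a cone `σ` are the chosen generators that lie in `σ`. No extra ones occur: a ray
of the fan contained in `σ` is its own intersection with `σ`, hence a face of `σ`. -/
theorem IsSimplicialFan.exists_isFanComplex {S : Set (PointedCone ℚ (NPlusQ N))}
    (hS : IsSimplicialFan S) : ∃ K : Finset (Finset (NPlusQ N)), fan K = S ∧
      IsFanComplex (proj N) (lattice N) K ∧ ∀ t ∈ K, ∀ v ∈ t, IsNormalized v := by
  obtain ⟨g, hg⟩ := exists_normalized_generators N
  have hfin : {ρ ∈ S | ∃ v : NPlusQ N, v ≠ 0 ∧ PointedCone.hull ℚ {v} = ρ}.Finite :=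
    hS.finite.subset fun _ h => h.1
  set G : Finset (NPlusQ N) := hfin.toFinset.image g with hG
  have hGmem : ∀ x, x ∈ G ↔ ∃ v : NPlusQ N, v ≠ 0 ∧ PointedCone.hull ℚ {v} ∈ S ∧
      g (PointedCone.hull ℚ {v}) = x := by
    intro x
    simp only [hG, Finset.mem_image, Set.Finite.mem_toFinset]
    constructor
    · rintro ⟨_, ⟨h1, v, hv, rfl⟩, rfl⟩
      exact ⟨v, hv, h1, rfl⟩
    · rintro ⟨v, hv, h1, rfl⟩
      exact ⟨_, ⟨h1, v, hv, rfl⟩, rfl⟩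
  have hGn : ∀ x ∈ G, IsNormalized x := by
    intro x hx
    obtain ⟨v, hv, -, rfl⟩ := (hGmem x).1 hx
    exact (hg v hv).1
  let T : PointedCone ℚ (NPlusQ N) → Finset (NPlusQ N) := fun σ => G.filter (· ∈ σ)
  have key : ∀ σ ∈ S, cone (T σ) = σ ∧ LinearIndepOn ℚ id (T σ : Set (NPlusQ N)) := by
    intro σ hσ
    obtain ⟨s, hsf, hs, hσs⟩ := hS.simplicial σ hσ
    lift s to Finset (NPlusQ N) using hsf
    change cone s = σ at hσs
    choose! q hq hgq using fun v hv => (hg v hv).2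
    have hs0 : ∀ v ∈ s, v ≠ 0 := fun v hv => hs.ne_zero hv
    have hT : T σ = s.image fun v => q v • v := by
      ext x
      simp only [T, Finset.mem_filter, Finset.mem_image, hGmem]
      constructor
      · rintro ⟨⟨w, hw, hwS, hgx⟩, hx⟩
        rw [hgq w hw] at hgx
        have hwσ : w ∈ σ := by
          have := σ.smul_mem ((inv_pos.2 (hq w hw)).le) hx
          rw [← hgx] at this
          rwa [smul_smul, inv_mul_cancel₀ (hq w hw).ne', one_smul] at this
        have hle : PointedCone.hull ℚ {w} ≤ σ :=
          Submodule.span_le.2 (Set.singleton_subset_iff.2 hwσ)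
        have hf := (hS.inf_face _ hwS σ hσ).2
        rw [inf_eq_left.2 hle, ← hσs] at hf
        obtain ⟨p, hp, hps⟩ := exists_smul_mem_of_isFaceOf hs hw hf
        refine ⟨_, hps, ?_⟩
        rw [← hgq _ (hs0 _ hps), hull_singleton_smul hp, hgq w hw, hgx]
      · rintro ⟨v, hv, rfl⟩
        have hvf := isFaceOf_cone hs (u := {v}) (by simpa using hv)
        rw [hσs, cone, Finset.coe_singleton] at hvf
        refine ⟨⟨v, hs0 v hv, hS.face_mem σ hσ _ hvf, hgq v (hs0 v hv)⟩, ?_⟩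
        rw [← hσs]
        exact (cone s).smul_mem ((hq v (hs0 v hv)).le) (subset_cone hv)
    constructor
    · apply le_antisymm
      · exact cone_le.2 fun v hv => (Finset.mem_filter.1 hv).2
      · conv_lhs => rw [← hσs]
        refine cone_le.2 fun v hv => ?_
        have h1 : q v • v ∈ cone (T σ) := subset_cone (by
          rw [hT]; exact Finset.mem_image_of_mem _ hv)
        have hqv := hq v (hs0 v hv)
        have := (cone (T σ)).smul_mem ((inv_pos.2 hqv).le) h1
        rwa [smul_smul, inv_mul_cancel₀ hqv.ne', one_smul] at this
    · rw [hT, Finset.coe_image]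
      have := LinearIndependent.units_smul (R := ℚ) hs
        (fun v => Units.mk0 (q v) (hq v (hs0 v v.2)).ne')
      exact LinearIndepOn.id_image this
  have hface : ∀ σ ∈ S, ∀ u ⊆ T σ, cone u ∈ S ∧ T (cone u) = u := by
    intro σ hσ u hu
    obtain ⟨h1, h2⟩ := key σ hσ
    have hf := isFaceOf_cone h2 hu
    refine ⟨hS.face_mem σ hσ _ (by rwa [h1] at hf), ?_⟩
    ext x
    refine ⟨fun hx => ?_, fun hx => Finset.mem_filter.2
      ⟨(Finset.mem_filter.1 (hu hx)).1, subset_cone hx⟩⟩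
    obtain ⟨hxG, hxu⟩ := Finset.mem_filter.1 hx
    have hxσ := hf.le hxu
    rw [h1] at hxσ
    exact (mem_cone_iff_mem h2 hu (Finset.mem_filter.2 ⟨hxG, hxσ⟩)).1 hxu
  have hmemK : ∀ t, t ∈ hS.finite.toFinset.image T ↔ ∃ σ ∈ S, T σ = t := by
    simp
  refine ⟨hS.finite.toFinset.image T, ?_, ⟨?_, ?_, ?_⟩, ?_⟩
  · ext σ
    constructor
    · rintro ⟨t, ht, rfl⟩
      obtain ⟨σ, hσ, rfl⟩ := (hmemK t).1 ht
      rwa [(key σ hσ).1]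
    · intro hσ
      exact ⟨T σ, (hmemK _).2 ⟨σ, hσ, rfl⟩, (key σ hσ).1⟩
  · intro s hs u hu
    obtain ⟨σ, hσ, rfl⟩ := (hmemK s).1 hs
    exact (hmemK u).2 ⟨_, hface σ hσ u hu⟩
  · intro a b ha hb has hbs hab
    obtain ⟨σ, hσ, hσa⟩ := (hmemK _).1 has
    obtain ⟨τ, hτ, hτb⟩ := (hmemK _).1 hbs
    have h1 := (mem_cone.2 ⟨a, hσa.ge, ha, rfl⟩ : Finsupp.linearCombination ℚ id a ∈ cone (T σ))
    have h2 := (mem_cone.2 ⟨b, hτb.ge, hb, rfl⟩ : Finsupp.linearCombination ℚ id b ∈ cone (T τ))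
    rw [(key σ hσ).1] at h1
    rw [(key τ hτ).1, ← hab] at h2
    have hf := (hS.inf_face σ hσ τ hτ).1
    nth_rewrite 2 [← (key σ hσ).1] at hf
    -- The common point lies in the face `σ ⊓ τ` of `σ`, so every vertex in the support of `a` lies
    -- in `τ`. Both combinations are therefore supported on the independent vertices of `τ`.
    refine eq_of_linearIndepOn (key τ hτ).2 (fun v hv => ?_) hτb.ge hab
    exact Finset.mem_filter.2 ⟨(Finset.mem_filter.1 (hσa.ge hv)).1,
      (mem_of_linearCombination_mem hf hσa.ge ha ⟨h1, h2⟩ hv).2⟩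
  · intro s hs v hv
    obtain ⟨σ, hσ, rfl⟩ := (hmemK s).1 hs
    exact (hGn v (Finset.mem_filter.1 hv).1).1
  · intro s hs v hv
    obtain ⟨σ, hσ, rfl⟩ := (hmemK s).1 hs
    exact hGn v (Finset.mem_filter.1 hv).1

theorem exists_sequence_of_reflTransGen {α : Type*} {r : α → α → Prop} {a b : α}
    (h : Relation.ReflTransGen r a b) :
    ∃ (k : ℕ) (f : ℕ → α), f 0 = a ∧ f k = b ∧ ∀ i < k, r (f i) (f (i + 1)) := by
  induction h using Relation.ReflTransGen.head_induction_on with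
  | refl => exact ⟨0, fun _ => b, rfl, rfl, by simp⟩
  | @head a c hac _ ih =>
    obtain ⟨k, f, h0, hk, hf⟩ := ih
    refine ⟨k + 1, fun i => Nat.casesOn i a f, rfl, hk, fun i hi => ?_⟩
    cases i with
    | zero =>
      change r a (f 0)
      rwa [h0]
    | succ i => exact hf i (Nat.lt_of_succ_lt_succ hi)

end Initial
end ToricFan

/-! ### Assembly of the theorem -/

theorem mainTheorem3 {N : Type*} [AddCommGroup N] [Module.Free ℤ N] [Module.Finite ℤ N]
    (S : Set (PointedCone ℚ (ToricFan.NPlusQ N))) (hS : ToricFan.IsSimplicialFan S) :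
    ∃ (k : ℕ) (F : ℕ → Set (PointedCone ℚ (ToricFan.NPlusQ N))),
      F 0 = S ∧
      (∀ i < k, ToricFan.IsStarSubdivision (F i) (F (i + 1))) ∧
      (∀ i ≤ k, ToricFan.IsSimplicialFan (F i)) ∧
      ToricFan.IsPiNonsingular (F k) ∧
      ∀ σ ∈ S, ToricFan.IsPiNonsingularCone σ → ∀ i ≤ k, σ ∈ F i := by
  obtain ⟨K, rfl, hK, hn⟩ := hS.exists_isFanComplex
  have hπ := ToricFan.isLatticeProjection_proj N
  obtain ⟨K', hKK', hK'⟩ := ToricFan.exists_isUnimodular hπ hK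
  obtain ⟨k, f, rfl, rfl, hf⟩ := ToricFan.exists_sequence_of_reflTransGen hKK'
  have key : ∀ i ≤ k, ToricFan.IsFanComplex (ToricFan.proj N) (ToricFan.lattice N) (f i) ∧
      (∀ σ ∈ ToricFan.fan (f i), ToricFan.IsPiStrictlyConvex σ) ∧
      ∀ t ∈ f 0, ToricFan.IsUnimodular (ToricFan.proj N) (ToricFan.lattice N) t → t ∈ f i := by
    intro i
    induction i with
    | zero => exact fun _ => ⟨hK, hS.piStrictlyConvex, fun t ht _ => ht⟩
    | succ i ih =>
      intro hi
      obtain ⟨h1, h2, h3⟩ := ih (Nat.le_of_succ_le hi)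
      have hstep := hf i hi
      refine ⟨?_, hstep.isPiStrictlyConvex h1 h2,
        fun t ht hu => hstep.mem_of_isUnimodular hπ h1 (h3 t ht hu) hu⟩
      obtain ⟨c, hc, -, h⟩ := hstep
      rw [h]
      exact h1.subdivide hc
  refine ⟨k, fun i => ToricFan.fan (f i), rfl,
    fun i hi => (hf i hi).isStarSubdivision (key i hi.le).1,
    fun i hi => (key i hi).1.isSimplicialFan (key i hi).2.1, ?_, ?_⟩
  · rintro _ ⟨t, ht, rfl⟩ hσ
    have hKk := (key k le_rfl).1
    exact (hK' t ht ((ToricFan.isPiIndependent_cone (hKk.linearIndepOn ht)).1 hσ)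
      ).isPiNonsingularCone (hKk.linearIndepOn ht) (hKk.integral t ht)
  · rintro _ ⟨t, ht, rfl⟩ hσ i hi
    exact ToricFan.cone_mem_fan ((key i hi).2.2 t ht (ToricFan.isUnimodular_of_isPiNonsingularCone
      (hK.linearIndepOn ht) (fun v hv => (hn t ht v hv).2) hσ))
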